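/- **Setting.** Let $G$ be a reductive group over a field $F$, and let $T$ be the centralizer of a maximal split torus. Parabolic and Levi subgroups are understood to be defined over $F$ and to contain $T$. All objects below depend on $G$ only through its relative root system: finite-dimensional real spaces $a_{T,\mathbb R}^*$ and $a_{T,\mathbb R}$ in duality, with a finite crystallographic root system $\Phi\subset a_{T,\mathbb R}^*$ (not necessarily reduced or spanning) and coroots $\alpha\mapsto\alpha^\vee$. The statement holds for every such system. In these terms: a parabolic subgroup $P$ is a set of roots $\{\alpha\in\Phi:\langle\alpha,H\rangle\ge 0\}$ with $H\in a_{T,\mathbb R}$; its Levi factor is $M_P=P\cap(-P)$; inclusions of subgroups are inclusions of sets of roots; $G$ is $\Phi$ and $T$ is $\emptyset$. For a Levi subgroup $M$, $\mathcal P(M)$ is the set of parabolic subgroups with Levi factor $M$, and $\mathcal F(M)$ the set of those containing $M$. Put $a_{M,\mathbb R}=a_{P,\mathbb R}=\{H:\langle\alpha,H\rangle=0\ \forall\alpha\in M\}$ for $P\in\mathcal P(M)$; one has $a_{T,\mathbb R}=a_{T,\mathbb R}^M\oplus a_{M,\mathbb R}$, where $a^M_{T,\mathbb R}$ is spanned by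 the coroots of $M$. For $P\subset Q$ put $a_P^Q=a_{P,\mathbb R}\cap a_{T,\mathbb R}^{M_Q}$, let $\xi_P^Q$ be the projection of $\xi\in a_{T,\mathbb R}$ on $a_P^Q$ along $a_{T,\mathbb R}^{M_P}\oplus a_{Q,\mathbb R}$, and let $a_M^*=\mathrm{Hom}_{\mathbb R}(a_{M,\mathbb R},\mathbb C)$. It contains $ia_{M,\mathbb R}^*$, the set of purely imaginary forms, and embeds in $\mathrm{Hom}_{\mathbb R}(a_{T,\mathbb R},\mathbb C)$ by extending forms by $0$ on $a_{T,\mathbb R}^M$. For $\lambda\in a_M^*$ and $M\subset M_Q$, $\lambda^Q\in a_M^*$ is $\lambda$ composed with the projection of $a_{M,\mathbb R}$ onto $a_{M,\mathbb R}\cap a_{T,\mathbb R}^{M_Q}$ along $a_{Q,\mathbb R}$. For a Levi subgroup $L\supset M$, $a_M^{L,*}\subset a_M^*$ is the subspace of forms vanishing on $a_{L,\mathbb R}$. For a minimal parabolic subgroup $B\subset P$ with simple roots $\Delta_B$ (the roots of $B$ that are not sums of two roots of $B$), let $\Delta_P^Q$ (resp. $\Delta_P^{Q,\vee}$) be the set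 of projections to $a_{P,\mathbb R}^*$ (resp. $a_{P,\mathbb R}$) of the $\alpha$ (resp. $\alpha^\vee$) for $\alpha\in\Delta_B$, $\alpha\in M_Q$, $\alpha\notin M_P$; it does not depend on $B$. Let $\hat\Delta_P^{Q,\vee}=\{\varpi_\alpha^\vee\}_{\alpha\in\Delta_P^Q}$ be the basis of $a_P^Q$ dual to $\Delta_P^Q$. A missing $Q$ means $Q=G$. $\mathbb Z(S)$ is the group generated by $S$. Fix an integer $q>1$. For $\xi\in a_{T,\mathbb R}$ write $\xi_P^Q=\sum_{v\in\Delta_P^{Q,\vee}}c_v v$ and put $[\xi]_P^Q=\sum_v[c_v]v$, where $[c]$ is the smallest integer $>c$. Define $$\vartheta_P^{Q,\xi}(\lambda)=q^{-\langle\lambda,[\xi]_P^Q\rangle}\prod_{v\in\Delta_P^{Q,\vee}}\frac1{1-q^{-\langle\lambda,v\rangle}},\qquad \hat\vartheta_P^Q(\lambda)=\prod_{\varpi^\vee\in\hat\Delta_P^{Q,\vee}}\frac1{1-q^{-\langle\lambda,\varpi^\vee\rangle}}.$$ Fix a Levi subgroup $M$; the lattice $\Lambda=\frac{2\pi i}{\log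 q}\mathbb Z(\Delta_P)\subset ia_{M,\mathbb R}^*$ does not depend on $P\in\mathcal P(M)$. A *dual triplet* for $M$ is a triplet $(\mathfrak N,b,b')$ with integers $b,b'\ge1$ such that $\mathbb Z(\hat\Delta_P^\vee)\subset\mathbb Z(\hat\Delta_P^{R,\vee})\oplus\frac1b\mathbb Z(\Delta_R^\vee)\subset\frac1{b'}\mathbb Z(\hat\Delta_P^\vee)$ for all $P\in\mathcal P(M)$ and all parabolic $R\supset P$, and $\mathfrak N\subset\Lambda$ is a finite system of representatives of $\Lambda/b'\Lambda$. For $P\in\mathcal P(M)$ and a function $\varphi$ put $$c_{P,\mathfrak N}^{G,\xi}(\varphi,\lambda)=\frac1{|\mathfrak N|}\sum_{\nu\in\mathfrak N}\sum_{R\supset P}(-1)^{\dim a_R^G}\,\hat\vartheta_P^R(\lambda+\nu)\,\varphi((\lambda+\nu)^R)\,\vartheta_R^{G,b\xi}\!\left(\tfrac{\lambda+\nu}b\right).$$ A point $\xi\in a_{T,\mathbb R}$ is *in general position* (with respect to $M$) if for some dual triplet $(\mathfrak N,b,b')$ one has $(b\xi)_Q^G\notin\mathbb Z(\Delta_Q^\vee)$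 for every $Q\in\mathcal F(M)$, $Q\ne G$. $P_1,P_2\in\mathcal P(M)$ are *co-adjacent* if $\Delta_{P_1}\cap\Delta_{P_2}=\Delta_{P_1}\setminus\{\alpha\}$ for some $\alpha\in\Delta_{P_1}$; then there is a unique maximal proper Levi subgroup $L\supset M$ with $P_1\cap L=P_2\cap L$ and $\mathcal P(L)=\{LP_1,LP_2\}$. A *periodic $(G,M)$-cofamily* on a $\Lambda$-invariant open neighbourhood $\Omega$ of $ia_{M,\mathbb R}^*$ in $a_M^*$ is a family $(\varphi_P)_{P\in\mathcal P(M)}$ of $\Lambda$-invariant holomorphic functions on $\Omega$ such that $\varphi_{P_1}=\varphi_{P_2}$ on $a_M^{L,*}\cap\Omega$ whenever $P_1,P_2$ are co-adjacent with associated Levi subgroup $L$. **Theorem.** Let $(\varphi_P)_{P\in\mathcal P(M)}$ be a periodic $(G,M)$-cofamily on $\Omega$. Assume that for each $P$ there are $r>0$ and functions $(\varphi_{P,\alpha})_{\alpha\in\Delta_P}$, meromorphic on $\{z\in\mathbb C:|z|<q^r\}$ and holomorphic outside $z=0$, with $\varphi_P(\lambda)=\prod_{\alpha\in\Delta_P}\varphi_{P,\alpha}(q^{-\langle\lambda,\varpi_\alpha^\vee\rangle})$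 for all $\lambda\in\Omega$ such that $\mathrm{Re}\langle\lambda,\varpi_\alpha^\vee\rangle>-r$ for every $\alpha\in\Delta_P$. Then dual triplets for $M$ exist, and for every $\xi$ in general position there is an open neighbourhood $U\subset\Omega$ of $ia_{M,\mathbb R}^*$ on which - the function $\varphi_M(\lambda)=\sum_{P\in\mathcal P(M)}\hat\vartheta_P^G(\lambda)\varphi_P(\lambda)$ extends holomorphically (across the zeros of the denominators); - for every $P\in\mathcal P(M)$ the functions $c_{P,\mathfrak N}^{G,\xi}(\varphi_P,\lambda)$, for all dual triplets $(\mathfrak N,b,b')$, extend to one and the same holomorphic function $c_P^{G,\xi}(\varphi_P,\lambda)$; - $\displaystyle\varphi_M(\lambda)=\sum_{P\in\mathcal P(M)}c_P^{G,\xi}(\varphi_P,\lambda)$ for all $\lambda\in U$. -/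

import Mathlib

/-!
Combinatorics of parabolic subgroups and periodic `(G, M)`-cofamilies.

A reductive group `G` enters through its relative root system with respect to the maximal split
torus of which `T` is the centralizer: `X` is the real space `a_T^*`, `Y` is `a_T`, and `R` is the
(possibly non-reduced, possibly non-spanning) crystallographic system of roots in `X` and coroots
in `Y`. A parabolic subgroup containing `T` is given by the set of its roots, that is, by a
set of the form `{α | 0 ≤ ⟨α, H⟩}`; its Levi factor containing `T` is given by the roots `α` such
that `α` and `-α` both occur, and inclusions of subgroups are inclusions of sets of roots. The
group `G` is `Set.univ`, the Levi subgroup `T` is `∅`.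
-/

noncomputable section

namespace Cofamily

open Complex

variable {ι X Y : Type*} [AddCommGroup X] [Module ℝ X]

section Parabolic

variable [AddCommGroup Y] [Module ℝ Y] (R : RootPairing ι ℝ X Y)

/-- `P` is (the set of roots of) a parabolic subgroup containing `T`. -/
def IsParabolic (P : Set ι) : Prop :=
  ∃ H : Y, P = {i | 0 ≤ R.toLinearMap (R.root i) H}

/-- The roots of the Levi factor `M_P`. -/
def levi (P : Set ι) : Set ι :=
  {i | i ∈ P ∧ ∃ j ∈ P, R.root j = -R.root i}

/-- `M` is (the set of roots of) a Levi subgroup containing `T`. -/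
def IsLevi (M : Set ι) : Prop := ∃ P, IsParabolic R P ∧ levi R P = M

/-- The set `𝒫(M)` of parabolic subgroups with Levi factor `M`. -/
def parabolicsOfLevi (M : Set ι) : Set (Set ι) := {P | IsParabolic R P ∧ levi R P = M}

/-- The set `ℱ(H)` of parabolic subgroups containing `H` (a Levi or a parabolic subgroup). -/
def parabolicsContaining (H : Set ι) : Set (Set ι) := {Q | IsParabolic R Q ∧ H ⊆ Q}

/-- The simple roots `Δ_B` of a minimal parabolic subgroup `B`: the roots of `B` which are not
sums of two roots of `B`. -/
def minimalSimple (B : Set ι) : Set ι :=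
  {i | i ∈ B ∧ ∀ j ∈ B, ∀ k ∈ B, R.root i ≠ R.root j + R.root k}

/-- The union of the sets `Δ_B^Q ∖ Δ_B^P` over the minimal parabolic subgroups `B ⊆ P`
(the projections of these sets defined below do not depend on `B`). -/
def simpleIdx (P Q : Set ι) : Set ι :=
  {i | i ∈ levi R Q ∧ i ∉ levi R P ∧ ∃ B ∈ parabolicsOfLevi R ∅, B ⊆ P ∧ i ∈ minimalSimple R B}

/-- The space `a_M`, common kernel of the roots of `M` (for `M` a Levi subgroup). -/
def aReal (S : Set ι) : Submodule ℝ Y where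
  carrier := {H | ∀ i ∈ S, R.toLinearMap (R.root i) H = 0}
  add_mem' := fun ha hb i hi => by simp [ha i hi, hb i hi]
  zero_mem' := fun i _ => by simp
  smul_mem' := fun c x hx i hi => by simp [hx i hi]

/-- The space `a_T^M`, spanned by the coroots of `M`. -/
def corootSpan (S : Set ι) : Submodule ℝ Y := Submodule.span ℝ (R.coroot '' S)

variable [Finite ι]

/-- The decomposition `a_T = a_T^M ⊕ a_M`. -/
theorem isCompl_corootSpan (S : Set ι) : IsCompl (corootSpan R S) (aReal R S) := by
  have : Fintype ι := Fintype.ofFinite ι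
  have horth : R.CorootForm.orthogonal (corootSpan R S) = aReal R S := by
    have key : ∀ (i : ι) (H : Y), R.CorootForm (R.coroot i) H = 0 ↔
        R.toLinearMap (R.root i) H = 0 := by
      intro i H
      have h1 : R.CorootForm (R.coroot i) (R.coroot i) * R.toLinearMap (R.root i) H =
          2 * R.CorootForm (R.coroot i) H := by
        have h := congrArg (fun x => R.toLinearMap x H) (R.corootForm_self_smul_root i)
        have h2 : R.toLinearMap (R.CoPolarization (R.coroot i)) H =
            R.CorootForm (R.coroot i) H := by
          rw [R.toLinearMap_apply_CoPolarization]
        simpa only [map_smul, LinearMap.smul_apply, smul_eq_mul, two_smul, map_add,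
          LinearMap.add_apply, h2, two_mul] using h
      have h3 : R.CorootForm (R.coroot i) (R.coroot i) ≠ 0 :=
        (R.flip.rootForm_pos_of_ne_zero (x := R.coroot i)
          (Submodule.subset_span ⟨i, rfl⟩) (R.ne_zero' i)).ne'
      constructor
      · intro h
        rw [h, mul_zero] at h1
        exact (mul_eq_zero.1 h1).resolve_left h3
      · intro h
        rw [h, mul_zero] at h1
        linarith
    ext H
    rw [LinearMap.BilinForm.mem_orthogonal_iff]
    constructor
    · intro h i hi
      exact (key i H).1 (h _ (Submodule.subset_span ⟨i, hi, rfl⟩))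
    · intro h n hn
      change R.CorootForm n H = 0
      refine Submodule.span_induction ?_ ?_ ?_ ?_ hn
      · rintro _ ⟨i, hi, rfl⟩
        exact (key i H).2 (h i hi)
      · simp
      · intro x y _ _ hx hy
        simp [hx, hy]
      · intro c x _ hx
        simp [hx]
  have hrefl : R.CorootForm.IsRefl := LinearMap.IsSymm.isRefl R.flip.rootForm_symmetric
  have hfin : FiniteDimensional ℝ (corootSpan R S) :=
    FiniteDimensional.span_of_finite ℝ (Set.toFinite _)
  have hdisj : Disjoint (corootSpan R S) (R.CorootForm.orthogonal (corootSpan R S)) := by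
    rw [Submodule.disjoint_def]
    intro x hx hx'
    refine R.flip.eq_zero_of_mem_rootSpan_of_rootForm_self_eq_zero ?_
      ((LinearMap.BilinForm.mem_orthogonal_iff.1 hx') x hx)
    exact Submodule.span_mono (Set.image_subset_range _ _) hx
  have hnd := R.CorootForm.nondegenerate_restrict_of_disjoint_orthogonal hrefl hdisj
  rw [← horth]
  refine ⟨hdisj, ?_⟩
  rw [codisjoint_iff, Submodule.eq_top_iff']
  intro x
  let f : Module.Dual ℝ (corootSpan R S) := (R.CorootForm x).domRestrict (corootSpan R S)
  let w := (LinearMap.BilinForm.toDual _ hnd).symm f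
  refine Submodule.mem_sup.2 ⟨w.1, w.2, x - w.1, ?_, by simp⟩
  rw [LinearMap.BilinForm.mem_orthogonal_iff]
  intro n hn
  refine hrefl _ _ ?_
  have h : R.CorootForm w.1 n = R.CorootForm x n :=
    LinearMap.BilinForm.apply_toDual_symm_apply (hB := hnd) f ⟨n, hn⟩
  rw [map_sub, LinearMap.sub_apply, h, sub_self]

/-- The projection of `a_T` onto `a_T^M` along `a_M`. -/
def projUpper (M : Set ι) : Y →ₗ[ℝ] Y :=
  (corootSpan R M).projection (aReal R M) (isCompl_corootSpan R M)

/-- The projection of `a_T` onto `a_M` along `a_T^M`. -/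
def projLower (M : Set ι) : Y →ₗ[ℝ] aReal R M :=
  (aReal R M).projectionOnto (corootSpan R M) (isCompl_corootSpan R M).symm

/-- The projection of `a_T = a_T^P ⊕ a_P^Q ⊕ a_Q` onto `a_P^Q`, for `P ⊆ Q`. -/
def projRel (P Q : Set ι) : Y →ₗ[ℝ] Y := projUpper R (levi R Q) - projUpper R (levi R P)

/-- The space `a_P^Q = a_P ∩ a_T^Q`, for `P ⊆ Q`. -/
def aRel (P Q : Set ι) : Submodule ℝ Y := aReal R (levi R P) ⊓ corootSpan R (levi R Q)

/-- `Δ_P^Q`, as a subset of `a_P^* ⊆ a_T^*`: the projections to `a_P^*` (along the span of the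
roots of `M_P`) of the elements of `Δ_B^Q ∖ Δ_B^P`. -/
def simpleRoots (P Q : Set ι) : Set X :=
  (fun i => R.root i - projUpper R.flip (levi R P) (R.root i)) '' simpleIdx R P Q

/-- `Δ_P^{Q,∨}`, as a subset of `a_P^Q`: the projections to `a_P` (along the span of the
coroots of `M_P`) of the coroots of the elements of `Δ_B^Q ∖ Δ_B^P`. -/
def simpleCoroots (P Q : Set ι) : Set Y :=
  (fun i => R.coroot i - projUpper R (levi R P) (R.coroot i)) '' simpleIdx R P Q

/-- The set of coweights `ϖ_α^∨`, `α ∈ Δ_P^Q`: the basis of `a_P^Q` dual to `Δ_P^Q`. -/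
def coweights (P Q : Set ι) : Set Y :=
  {H | H ∈ aRel R P Q ∧ ∃ α ∈ simpleRoots R P Q, R.toLinearMap α H = 1 ∧
    ∀ β ∈ simpleRoots R P Q, β ≠ α → R.toLinearMap β H = 0}

/-- The coordinates of `x` with respect to a linearly independent finite set `S` whose span
contains `x`. -/
def coords (S : Set Y) (x : Y) : Y → ℝ :=
  Classical.epsilon fun c => x = ∑ᶠ v ∈ S, c v • v

/-- The point `[ξ]_P^Q = ∑ [c_v] v`, where `ξ_P^Q = ∑ c_v v` (sums over `v ∈ Δ_P^{Q,∨}`) and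
`[c]` is the smallest integer `> c`. -/
def bracket (P Q : Set ι) (ξ : Y) : Y :=
  ∑ᶠ v ∈ simpleCoroots R P Q,
    ((⌊coords (simpleCoroots R P Q) (projRel R P Q ξ) v⌋ + 1 : ℤ) : ℝ) • v

/-- `P₁` and `P₂` in `𝒫(M)` are co-adjacent: `Δ_{P₁} ∩ Δ_{P₂} = Δ_{P₁} ∖ {α}` for some
`α ∈ Δ_{P₁}`. -/
def CoAdjacent (P₁ P₂ : Set ι) : Prop :=
  ∃ α ∈ simpleRoots R P₁ Set.univ,
    simpleRoots R P₁ Set.univ ∩ simpleRoots R P₂ Set.univ = simpleRoots R P₁ Set.univ \ {α}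

/-- `L` is a maximal (proper) Levi subgroup containing `M` such that `P₁ ∩ L = P₂ ∩ L` and
`𝒫(L) = {L P₁, L P₂}`, where `L Pᵢ` is the element of `𝒫(L)` containing `Pᵢ`. -/
def IsGluingLevi (M P₁ P₂ L : Set ι) : Prop :=
  IsLevi R L ∧ M ⊆ L ∧ L ≠ Set.univ ∧ (∀ L', IsLevi R L' → L ⊆ L' → L' = L ∨ L' = Set.univ) ∧
    P₁ ∩ L = P₂ ∩ L ∧ ∃ Q₁ Q₂, P₁ ⊆ Q₁ ∧ P₂ ⊆ Q₂ ∧ parabolicsOfLevi R L = {Q₁, Q₂}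

end Parabolic

section Complexified

variable [NormedAddCommGroup Y] [NormedSpace ℝ Y]

/-- The complex space `a_M^*`, realized as the space of real-linear forms `a_M → ℂ`. -/
abbrev aC (R : RootPairing ι ℝ X Y) (M : Set ι) : Type _ := aReal R M →L[ℝ] ℂ

/-- The real subspace `i a_{M,ℝ}^*` of `a_M^*`. -/
def imaginary (R : RootPairing ι ℝ X Y) (M : Set ι) : Set (aC R M) := {l | ∀ H, (l H).re = 0}

variable [FiniteDimensional ℝ Y]

/-- The element of `a_M^*` defined by an element of `a_{T,ℝ}^*`. -/
def toC (R : RootPairing ι ℝ X Y) (M : Set ι) (x : X) : aC R M :=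
  LinearMap.toContinuousLinearMap
    (Complex.ofRealLI.toLinearMap ∘ₗ R.toLinearMap x ∘ₗ (aReal R M).subtype)

/-- The lattice `(2πi / log q) ℤ(Δ_P)` in `i a_{M,ℝ}^*`, for `P ∈ 𝒫(M)`. -/
def periodLattice (R : RootPairing ι ℝ X Y) [Finite ι] (q : ℕ) (M P : Set ι) :
    AddSubgroup (aC R M) :=
  AddSubgroup.closure
    ((fun α => (2 * (Real.pi : ℂ) * I / (Real.log q : ℂ)) • toC R M α) ''
      simpleRoots R P Set.univ)

variable [Finite ι] (R : RootPairing ι ℝ X Y) (q : ℕ) {M : Set ι}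

/-- The inclusion `a_M^* ⊆ a_T^*`: extension of a form on `a_M` by zero on `a_T^M`. -/
def extend (l : aC R M) : Y →L[ℝ] ℂ :=
  l.comp (LinearMap.toContinuousLinearMap (projLower R M))

/-- The projection `λ ↦ λ^Q` of `a_M^*` onto `a_M^{Q,*}` along `a_Q^*`, for `M ⊆ M_Q`:
`λ^Q` is `λ` composed with the projection of `a_M` onto `a_M^Q`. -/
def projC (Q : Set ι) (l : aC R M) : aC R M :=
  ((extend R l).comp (LinearMap.toContinuousLinearMap (projUpper R (levi R Q)))).comp
    (aReal R M).subtypeL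

/-- `q^{-⟨λ, H⟩}`. -/
def qpow (l : aC R M) (H : Y) : ℂ := (q : ℂ) ^ (-(extend R l H))

/-- `ϑ_P^{Q,ξ}(λ)`. -/
def vartheta (P Q : Set ι) (ξ : Y) (l : aC R M) : ℂ :=
  qpow R q l (bracket R P Q ξ) * ∏ᶠ v ∈ simpleCoroots R P Q, 1 / (1 - qpow R q l v)

/-- `ϑ̂_P^Q(λ)`. -/
def varthetaHat (P Q : Set ι) (l : aC R M) : ℂ :=
  ∏ᶠ w ∈ coweights R P Q, 1 / (1 - qpow R q l w)

/-- The set of real points `(1/b) ℤ(S)`. -/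
def scaledLattice (b : ℕ) (S : Set Y) : AddSubgroup Y :=
  AddSubgroup.closure ((fun v => (b : ℝ)⁻¹ • v) '' S)

/-- Dual triplets `(𝔑, b, b')` for `M`. -/
structure IsDualTriplet (M : Set ι) (N : Finset (aC R M)) (b b' : ℕ) : Prop where
  one_le_b : 1 ≤ b
  one_le_b' : 1 ≤ b'
  lattice_le : ∀ P ∈ parabolicsOfLevi R M, ∀ Q ∈ parabolicsContaining R P,
    AddSubgroup.closure (coweights R P Set.univ) ≤
      AddSubgroup.closure (coweights R P Q) ⊔ scaledLattice b (simpleCoroots R Q Set.univ)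
  le_lattice : ∀ P ∈ parabolicsOfLevi R M, ∀ Q ∈ parabolicsContaining R P,
    AddSubgroup.closure (coweights R P Q) ⊔ scaledLattice b (simpleCoroots R Q Set.univ) ≤
      scaledLattice b' (coweights R P Set.univ)
  subset_lattice : ∀ P ∈ parabolicsOfLevi R M, ∀ n ∈ N, n ∈ periodLattice R q M P
  representatives : ∀ P ∈ parabolicsOfLevi R M, ∀ x ∈ periodLattice R q M P,
    ∃! n, n ∈ N ∧ ∃ y ∈ periodLattice R q M P, x - n = b' • y

/-- The function `c_{P,𝔑}^{G,ξ}(φ, λ)` attached to a dual triplet `(𝔑, b, b')`. -/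
def cTriplet (N : Finset (aC R M)) (b : ℕ) (ξ : Y) (P : Set ι) (φ : aC R M → ℂ)
    (l : aC R M) : ℂ :=
  (1 / (N.card : ℂ)) * ∑ n ∈ N, ∑ᶠ Q ∈ parabolicsContaining R P,
    (-1) ^ Module.finrank ℝ (aRel R Q Set.univ) *
      varthetaHat R q P Q (l + n) * φ (projC R Q (l + n)) *
      vartheta R q Q Set.univ ((b : ℝ) • ξ) ((b : ℂ)⁻¹ • (l + n))

/-- No denominator occurring in `c_{P,𝔑}^{G,ξ}(φ, λ)` vanishes at `λ`. -/
def CRegular (N : Finset (aC R M)) (b : ℕ) (P : Set ι) (l : aC R M) : Prop :=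
  ∀ n ∈ N, ∀ Q ∈ parabolicsContaining R P,
    (∀ w ∈ coweights R P Q, qpow R q (l + n) w ≠ 1) ∧
    (∀ v ∈ simpleCoroots R Q Set.univ, qpow R q ((b : ℂ)⁻¹ • (l + n)) v ≠ 1)

/-- `C` is, on the open set `U`, the holomorphic function `c_P^{G,ξ}(φ, ·)`: it is holomorphic
on `U` and, away from the zeros of the denominators, it is given by the formula attached to any
dual triplet for `M`. -/
def IsCFunction (U : Set (aC R M)) (ξ : Y) (P : Set ι) (φ C : aC R M → ℂ) : Prop :=
  DifferentiableOn ℂ C U ∧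
    ∀ (N : Finset (aC R M)) (b b' : ℕ), IsDualTriplet R q M N b b' →
      ∀ l ∈ U, CRegular R q N b P l → C l = cTriplet R q N b ξ P φ l

/-- `Φ` is, on the open set `U`, the holomorphic function
`φ_M(λ) = ∑_{P ∈ 𝒫(M)} ϑ̂_P^G(λ) φ_P(λ)`: it is holomorphic on `U` and given by this formula
away from the zeros of the denominators. -/
def IsPhiM (U : Set (aC R M)) (φ : parabolicsOfLevi R M → aC R M → ℂ) (Φ : aC R M → ℂ) : Prop :=
  DifferentiableOn ℂ Φ U ∧
    ∀ l ∈ U,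
      (∀ P ∈ parabolicsOfLevi R M, ∀ w ∈ coweights R P Set.univ, qpow R q l w ≠ 1) →
      Φ l = ∑ᶠ P : parabolicsOfLevi R M, varthetaHat R q P.1 Set.univ l * φ P l

/-- Periodic `(G, M)`-cofamilies on `Ω`. -/
structure IsPeriodicCofamily (Ω : Set (aC R M)) (φ : parabolicsOfLevi R M → aC R M → ℂ) :
    Prop where
  isOpen : IsOpen Ω
  imaginary_subset : imaginary R M ⊆ Ω
  invariant : ∀ P ∈ parabolicsOfLevi R M, ∀ n ∈ periodLattice R q M P, ∀ l ∈ Ω, l + n ∈ Ω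
  holomorphic : ∀ P, DifferentiableOn ℂ (φ P) Ω
  gluing : ∀ P₁ P₂ : parabolicsOfLevi R M, CoAdjacent R P₁.1 P₂.1 →
    ∀ L, IsGluingLevi R M P₁.1 P₂.1 L →
      ∀ l ∈ Ω, (∀ H : aReal R M, H.1 ∈ aReal R L → l H = 0) → φ P₁ l = φ P₂ l
  periodic : ∀ P : parabolicsOfLevi R M, ∀ n ∈ periodLattice R q M P.1, ∀ l ∈ Ω,
    φ P (l + n) = φ P l

/-- `φ` is of product form: `φ(λ) = ∏_{α ∈ Δ_P} f_α(q^{-⟨λ, ϖ_α^∨⟩})`, where the functions `f_α`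
(indexed here by `w = ϖ_α^∨`) are meromorphic on the disc `|z| < q^r`, `r > 0`, and holomorphic
outside `z = 0`. -/
def IsProductForm (P : Set ι) (Ω : Set (aC R M)) (φ : aC R M → ℂ) : Prop :=
  ∃ r : ℝ, 0 < r ∧ ∃ f : Y → ℂ → ℂ,
    (∀ w ∈ coweights R P Set.univ,
      MeromorphicOn (f w) (Metric.ball 0 ((q : ℝ) ^ r)) ∧
      DifferentiableOn ℂ (f w) (Metric.ball 0 ((q : ℝ) ^ r) \ {0})) ∧
    ∀ l ∈ Ω, (∀ w ∈ coweights R P Set.univ, -r < (extend R l w).re) →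
      φ l = ∏ᶠ w ∈ coweights R P Set.univ, f w (qpow R q l w)

/-- `ξ` is in general position with respect to `M`: for some dual triplet `(𝔑, b, b')` and every
parabolic subgroup `Q ≠ G` containing `M`, the projection of `b ξ` to `a_Q^G` does not belong to
the lattice `ℤ(Δ_Q^∨)`. -/
def GeneralPosition (M : Set ι) (ξ : Y) : Prop :=
  ∃ (N : Finset (aC R M)) (b b' : ℕ), IsDualTriplet R q M N b b' ∧
    ∀ Q ∈ parabolicsContaining R M, Q ≠ Set.univ →
      projRel R Q Set.univ ((b : ℝ) • ξ) ∉ AddSubgroup.closure (simpleCoroots R Q Set.univ)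

end Complexified

end Cofamily

end

/-! Everything is read off from expansions in the characters $H\mapsto q^{-\langle\lambda,H\rangle}$
of lattices in $a_T$. The expansions of $\vartheta$ and $\hat\vartheta$ need not converge near the
imaginary forms, so `RegSum` sums a coefficient function after applying finitely many difference
operators, each of which multiplies a convergent sum by a known nonzero factor. This summation is
linear, has a unique value (`RegSum.unique`), and gives $0$ for a function invariant under a
translation on which the character is nontrivial (`RegSum.zero_of_invariant`). Two computations with
coefficients carry the theorem.

The identity. Fix a proper Levi subgroup $L$. For $Q\in\mathcal P(L)$ the function
$\vartheta_Q^{G,b\xi}(\lambda/b)$ is the regularized sum of the indicator of an open cone with apex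
$\xi$, over a lattice depending only on $L$ (`IsMin.regSum_vartheta`, `scaledLattice_eq`). Give the
cones weights which agree for adjacent $Q$. A path crossing a facet of one cone crosses the same
facet of the adjacent cone from the other side, so the weighted number of cones containing a point
is constant off the walls (`coneCount_const`). General position keeps the lattice off the walls,
hence the weighted sum of the $\vartheta_Q$ is the regularized sum of a constant and vanishes
(`sum_vartheta_eq_zero`). In $\sum_P c_P$ the pairs $P\subset R$ with $R\ne G$ are grouped by
$L=M_R$ and $P\cap L$. Within a group only $\varphi_P(\lambda^R)$ and $\vartheta_R$ vary, and the
cofamily condition says that the values of $\varphi$ agree for adjacent $R$ (`Opp.coAdjacent`,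
`Opp.isGluingLevi`). All these groups cancel, and $R=G$ leaves $\varphi_M$ (`sum_contribution`).

Holomorphy. Write $a_\alpha=f_\alpha(1)$ and let $S_\alpha(k)$ be the partial sums of the Laurent
coefficients of $f_\alpha=\varphi_{P,\alpha}$. The term of $R$ has coefficients equal to a product
over $\alpha\in\Delta_P$, with factor $S_\alpha(\langle\alpha,H\rangle)$ for $\alpha\in M_R$ and
$a_\alpha$ times the indicator of $\varpi_\alpha(H)>\varpi_\alpha(\xi)$ for the others
(`IsMin.regSum_mix`). Averaging over $\mathfrak N$ kills the lattice points outside $\mathbb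
Z(\hat\Delta_P^\vee)$ (`sum_qpow_eq_zero`), and the alternating sum over $R$ becomes the product of
the differences of the two kinds of factor (`IsMin.prod_sub_eq`). The triplet has disappeared. These
coefficients decay exponentially (`IsMin.exists_cCoeff_bound`): a factor fails to be small only if
$\langle\alpha,H\rangle$ and $\varpi_\alpha(H)$ have essentially opposite signs, whereas
$\sum_\alpha c_\alpha\langle\alpha,H\rangle\varpi_\alpha(H)$, with $c_\alpha>0$, is a positive
definite form. So the series converges to a holomorphic function on a tube (`IsMin.exists_tube`),
which by uniqueness of regularized sums equals $c_{P,\mathfrak N}$ for every triplet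
(`exists_cFunction`).

The continuation of $\varphi_M$ is defined as the sum of these functions. It agrees with the
defining formula because both are continuous off the denominators of $\varphi_M$ and coincide at
nearby points where no denominator at all vanishes (`sum_cFunction_eq`). -/

noncomputable section

namespace Cofamily

set_option linter.unusedSectionVars false

open Complex

/-! ### Parabolic sets, minimal parabolics and their simple roots. -/

section Parabolic

variable {ι X Y : Type*} [AddCommGroup X] [Module ℝ X] [AddCommGroup Y] [Module ℝ Y]
  (R : RootPairing ι ℝ X Y)

/-- The parabolic subset attached to `H`. -/
def par (H : Y) : Set ι := {i | 0 ≤ R.root' i H}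

theorem isParabolic_par (H : Y) : IsParabolic R (par R H) := ⟨H, rfl⟩

theorem exists_neg (i : ι) : ∃ j, R.root j = -R.root i :=
  ⟨R.reflectionPerm i i, by simp⟩

theorem levi_par (H : Y) : levi R (par R H) = {i | R.root' i H = 0} := by
  ext i
  constructor
  · rintro ⟨h, j, hj, e⟩
    have hj' : 0 ≤ R.toLinearMap (R.root j) H := hj
    rw [e, map_neg, LinearMap.neg_apply] at hj'
    exact le_antisymm (by linarith) h
  · intro h
    have h0 : R.toLinearMap (R.root i) H = 0 := h
    obtain ⟨j, e⟩ := exists_neg R i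
    refine ⟨ge_of_eq h, j, ?_, e⟩
    change 0 ≤ R.toLinearMap (R.root j) H
    rw [e, map_neg, LinearMap.neg_apply, h0, neg_zero]

theorem levi_subset (P : Set ι) : levi R P ⊆ P := fun _ h => h.1

theorem levi_mono {P Q : Set ι} (h : P ⊆ Q) : levi R P ⊆ levi R Q :=
  fun _ ⟨hi, j, hj, e⟩ => ⟨h hi, j, h hj, e⟩

theorem levi_univ : levi R Set.univ = Set.univ :=
  Set.eq_univ_of_forall fun i => ⟨trivial, (exists_neg R i).imp fun _ e => ⟨trivial, e⟩⟩

theorem par_zero : par R 0 = Set.univ := Set.eq_univ_of_forall fun i => by simp [par]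

theorem isParabolic_univ : IsParabolic R Set.univ := ⟨0, (par_zero R).symm⟩

theorem mem_or_neg_mem {P : Set ι} (hP : IsParabolic R P) (i : ι) :
    i ∈ P ∨ ∃ j ∈ P, R.root j = -R.root i := by
  obtain ⟨H, rfl⟩ := hP
  rcases le_total 0 (R.root' i H) with h | h
  · exact Or.inl h
  · obtain ⟨j, e⟩ := exists_neg R i
    refine Or.inr ⟨j, ?_, e⟩
    change 0 ≤ R.toLinearMap (R.root j) H
    rw [e, map_neg, LinearMap.neg_apply]
    have : R.toLinearMap (R.root i) H ≤ 0 := h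
    linarith

/-- A set of roots of a parabolic contained in the Levi is stable under negation. -/
theorem neg_mem_levi {P : Set ι} {i j : ι} (hi : i ∈ levi R P) (e : R.root j = -R.root i) :
    j ∈ levi R P := by
  obtain ⟨h, k, hk, e'⟩ := hi
  have : j = k := R.root.injective (e.trans e'.symm)
  subst this
  exact ⟨hk, i, h, by rw [e, neg_neg]⟩

/-- The lexicographic combination of `K` (dominant) and `H`. -/
theorem exists_lex [Finite ι] (K H : Y) : ∃ ε : ℝ, 0 < ε ∧ ∀ i,
    (0 ≤ R.root' i (K + ε • H) ↔ 0 < R.root' i K ∨ (R.root' i K = 0 ∧ 0 ≤ R.root' i H)) ∧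
    (R.root' i (K + ε • H) = 0 ↔ R.root' i K = 0 ∧ R.root' i H = 0) := by
  have key : ∀ i : ι, ∀ᶠ ε : ℝ in nhdsWithin 0 (Set.Ioi 0),
      (0 ≤ R.root' i (K + ε • H) ↔ 0 < R.root' i K ∨ (R.root' i K = 0 ∧ 0 ≤ R.root' i H)) ∧
      (R.root' i (K + ε • H) = 0 ↔ R.root' i K = 0 ∧ R.root' i H = 0) := by
    intro i
    have hc : Filter.Tendsto (fun ε : ℝ => R.root' i (K + ε • H)) (nhdsWithin 0 (Set.Ioi 0))
        (nhds (R.root' i K)) := by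
      have : Continuous (fun ε : ℝ => R.root' i (K + ε • H)) := by
        simp only [map_add, map_smul, smul_eq_mul]
        fun_prop
      have h := this.tendsto 0
      simp only [zero_smul, add_zero] at h
      exact h.mono_left nhdsWithin_le_nhds
    rcases lt_trichotomy (R.root' i K) 0 with h | h | h
    · filter_upwards [hc.eventually (gt_mem_nhds h)] with ε hε
      constructor
      · constructor
        · intro h'; linarith
        · rintro (h' | h')
          · linarith
          · exact absurd h'.1 h.ne
      · exact ⟨fun h' => absurd h' hε.ne, fun h' => absurd h'.1 h.ne⟩
    · filter_upwards [self_mem_nhdsWithin] with ε hε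
      have hε : 0 < ε := hε
      simp only [map_add, map_smul, smul_eq_mul, h, zero_add, lt_irrefl, false_or, true_and,
        mul_eq_zero, hε.ne', false_or, and_true]
      exact ⟨fun h' => by simpa [hε] using h', fun h' => by positivity⟩
    · filter_upwards [hc.eventually (lt_mem_nhds h)] with ε hε
      exact ⟨⟨fun _ => Or.inl h, fun _ => hε.le⟩,
        ⟨fun h' => absurd h' hε.ne', fun h' => absurd h'.1 h.ne'⟩⟩
  obtain ⟨ε, h1, h2⟩ := ((Filter.eventually_all.2 key).and self_mem_nhdsWithin).exists
  exact ⟨ε, h2, h1⟩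

/-- The roots of the parabolic attached to `K + ε H` for small positive `ε`. -/
def lex (K H : Y) : Set ι := {i | 0 < R.root' i K ∨ (R.root' i K = 0 ∧ i ∈ par R H)}

theorem exists_par_eq_lex [Finite ι] (K H : Y) : ∃ H', par R H' = lex R K H ∧
    levi R (par R H') = levi R (par R K) ∩ levi R (par R H) := by
  obtain ⟨ε, -, h⟩ := exists_lex R K H
  refine ⟨K + ε • H, Set.ext fun i => (h i).1, ?_⟩
  simp only [levi_par]
  exact Set.ext fun i => (h i).2

theorem isParabolic_lex [Finite ι] (K H : Y) : IsParabolic R (lex R K H) := by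
  obtain ⟨H', h, -⟩ := exists_par_eq_lex R K H
  exact ⟨H', h.symm⟩

theorem levi_lex [Finite ι] (K H : Y) :
    levi R (lex R K H) = levi R (par R K) ∩ levi R (par R H) := by
  obtain ⟨H', h, h'⟩ := exists_par_eq_lex R K H
  rw [← h, h']

theorem lex_subset (K H : Y) : lex R K H ⊆ par R K := by
  rintro i (h | h)
  · exact h.le
  · exact ge_of_eq h.1

/-- The minimal parabolics. -/
def IsMin (B : Set ι) : Prop := B ∈ parabolicsOfLevi R ∅

theorem exists_regular [Finite ι] : ∃ H : Y, ∀ i, R.root' i H ≠ 0 := by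
  have := RootPairing.flip R
  obtain ⟨x, hx⟩ := Submodule.exists_forall_notMem_of_forall_ne_top
    (fun i => LinearMap.ker (R.root' i)) (fun i h => by
      have h2 : R.root' i (R.coroot i) = 0 := by
        have : R.coroot i ∈ LinearMap.ker (R.root' i) := h ▸ trivial
        exact this
      rw [R.root_coroot_two i] at h2
      norm_num at h2)
  exact ⟨x, fun i => hx i⟩

/-- Perturbing the point that defines `P` in a regular direction empties the Levi factor and can
only remove roots from `P`. -/
theorem exists_isMin_subset [Finite ι] {P : Set ι} (hP : IsParabolic R P) :
    ∃ B, IsMin R B ∧ B ⊆ P := by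
  obtain ⟨K, rfl⟩ := hP
  obtain ⟨H, hH⟩ := exists_regular R
  refine ⟨lex R K H, ⟨isParabolic_lex R K H, ?_⟩, lex_subset R K H⟩
  rw [levi_lex, levi_par R H]
  exact Set.eq_empty_of_forall_notMem fun i h => hH i h.2

variable {R}

theorem IsMin.exists_par {B : Set ι} (hB : IsMin R B) :
    ∃ H, B = par R H ∧ ∀ i, R.root' i H ≠ 0 := by
  obtain ⟨⟨H, hH⟩, h⟩ := hB
  refine ⟨H, hH, fun i hi => ?_⟩
  have : i ∈ levi R (par R H) := by rw [levi_par]; exact hi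
  have e : par R H = B := hH.symm
  rw [e, h] at this
  exact this

theorem IsMin.neg_notMem {B : Set ι} (hB : IsMin R B) {i j : ι} (hi : i ∈ B)
    (e : R.root j = -R.root i) : j ∉ B := fun hj => by
  have : i ∈ levi R B := ⟨hi, j, hj, e⟩
  rw [hB.2] at this
  exact this

/-- Away from its Levi, a parabolic is contained in each of its minimal parabolics. -/
theorem IsMin.diff_levi_subset {B P : Set ι} (hB : IsMin R B) (h : B ⊆ P) : P \ levi R P ⊆ B := by
  rintro i ⟨hi, hi'⟩
  rcases mem_or_neg_mem R hB.1 i with h' | ⟨j, hj, e⟩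
  · exact h'
  · exact absurd ⟨hi, j, h hj, e⟩ hi'

section Finite

variable [Finite ι] {B : Set ι}

/-- Evaluation at a regular point is a linear form without zeros on the roots. Through it the
definition of simple roots by indecomposability becomes `IsAddIndecomposable.baseOf`, from which
linear independence and generation are inherited. -/
theorem IsMin.minimalSimple_eq (hB : IsMin R B) : ∃ f : Module.Dual ℝ X,
    (∀ i, f (R.root i) ≠ 0) ∧ B = {i | 0 < f (R.root i)} ∧
      minimalSimple R B = IsAddIndecomposable.baseOf R.root (f : X →+ ℝ) := by
  obtain ⟨H, rfl, hH⟩ := hB.exists_par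
  have e : par R H = {i | 0 < R.toLinearMap.flip H (R.root i)} := by
    ext i
    exact ⟨fun h => lt_of_le_of_ne h (hH i).symm, fun h => show 0 ≤ R.root' i H from le_of_lt h⟩
  refine ⟨R.toLinearMap.flip H, hH, e, ?_⟩
  ext i
  rw [e]
  change _ ↔ IsAddIndecomposable R.root {i | 0 < R.toLinearMap.flip H (R.root i)} i
  simp only [IsAddIndecomposable, R.ne_zero, or_self, imp_false, minimalSimple]
  rfl

variable [R.IsCrystallographic]

theorem IsMin.linearIndepOn_root (hB : IsMin R B) :
    LinearIndepOn ℝ R.root (minimalSimple R B) := by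
  obtain ⟨f, hf, -, e⟩ := hB.minimalSimple_eq
  rw [e]
  exact R.linearIndepOn_root_baseOf' f hf

theorem IsMin.root_mem_closure (hB : IsMin R B) {i : ι} (hi : i ∈ B) :
    R.root i ∈ AddSubmonoid.closure (R.root '' minimalSimple R B) := by
  obtain ⟨f, hf, e', e⟩ := hB.minimalSimple_eq
  rw [e, AddSubmonoid.closure_image_isAddIndecomposable_baseOf]
  rw [e'] at hi
  exact AddSubmonoid.subset_closure ⟨i, hi, rfl⟩

/-- The point defining `Q` is nonnegative on simple roots, so when it kills a sum of simple roots it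
kills every summand. The simple roots in $M_Q$ therefore generate the positive roots of $M_Q$. -/
theorem IsMin.root_mem_closure_levi (hB : IsMin R B) {Q : Set ι} (hQ : IsParabolic R Q)
    (hBQ : B ⊆ Q) {i : ι} (hi : i ∈ B) (hi' : i ∈ levi R Q) :
    R.root i ∈ AddSubmonoid.closure (R.root '' (minimalSimple R B ∩ levi R Q)) := by
  obtain ⟨H, rfl⟩ := hQ
  have e : levi R (par R H) = {i | R.root' i H = 0} := levi_par R H
  change i ∈ levi R (par R H) at hi'
  change B ⊆ par R H at hBQ
  change _ ∈ AddSubmonoid.closure (R.root '' (minimalSimple R B ∩ levi R (par R H)))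
  rw [e] at hi' ⊢
  have key : ∀ x ∈ AddSubmonoid.closure (R.root '' minimalSimple R B),
      0 ≤ R.toLinearMap x H ∧ (R.toLinearMap x H = 0 →
        x ∈ AddSubmonoid.closure (R.root '' (minimalSimple R B ∩ {i | R.root' i H = 0}))) := by
    intro x hx
    induction hx using AddSubmonoid.closure_induction with
    | mem x hx =>
      obtain ⟨j, hj, rfl⟩ := hx
      exact ⟨hBQ hj.1, fun h => AddSubmonoid.subset_closure ⟨j, ⟨hj, h⟩, rfl⟩⟩
    | zero => simp
    | add x y _ _ hx hy =>
      rw [map_add, LinearMap.add_apply]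
      refine ⟨add_nonneg hx.1 hy.1, fun h => add_mem (hx.2 ?_) (hy.2 ?_)⟩
      · linarith [hx.1, hy.1]
      · linarith [hx.1, hy.1]
  exact (key _ (hB.root_mem_closure hi)).2 hi'

theorem IsMin.aReal_levi (hB : IsMin R B) {Q : Set ι} (hQ : IsParabolic R Q) (hBQ : B ⊆ Q) :
    aReal R (levi R Q) = aReal R (minimalSimple R B ∩ levi R Q) := by
  refine le_antisymm (fun H h i hi => h i hi.2) fun H h => ?_
  have key : ∀ x ∈ AddSubmonoid.closure (R.root '' (minimalSimple R B ∩ levi R Q)),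
      R.toLinearMap x H = 0 := by
    intro x hx
    induction hx using AddSubmonoid.closure_induction with
    | mem x hx =>
      obtain ⟨j, hj, rfl⟩ := hx
      exact h j hj
    | zero => simp
    | add x y _ _ hx hy => rw [map_add, LinearMap.add_apply, hx, hy, add_zero]
  intro i hi
  rcases mem_or_neg_mem R hB.1 i with h' | ⟨j, hj, e⟩
  · exact key _ (hB.root_mem_closure_levi hQ hBQ h' hi)
  · have := key _ (hB.root_mem_closure_levi hQ hBQ hj (neg_mem_levi R hi e))
    rwa [e, map_neg, LinearMap.neg_apply, neg_eq_zero] at this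

/-- Both spans are complements of the same common kernel, by `IsMin.aReal_levi`, and one contains
the other; comparable complements coincide. -/
theorem IsMin.corootSpan_levi (hB : IsMin R B) {Q : Set ι} (hQ : IsParabolic R Q) (hBQ : B ⊆ Q) :
    corootSpan R (levi R Q) = corootSpan R (minimalSimple R B ∩ levi R Q) := by
  have h1 := isCompl_corootSpan R (levi R Q)
  have h2 := isCompl_corootSpan R (minimalSimple R B ∩ levi R Q)
  rw [hB.aReal_levi hQ hBQ] at h1
  symm
  refine eq_of_le_of_inf_le_of_sup_le (z := aReal R (minimalSimple R B ∩ levi R Q)) ?_ ?_ ?_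
  · exact Submodule.span_mono (Set.image_mono Set.inter_subset_right)
  · rw [h1.inf_eq_bot]; exact bot_le
  · rw [h2.sup_eq_top]; exact le_top

theorem IsMin.aReal_univ (hB : IsMin R B) :
    aReal R Set.univ = aReal R (minimalSimple R B) := by
  have := hB.aReal_levi (isParabolic_univ R) (Set.subset_univ _)
  rwa [levi_univ, Set.inter_univ] at this

theorem IsMin.corootSpan_univ (hB : IsMin R B) :
    corootSpan R Set.univ = corootSpan R (minimalSimple R B) := by
  have := hB.corootSpan_levi (isParabolic_univ R) (Set.subset_univ _)
  rwa [levi_univ, Set.inter_univ] at this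

end Finite

end Parabolic

end Cofamily

end

noncomputable section

namespace Cofamily

set_option linter.unusedSectionVars false

open Complex

/-! ### Invariant form, fundamental coweights and fundamental weights. -/

section Parabolic

variable {ι X Y : Type*} [AddCommGroup X] [Module ℝ X] [AddCommGroup Y] [Module ℝ Y]
  (R : RootPairing ι ℝ X Y) [Finite ι]

/-- An invariant form on `Y`, positive definite on the span of the coroots. -/
theorem exists_form : ∃ (b : LinearMap.BilinForm ℝ Y) (c : ι → ℝ), (∀ i, 0 < c i) ∧
    (∀ x y, b x y = b y x) ∧
    (∀ i H, b (R.coroot i) H = c i * R.root' i H) ∧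
    ∀ H ∈ corootSpan R Set.univ, H ≠ 0 → 0 < b H H := by
  have : Fintype ι := Fintype.ofFinite ι
  have hpos : ∀ H ∈ corootSpan R Set.univ, H ≠ 0 → 0 < R.CorootForm H H := by
    intro H hH h
    refine R.flip.rootForm_pos_of_ne_zero ?_ h
    rw [corootSpan, Set.image_univ] at hH
    exact hH
  refine ⟨R.CorootForm, fun i => R.CorootForm (R.coroot i) (R.coroot i) / 2, fun i => ?_,
    fun x y => ?_, fun i H => ?_, hpos⟩
  · exact half_pos (hpos _ (Submodule.subset_span ⟨i, trivial, rfl⟩) (R.ne_zero' i))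
  · rw [R.corootForm_apply_apply, R.corootForm_apply_apply]
    exact Finset.sum_congr rfl fun i _ => mul_comm _ _
  · have h := congrArg (fun x => R.toLinearMap x H) (R.corootForm_self_smul_root i)
    have h2 : R.toLinearMap (R.CoPolarization (R.coroot i)) H =
        R.CorootForm (R.coroot i) H := by
      rw [R.toLinearMap_apply_CoPolarization]
    have h1 : R.CorootForm (R.coroot i) (R.coroot i) * R.toLinearMap (R.root i) H =
        2 * R.CorootForm (R.coroot i) H := by
      simpa only [map_smul, LinearMap.smul_apply, smul_eq_mul, two_smul, map_add,
        LinearMap.add_apply, h2, two_mul] using h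
    linarith

/-- The form pairs the span of all coroots with the common kernel of the roots trivially. -/
theorem form_eq_zero {b : LinearMap.BilinForm ℝ Y} {c : ι → ℝ}
    (hb : ∀ i H, b (R.coroot i) H = c i * R.root' i H) {S : Set ι} {x H : Y}
    (hx : x ∈ corootSpan R S) (hH : H ∈ aReal R S) : b x H = 0 := by
  refine Submodule.span_induction ?_ ?_ ?_ ?_ hx
  · rintro _ ⟨i, hi, rfl⟩
    rw [hb, hH i hi, mul_zero]
  · simp
  · intro x y _ _ hx hy
    simp [hx, hy]
  · intro c x _ hx
    simp [hx]

theorem corootSpan_mono {S T : Set ι} (h : S ⊆ T) : corootSpan R S ≤ corootSpan R T :=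
  Submodule.span_mono (Set.image_mono h)

theorem aReal_anti {S T : Set ι} (h : S ⊆ T) : aReal R T ≤ aReal R S :=
  fun _ hH i hi => hH i (h hi)

theorem projUpper_mem (S : Set ι) (y : Y) : projUpper R S y ∈ corootSpan R S :=
  Submodule.projection_apply_mem _ _

theorem sub_projUpper_mem (S : Set ι) (y : Y) : y - projUpper R S y ∈ aReal R S :=
  Submodule.sub_projection_mem (isCompl_corootSpan R S) y

theorem projUpper_of_mem {S : Set ι} {y : Y} (h : y ∈ corootSpan R S) : projUpper R S y = y :=
  Submodule.projection_apply_of_mem_left (isCompl_corootSpan R S) h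

theorem projUpper_of_mem_aReal {S : Set ι} {y : Y} (h : y ∈ aReal R S) : projUpper R S y = 0 :=
  Submodule.projection_apply_of_mem_right (isCompl_corootSpan R S) h

theorem eq_zero_of_mem {S : Set ι} {y : Y} (h : y ∈ corootSpan R S) (h' : y ∈ aReal R S) :
    y = 0 :=
  Submodule.disjoint_def.1 (isCompl_corootSpan R S).disjoint y h h'

theorem root'_projUpper {S : Set ι} {i : ι} (hi : i ∈ S) (y : Y) :
    R.root' i (projUpper R S y) = R.root' i y := by
  have := sub_projUpper_mem R S y i hi
  change R.root' i (y - projUpper R S y) = 0 at this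
  rw [map_sub, sub_eq_zero] at this
  exact this.symm

theorem projLower_apply (S : Set ι) (y : Y) : (projLower R S y : Y) = y - projUpper R S y := by
  have h := Submodule.projection_add_projection_eq_self (isCompl_corootSpan R S) y
  have h2 : (projLower R S y : Y) =
    (aReal R S).projection (corootSpan R S) (isCompl_corootSpan R S).symm y := rfl
  rw [h2, projUpper]
  exact eq_sub_of_add_eq' h

/-- The set of simple roots, as a finset. -/
def simple (B : Set ι) : Finset ι := (Set.toFinite (minimalSimple R B)).toFinset

@[simp] theorem mem_simple {B : Set ι} {i : ι} : i ∈ simple R B ↔ i ∈ minimalSimple R B := by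
  simp [simple]

open Classical in
/-- The fundamental coweights. -/
def cow (B : Set ι) (i : ι) : Y :=
  Classical.epsilon fun w => w ∈ corootSpan R Set.univ ∧
    ∀ j ∈ minimalSimple R B, R.root' j w = if j = i then 1 else 0

open Classical in
/-- The fundamental weights, as forms on `Y`. -/
def wt (B : Set ι) (i : ι) : Module.Dual ℝ Y :=
  Classical.epsilon fun f => (∀ j ∈ minimalSimple R B, f (R.coroot j) = if j = i then 1 else 0) ∧
    ∀ H ∈ aReal R Set.univ, f H = 0

variable {R} {B : Set ι} [R.IsCrystallographic]

/-- The invariant form turns each coroot into a positive multiple of its root, so a relation among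
coroots rescales to one among roots. -/
theorem IsMin.linearIndepOn_coroot (hB : IsMin R B) :
    LinearIndepOn ℝ R.coroot (minimalSimple R B) := by
  obtain ⟨b, c, hc, -, hb, -⟩ := exists_form R
  have h := hB.linearIndepOn_root
  rw [LinearIndepOn, linearIndependent_iff'] at h ⊢
  intro s g hg i hi
  have h2 := h s (fun i => g i * c i) (by
    refine R.toPerfPair.injective ?_
    ext H
    have := congrArg (fun x => b x H) hg
    simp only [map_sum, map_smul, LinearMap.sum_apply, LinearMap.smul_apply, hb, map_zero,
      LinearMap.zero_apply, smul_eq_mul] at this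
    simp only [map_sum, map_smul, LinearMap.sum_apply, LinearMap.smul_apply, map_zero,
      LinearMap.zero_apply, smul_eq_mul, mul_assoc]
    exact this) i hi
  exact (mul_eq_zero.1 h2).resolve_right (hc i).ne'

theorem IsMin.eq_zero (hB : IsMin R B) {H : Y} (hH : H ∈ corootSpan R Set.univ)
    (h : ∀ j ∈ minimalSimple R B, R.root' j H = 0) : H = 0 := by
  refine eq_zero_of_mem R hH ?_
  rw [hB.aReal_univ]
  exact h

open Classical in
theorem IsMin.exists_cow (hB : IsMin R B) (g : ι → ℝ) :
    ∃ w ∈ corootSpan R Set.univ, ∀ j ∈ minimalSimple R B, R.root' j w = g j := by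
  have : Fintype ι := Fintype.ofFinite ι
  let ev : corootSpan R Set.univ →ₗ[ℝ] (minimalSimple R B → ℝ) :=
    LinearMap.pi fun j => (R.root' j).domRestrict _
  have hinj : Function.Injective ev := by
    rw [← LinearMap.ker_eq_bot, LinearMap.ker_eq_bot']
    intro H hH
    exact Subtype.ext (hB.eq_zero H.2 fun j hj => congrFun hH ⟨j, hj⟩)
  have hfin : FiniteDimensional ℝ (corootSpan R Set.univ) :=
    FiniteDimensional.span_of_finite ℝ (Set.toFinite _)
  have hd : Module.finrank ℝ (corootSpan R Set.univ) =
      Module.finrank ℝ (minimalSimple R B → ℝ) := by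
    rw [hB.corootSpan_univ, corootSpan, Set.image_eq_range]
    have := finrank_span_eq_card (hB.linearIndepOn_coroot)
    rw [Module.finrank_fintype_fun_eq_card]
    exact this
  obtain ⟨w, hw⟩ := (LinearMap.injective_iff_surjective_of_finrank_eq_finrank hd).1 hinj
    fun j => g j
  exact ⟨w, w.2, fun j hj => congrFun hw ⟨j, hj⟩⟩

open Classical in
theorem IsMin.cow_spec (hB : IsMin R B) (i : ι) : cow R B i ∈ corootSpan R Set.univ ∧
    ∀ j ∈ minimalSimple R B, R.root' j (cow R B i) = if j = i then 1 else 0 := by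
  obtain ⟨w, hw⟩ := hB.exists_cow fun j => if j = i then 1 else 0
  exact Classical.epsilon_spec (p := fun w => w ∈ corootSpan R Set.univ ∧
    ∀ j ∈ minimalSimple R B, R.root' j w = if j = i then 1 else 0) ⟨w, hw⟩

theorem IsMin.root'_cow_self (hB : IsMin R B) {i : ι} (hi : i ∈ minimalSimple R B) :
    R.root' i (cow R B i) = 1 := by
  rw [(hB.cow_spec i).2 i hi, if_pos rfl]

theorem IsMin.root'_cow_ne (hB : IsMin R B) {i j : ι} (hj : j ∈ minimalSimple R B)
    (h : j ≠ i) : R.root' j (cow R B i) = 0 := by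
  rw [(hB.cow_spec i).2 j hj, if_neg h]

open Classical in
theorem IsMin.wt_spec (hB : IsMin R B) {i : ι} (hi : i ∈ minimalSimple R B) :
    (∀ j ∈ minimalSimple R B, wt R B i (R.coroot j) = if j = i then 1 else 0) ∧
    ∀ H ∈ aReal R Set.univ, wt R B i H = 0 := by
  obtain ⟨b, c, hc, hs, hb, -⟩ := exists_form R
  have h := hB.cow_spec i
  -- The fundamental weight is $c_i^{-1}b(\varpi_i^\vee,\cdot)$: its value at $\alpha_j^\vee$ is
  -- $c_i^{-1}c_j\delta_{ij}$, and it kills the center by orthogonality.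
  refine Classical.epsilon_spec (p := fun f : Module.Dual ℝ Y =>
    (∀ j ∈ minimalSimple R B, f (R.coroot j) = if j = i then 1 else 0) ∧
    ∀ H ∈ aReal R Set.univ, f H = 0) ⟨(c i)⁻¹ • b (cow R B i), fun j hj => ?_, fun H hH => ?_⟩
  · rw [LinearMap.smul_apply, hs, hb, h.2 j hj]
    split_ifs with hij
    · subst hij
      simp [(hc j).ne']
    · simp
  · rw [LinearMap.smul_apply, form_eq_zero R hb h.1 hH, smul_zero]

theorem IsMin.wt_coroot_self (hB : IsMin R B) {i : ι} (hi : i ∈ minimalSimple R B) :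
    wt R B i (R.coroot i) = 1 := by
  rw [(hB.wt_spec hi).1 i hi, if_pos rfl]

theorem IsMin.wt_coroot_ne (hB : IsMin R B) {i j : ι} (hi : i ∈ minimalSimple R B)
    (hj : j ∈ minimalSimple R B) (h : j ≠ i) : wt R B i (R.coroot j) = 0 := by
  rw [(hB.wt_spec hi).1 j hj, if_neg h]

theorem IsMin.wt_aReal (hB : IsMin R B) {i : ι} (hi : i ∈ minimalSimple R B) {H : Y}
    (hH : H ∈ aReal R Set.univ) : wt R B i H = 0 := (hB.wt_spec hi).2 H hH

theorem IsMin.wt_projUpper_univ (hB : IsMin R B) {i : ι} (hi : i ∈ minimalSimple R B) (y : Y) :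
    wt R B i (projUpper R Set.univ y) = wt R B i y := by
  have := hB.wt_aReal hi (sub_projUpper_mem R Set.univ y)
  rw [map_sub, sub_eq_zero] at this
  exact this.symm

theorem IsMin.wt_eq_zero_of_mem (hB : IsMin R B) {i : ι} (hi : i ∈ minimalSimple R B) {S : Set ι}
    (hS : i ∉ S) {y : Y} (hy : y ∈ corootSpan R (minimalSimple R B ∩ S)) : wt R B i y = 0 := by
  refine Submodule.span_induction ?_ ?_ ?_ ?_ hy
  · rintro _ ⟨j, hj, rfl⟩
    exact hB.wt_coroot_ne hi hj.1 fun h => hS (h ▸ hj.2)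
  · simp
  · intro x y _ _ hx hy
    simp [hx, hy]
  · intro c x _ hx
    simp [hx]

theorem IsMin.sum_wt (hB : IsMin R B) {y : Y} (hy : y ∈ corootSpan R Set.univ) :
    ∑ i ∈ simple R B, wt R B i y • R.coroot i = y := by
  rw [hB.corootSpan_univ] at hy
  refine Submodule.span_induction ?_ ?_ ?_ ?_ hy
  · rintro _ ⟨j, hj, rfl⟩
    rw [Finset.sum_eq_single j]
    · rw [hB.wt_coroot_self hj, one_smul]
    · intro i hi hij
      rw [hB.wt_coroot_ne (by simpa using hi) hj hij.symm, zero_smul]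
    · intro h
      exact absurd hj (by simpa using h)
  · simp
  · intro x y _ _ hx hy
    simp only [map_add, add_smul, Finset.sum_add_distrib, hx, hy]
  · intro c x _ hx
    simp only [map_smul, smul_assoc, ← Finset.smul_sum, hx]

theorem IsMin.sum_cow (hB : IsMin R B) {y : Y} (hy : y ∈ corootSpan R Set.univ) :
    ∑ i ∈ simple R B, R.root' i y • cow R B i = y := by
  refine sub_eq_zero.1 (hB.eq_zero (sub_mem (sum_mem fun i _ => Submodule.smul_mem _ _
    (hB.cow_spec i).1) hy) fun j hj => ?_)
  rw [map_sub, map_sum, Finset.sum_eq_single j]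
  · rw [map_smul, hB.root'_cow_self hj, smul_eq_mul, mul_one, sub_self]
  · intro i _ hij
    rw [map_smul, hB.root'_cow_ne hj hij.symm, smul_zero]
  · intro h
    exact absurd hj (by simpa using h)

theorem IsMin.sum_wt_add (hB : IsMin R B) (y : Y) :
    ∃ z ∈ aReal R Set.univ, y = ∑ i ∈ simple R B, wt R B i y • R.coroot i + z := by
  refine ⟨_, sub_projUpper_mem R Set.univ y, ?_⟩
  have := hB.sum_wt (projUpper_mem R Set.univ y)
  rw [Finset.sum_congr rfl fun i hi => by
    rw [← hB.wt_projUpper_univ (by simpa using hi) y], this]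
  abel

/-- The fundamental coweights are positive multiples of the fundamental weights for an
invariant form. -/
theorem IsMin.exists_form_cow (hB : IsMin R B) :
    ∃ (b : LinearMap.BilinForm ℝ Y) (c : ι → ℝ), (∀ i, 0 < c i) ∧
    (∀ x y, b x y = b y x) ∧
    (∀ i H, b (R.coroot i) H = c i * R.root' i H) ∧
    (∀ i ∈ minimalSimple R B, ∀ H, b (cow R B i) H = c i * wt R B i H) ∧
    (∀ H ∈ corootSpan R Set.univ, H ≠ 0 → 0 < b H H) := by
  obtain ⟨b, c, hc, hs, hb, hp⟩ := exists_form R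
  refine ⟨b, c, hc, hs, hb, fun i hi H => ?_, hp⟩
  obtain ⟨z, hz, e⟩ := hB.sum_wt_add H
  have h1 : b (cow R B i) z = 0 := form_eq_zero R hb (hB.cow_spec i).1 hz
  conv_lhs => rw [e]
  rw [map_add, h1, add_zero, map_sum, Finset.sum_eq_single i]
  · rw [map_smul, hs, hb, hB.root'_cow_self hi, smul_eq_mul]
    ring
  · intro j hj hij
    rw [map_smul, hs, hb, hB.root'_cow_ne (by simpa using hj) hij, mul_zero, smul_zero]
  · intro h
    exact absurd hi (by simpa using h)

end Parabolic

end Cofamily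

end

noncomputable section

namespace Cofamily

set_option linter.unusedSectionVars false

open Complex

/-! ### Weyl groups and independence of the minimal parabolic. -/

theorem perm_apply_inv {ι : Type*} (σ : Equiv.Perm ι) (i : ι) : σ (σ⁻¹ i) = i :=
  Equiv.apply_symm_apply σ i

section Parabolic

variable {ι X Y : Type*} [AddCommGroup X] [Module ℝ X] [AddCommGroup Y] [Module ℝ Y]
  (R : RootPairing ι ℝ X Y)

/-- The group of permutations of the roots generated by the reflections in the roots of `S`. -/
def weyl (S : Set ι) : Subgroup (Equiv.Perm ι) := Subgroup.closure (R.reflectionPerm '' S)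

variable {R}

theorem exists_linearEquiv_of_mem_weyl {S : Set ι} {σ : Equiv.Perm ι} (hσ : σ ∈ weyl R S) :
    ∃ w : X ≃ₗ[ℝ] X, ∀ i, R.root (σ i) = w (R.root i) := by
  induction hσ using Subgroup.closure_induction with
  | mem σ h =>
    obtain ⟨β, -, rfl⟩ := h
    exact ⟨R.reflection β, fun i => R.root_reflectionPerm β i⟩
  | one => exact ⟨LinearEquiv.refl ℝ X, fun i => rfl⟩
  | mul σ τ _ _ hσ hτ =>
    obtain ⟨v, hv⟩ := hσ
    obtain ⟨w, hw⟩ := hτ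
    exact ⟨w.trans v, fun i => by
      rw [Equiv.Perm.mul_apply, hv, hw, LinearEquiv.trans_apply]⟩
  | inv σ _ hσ =>
    obtain ⟨v, hv⟩ := hσ
    refine ⟨v.symm, fun i => ?_⟩
    have := hv (σ⁻¹ i)
    rw [perm_apply_inv] at this
    rw [this, LinearEquiv.symm_apply_apply]

theorem exists_point_of_mem_weyl {S : Set ι} {σ : Equiv.Perm ι} (hσ : σ ∈ weyl R S) (H : Y) :
    ∃ H' : Y, ∀ i, R.root' (σ i) H = R.root' i H' := by
  obtain ⟨w, hw⟩ := exists_linearEquiv_of_mem_weyl hσ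
  refine ⟨R.flip.toPerfPair.symm (R.toLinearMap.flip H ∘ₗ w.toLinearMap), fun i => ?_⟩
  have h := R.flip.toPerfPair.apply_symm_apply (R.toLinearMap.flip H ∘ₗ w.toLinearMap)
  have h2 := congrArg (fun f => f (R.root i)) h
  change R.toLinearMap (R.root i) _ = R.toLinearMap (w (R.root i)) H at h2
  rw [RootPairing.root', h2, ← hw]

/-- A reflection changes a root by an integral multiple of the reflecting root, and these changes
accumulate in the lattice spanned by `S`. When `S` lies in a Levi factor $M$, Weyl conjugate roots
thus have the same restriction to $a_M$. -/
theorem mem_closure_of_mem_weyl {S : Set ι} [R.IsCrystallographic] {σ : Equiv.Perm ι}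
    (hσ : σ ∈ weyl R S) (i : ι) :
    R.root (σ i) - R.root i ∈ AddSubgroup.closure (R.root '' S) ∧
      R.coroot (σ i) - R.coroot i ∈ AddSubgroup.closure (R.coroot '' S) := by
  induction hσ using Subgroup.closure_induction generalizing i with
  | mem σ h =>
    obtain ⟨β, hβ, rfl⟩ := h
    rw [R.root_reflectionPerm, R.coroot_reflectionPerm, R.reflection_apply_root,
      R.coreflection_apply_coroot, sub_sub_cancel_left, sub_sub_cancel_left]
    obtain ⟨m, hm⟩ := RootPairing.exists_value (P := R) (S := ℤ) i β
    obtain ⟨n, hn⟩ := RootPairing.exists_value (P := R) (S := ℤ) β i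
    rw [← hm, ← hn]
    constructor
    · have : (algebraMap ℤ ℝ m) • R.root β = m • R.root β := algebraMap_smul _ _ _
      rw [this]
      exact neg_mem (zsmul_mem (AddSubgroup.subset_closure (Set.mem_image_of_mem _ hβ)) m)
    · have : (algebraMap ℤ ℝ n) • R.coroot β = n • R.coroot β := algebraMap_smul _ _ _
      rw [this]
      exact neg_mem (zsmul_mem (AddSubgroup.subset_closure (Set.mem_image_of_mem _ hβ)) n)
  | one => simp
  | mul σ τ _ _ hσ hτ =>
    have h1 := hσ (τ i)
    have h2 := hτ i
    constructor
    · have := add_mem h1.1 h2.1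
      rwa [sub_add_sub_cancel] at this
    · have := add_mem h1.2 h2.2
      rwa [sub_add_sub_cancel] at this
  | inv σ _ hσ =>
    have h := hσ (σ⁻¹ i)
    rw [perm_apply_inv] at h
    constructor
    · have := neg_mem h.1
      rwa [neg_sub] at this
    · have := neg_mem h.2
      rwa [neg_sub] at this

theorem closure_root_subset (S : Set ι) {x : X} (hx : x ∈ AddSubgroup.closure (R.root '' S)) :
    x ∈ corootSpan R.flip S := by
  have : AddSubgroup.closure (R.root '' S) ≤ (corootSpan R.flip S).toAddSubgroup :=
    (AddSubgroup.closure_le _).2 Submodule.subset_span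
  exact this hx

theorem closure_coroot_subset (S : Set ι) {x : Y}
    (hx : x ∈ AddSubgroup.closure (R.coroot '' S)) : x ∈ corootSpan R S := by
  have : AddSubgroup.closure (R.coroot '' S) ≤ (corootSpan R S).toAddSubgroup :=
    (AddSubgroup.closure_le _).2 Submodule.subset_span
  exact this hx

theorem apply_eq_zero_of_mem_flip {S : Set ι} {x : X} (hx : x ∈ corootSpan R.flip S) {H : Y}
    (hH : H ∈ aReal R S) : R.toLinearMap x H = 0 := by
  refine Submodule.span_induction ?_ ?_ ?_ ?_ hx
  · rintro _ ⟨i, hi, rfl⟩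
    exact hH i hi
  · simp
  · intro x y _ _ hx hy
    simp [hx, hy]
  · intro c x _ hx
    simp [hx]

theorem levi_subset_aReal (H : Y) : H ∈ aReal R (levi R (par R H)) := fun i hi => by
  rw [levi_par] at hi
  exact hi

theorem root'_perm_of_mem_weyl [R.IsCrystallographic] {S : Set ι} {σ : Equiv.Perm ι}
    (hσ : σ ∈ weyl R S) {H : Y} (hH : H ∈ aReal R S) (i : ι) :
    R.root' (σ i) H = R.root' i H := by
  have := apply_eq_zero_of_mem_flip (closure_root_subset S (mem_closure_of_mem_weyl hσ i).1) hH
  rwa [map_sub, LinearMap.sub_apply, sub_eq_zero] at this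

variable [Finite ι] [R.IsCrystallographic] {B B' P Q : Set ι}

/-- Minimal parabolics contained in `P` are conjugate under the Weyl group of the Levi of `P`. -/
theorem IsMin.exists_perm (hB : IsMin R B) (hB' : IsMin R B') (hP : IsParabolic R P)
    (h : B ⊆ P) (h' : B' ⊆ P) :
    ∃ σ ∈ weyl R (minimalSimple R B ∩ levi R P), ∀ i, i ∈ B ↔ σ i ∈ B' := by
  have : Fintype ι := Fintype.ofFinite ι
  obtain ⟨H, hH, hr⟩ := hB.exists_par
  obtain ⟨H', hH', hr'⟩ := hB'.exists_par
  obtain ⟨H₀, hH₀⟩ := hP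
  set S := minimalSimple R B ∩ levi R P with hS
  have hH₀S : H₀ ∈ aReal R S := fun i hi => by
    have h2 := hi.2
    rw [hH₀] at h2
    exact levi_subset_aReal H₀ i h2
  -- The conjugating element maximizes this pairing, which amounts to moving a point into the
  -- dominant chamber. Composing with the reflection in $\beta$ lowers the sum by `R.CorootForm
  -- (R.coroot β) H * R.root' β K`, whose first factor is positive; maximality forces
  -- $\langle\beta,K\rangle\ge0$.
  obtain ⟨⟨σ, hσ⟩, hmax⟩ := Finite.exists_max fun σ : weyl R S =>
    ∑ i, R.root' i H * R.root' (σ.1 i) H'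
  obtain ⟨K, hK⟩ := exists_point_of_mem_weyl hσ H'
  have hpos : ∀ β ∈ S, 0 ≤ R.root' β K := by
    intro β hβ
    have h1 := hmax ⟨σ * R.reflectionPerm β, mul_mem hσ (Subgroup.subset_closure ⟨β, hβ, rfl⟩)⟩
    have e : ∀ i, R.root' (σ (R.reflectionPerm β i)) H' =
        R.root' i K - R.pairing i β * R.root' β K := by
      intro i
      rw [hK, RootPairing.root', R.root_reflectionPerm, R.reflection_apply_root, map_sub,
        map_smul]
      rfl
    simp only [Equiv.Perm.mul_apply, e, hK, mul_sub, Finset.sum_sub_distrib] at h1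
    have h2 : ∑ i, R.root' i H * (R.pairing i β * R.root' β K) =
        R.CorootForm (R.coroot β) H * R.root' β K := by
      rw [R.corootForm_apply_apply, Finset.sum_mul]
      refine Finset.sum_congr rfl fun i _ => ?_
      rw [R.root'_coroot_eq_pairing]
      ring
    rw [h2] at h1
    have h3 : 0 < R.CorootForm (R.coroot β) H := by
      have h := congrArg (fun x => R.toLinearMap x H) (R.corootForm_self_smul_root β)
      have h2 : R.toLinearMap (R.CoPolarization (R.coroot β)) H =
          R.CorootForm (R.coroot β) H := by
        rw [R.toLinearMap_apply_CoPolarization]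
      have h1 : R.CorootForm (R.coroot β) (R.coroot β) * R.toLinearMap (R.root β) H =
          2 * R.CorootForm (R.coroot β) H := by
        simpa only [map_smul, LinearMap.smul_apply, smul_eq_mul, two_smul, map_add,
          LinearMap.add_apply, h2, two_mul] using h
      have h3 : 0 < R.CorootForm (R.coroot β) (R.coroot β) :=
        (R.flip.rootForm_pos_of_ne_zero (x := R.coroot β)
          (Submodule.subset_span ⟨β, rfl⟩) (R.ne_zero' β))
      have h4 : 0 < R.root' β H := by
        have : β ∈ par R H := hH ▸ hβ.1.1
        exact lt_of_le_of_ne this (hr β).symm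
      have := mul_pos h3 h4
      have h5 : R.CorootForm (R.coroot β) (R.coroot β) * R.root' β H =
          2 * R.CorootForm (R.coroot β) H := h1
      linarith
    by_contra hneg
    push Not at hneg
    nlinarith
  have hBs : ∀ i ∈ B, σ i ∈ B' := by
    intro i hi
    by_cases hiP : i ∈ levi R P
    · have := hB.root_mem_closure_levi ⟨H₀, hH₀⟩ h hi hiP
      have key : ∀ x ∈ AddSubmonoid.closure (R.root '' S), 0 ≤ R.toLinearMap x K := by
        intro x hx
        induction hx using AddSubmonoid.closure_induction with
        | mem x hx =>
          obtain ⟨j, hj, rfl⟩ := hx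
          exact hpos j hj
        | zero => simp
        | add x y _ _ hx hy =>
          rw [map_add, LinearMap.add_apply]
          exact add_nonneg hx hy
      have h2 := key _ this
      rw [hH']
      change 0 ≤ R.root' (σ i) H'
      rw [hK]
      exact h2
    -- A product of reflections from the Levi factor preserves pairings with the point defining `P`.
    -- So a root of `P` outside the Levi factor stays such a root, and all of those belong to `B'`.
    · refine hB'.diff_levi_subset h' ⟨?_, ?_⟩
      · have := h hi
        rw [hH₀] at this ⊢
        change 0 ≤ R.root' (σ i) H₀
        rw [root'_perm_of_mem_weyl hσ hH₀S]
        exact this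
      · intro h2
        apply hiP
        rw [hH₀] at h2 ⊢
        change i ∈ levi R (par R H₀)
        change σ i ∈ levi R (par R H₀) at h2
        rw [levi_par] at h2 ⊢
        change R.root' (σ i) H₀ = 0 at h2
        rw [root'_perm_of_mem_weyl hσ hH₀S] at h2
        exact h2
  refine ⟨σ, hσ, fun i => ⟨hBs i, fun hi => ?_⟩⟩
  rcases mem_or_neg_mem R hB.1 i with h1 | ⟨j, hj, e⟩
  · exact h1
  · refine absurd (hBs j hj) (hB'.neg_notMem hi ?_)
    obtain ⟨w, hw⟩ := exists_linearEquiv_of_mem_weyl hσ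
    rw [hw, hw, e, map_neg]

theorem minimalSimple_iff_of_perm {S : Set ι} {σ : Equiv.Perm ι} (hσ : σ ∈ weyl R S)
    (h : ∀ i, i ∈ B ↔ σ i ∈ B') (i : ι) :
    i ∈ minimalSimple R B ↔ σ i ∈ minimalSimple R B' := by
  obtain ⟨w, hw⟩ := exists_linearEquiv_of_mem_weyl hσ
  refine and_congr (h i) ⟨fun h1 j hj k hk e => ?_, fun h1 j hj k hk e => ?_⟩
  · refine h1 (σ⁻¹ j) ?_ (σ⁻¹ k) ?_ (w.injective ?_)
    · rwa [h, perm_apply_inv]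
    · rwa [h, perm_apply_inv]
    · rw [map_add, ← hw, ← hw, ← hw, perm_apply_inv, perm_apply_inv, e]
  · refine h1 (σ j) ((h j).1 hj) (σ k) ((h k).1 hk) ?_
    rw [hw, hw, hw, e, map_add]

theorem mem_levi_iff_of_perm {S : Set ι} {σ : Equiv.Perm ι} (hσ : σ ∈ weyl R S)
    (hQ : IsParabolic R Q) (hS : S ⊆ levi R Q) (i : ι) : i ∈ levi R Q ↔ σ i ∈ levi R Q := by
  obtain ⟨K, rfl⟩ := hQ
  have hK : K ∈ aReal R S := aReal_anti R hS (levi_subset_aReal K)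
  change i ∈ levi R (par R K) ↔ σ i ∈ levi R (par R K)
  rw [levi_par]
  change R.root' i K = 0 ↔ R.root' (σ i) K = 0
  rw [root'_perm_of_mem_weyl hσ hK]

/-- Conjugating the minimal parabolic that witnesses `i` back to `B` changes root and coroot only by
elements of the spans of $M_P$, which the projections to $a_P^*$ and $a_P$ forget. Hence a single
`B` computes $\Delta_P^Q$ and $\Delta_P^{Q,\vee}$. -/
theorem IsMin.exists_simple_perm (hB : IsMin R B) (hP : IsParabolic R P) (hQ : IsParabolic R Q)
    (h : B ⊆ P) (hPQ : P ⊆ Q) {i : ι} (hi : i ∈ simpleIdx R P Q) :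
    ∃ j ∈ minimalSimple R B ∩ (levi R Q \ levi R P),
      R.root i - R.root j ∈ corootSpan R.flip (levi R P) ∧
      R.coroot i - R.coroot j ∈ corootSpan R (levi R P) := by
  obtain ⟨h1, h2, B', hB', h', h3⟩ := hi
  obtain ⟨σ, hσ, hσB⟩ := hB.exists_perm hB' hP h h'
  have e : σ (σ⁻¹ i) = i := perm_apply_inv σ i
  have h5 := mem_closure_of_mem_weyl hσ (σ⁻¹ i)
  rw [e] at h5
  refine ⟨σ⁻¹ i, ⟨?_, ?_, ?_⟩, ?_, ?_⟩
  · rwa [minimalSimple_iff_of_perm hσ hσB, e]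
  · rwa [mem_levi_iff_of_perm hσ hQ (Set.inter_subset_right.trans (levi_mono R hPQ)), e]
  · rwa [mem_levi_iff_of_perm hσ hP Set.inter_subset_right, e]
  · exact corootSpan_mono R.flip Set.inter_subset_right (closure_root_subset _ h5.1)
  · exact corootSpan_mono R Set.inter_subset_right (closure_coroot_subset _ h5.2)

theorem IsMin.mem_simpleIdx (hB : IsMin R B) (h : B ⊆ P) {i : ι}
    (hi : i ∈ minimalSimple R B ∩ (levi R Q \ levi R P)) : i ∈ simpleIdx R P Q :=
  ⟨hi.2.1, hi.2.2, B, hB, h, hi.1⟩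

theorem sub_projUpper_eq {S : Set ι} {x y : Y} (h : x - y ∈ corootSpan R S) :
    x - projUpper R S x = y - projUpper R S y := by
  have := projUpper_of_mem R h
  rw [map_sub] at this
  rw [sub_eq_sub_iff_sub_eq_sub, ← this]

theorem IsMin.simpleRoots_eq (hB : IsMin R B) (hP : IsParabolic R P) (hQ : IsParabolic R Q)
    (h : B ⊆ P) (hPQ : P ⊆ Q) : simpleRoots R P Q =
      (fun i => R.root i - projUpper R.flip (levi R P) (R.root i)) ''
        (minimalSimple R B ∩ (levi R Q \ levi R P)) := by
  apply Set.Subset.antisymm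
  · rintro _ ⟨i, hi, rfl⟩
    obtain ⟨j, hj, h1, -⟩ := hB.exists_simple_perm hP hQ h hPQ hi
    exact ⟨j, hj, (sub_projUpper_eq (R := R.flip) h1).symm⟩
  · exact Set.image_mono fun i hi => hB.mem_simpleIdx h hi

theorem IsMin.simpleCoroots_eq (hB : IsMin R B) (hP : IsParabolic R P) (hQ : IsParabolic R Q)
    (h : B ⊆ P) (hPQ : P ⊆ Q) : simpleCoroots R P Q =
      (fun i => R.coroot i - projUpper R (levi R P) (R.coroot i)) ''
        (minimalSimple R B ∩ (levi R Q \ levi R P)) := by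
  apply Set.Subset.antisymm
  · rintro _ ⟨i, hi, rfl⟩
    obtain ⟨j, hj, -, h1⟩ := hB.exists_simple_perm hP hQ h hPQ hi
    exact ⟨j, hj, (sub_projUpper_eq h1).symm⟩
  · exact Set.image_mono fun i hi => hB.mem_simpleIdx h hi

theorem IsMin.closure_coroot_le (hB : IsMin R B) (hB' : IsMin R B') :
    AddSubgroup.closure (R.coroot '' minimalSimple R B') ≤
      AddSubgroup.closure (R.coroot '' minimalSimple R B) := by
  obtain ⟨σ, hσ, hσB⟩ := hB.exists_perm hB' (isParabolic_univ R) (Set.subset_univ _)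
    (Set.subset_univ _)
  rw [AddSubgroup.closure_le]
  rintro _ ⟨i, hi, rfl⟩
  have e : σ (σ⁻¹ i) = i := perm_apply_inv σ i
  have h5 := (mem_closure_of_mem_weyl hσ (σ⁻¹ i)).2
  rw [levi_univ, Set.inter_univ, e] at h5
  have h6 : R.coroot (σ⁻¹ i) ∈ AddSubgroup.closure (R.coroot '' minimalSimple R B) :=
    AddSubgroup.subset_closure ⟨σ⁻¹ i, by rwa [minimalSimple_iff_of_perm hσ hσB, e], rfl⟩
  have := add_mem h5 h6
  rwa [sub_add_cancel] at this

end Parabolic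

end Cofamily

end

noncomputable section

namespace Cofamily

set_option linter.unusedSectionVars false

open Complex

/-! ### Bases of $a_P^Q$ indexed by the simple roots of a fixed minimal parabolic. -/

section Parabolic

variable {ι X Y : Type*} [AddCommGroup X] [Module ℝ X] [AddCommGroup Y] [Module ℝ Y]
  (R : RootPairing ι ℝ X Y) [Finite ι]

/-- The projection of a coroot to `a_Q`. -/
def cor (Q : Set ι) (i : ι) : Y := R.coroot i - projUpper R (levi R Q) (R.coroot i)

/-- The projection of a fundamental coweight to `a_T^Q`. -/
def cowRel (B Q : Set ι) (i : ι) : Y := projUpper R (levi R Q) (cow R B i)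

theorem cor_mem_aReal (Q : Set ι) (i : ι) : cor R Q i ∈ aReal R (levi R Q) :=
  sub_projUpper_mem R _ _

theorem cor_mem_univ (Q : Set ι) (i : ι) : cor R Q i ∈ corootSpan R Set.univ :=
  sub_mem (Submodule.subset_span ⟨i, trivial, rfl⟩)
    (corootSpan_mono R (Set.subset_univ _) (projUpper_mem R _ _))

theorem cor_eq_zero {Q : Set ι} {i : ι} (hi : i ∈ levi R Q) : cor R Q i = 0 := by
  rw [cor, projUpper_of_mem R (Submodule.subset_span ⟨i, hi, rfl⟩), sub_self]

open Classical in
/-- The simple roots in `Δ_P^Q`, as indices. -/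
def simpleRel (B P Q : Set ι) : Finset ι :=
  (simple R B).filter fun i => i ∈ levi R Q ∧ i ∉ levi R P

theorem mem_simpleRel {B P Q : Set ι} {i : ι} :
    i ∈ simpleRel R B P Q ↔ i ∈ minimalSimple R B ∧ i ∈ levi R Q ∧ i ∉ levi R P := by
  simp [simpleRel]

theorem coe_simpleRel {B P Q : Set ι} :
    (simpleRel R B P Q : Set ι) = minimalSimple R B ∩ (levi R Q \ levi R P) := by
  ext i
  simp [mem_simpleRel]

theorem mem_simpleRel_univ {B P : Set ι} {i : ι} :
    i ∈ simpleRel R B P Set.univ ↔ i ∈ minimalSimple R B ∧ i ∉ levi R P := by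
  simp [mem_simpleRel, levi_univ]

variable {R} {B P Q : Set ι} [R.IsCrystallographic]

theorem IsMin.cow_mem_aReal (hB : IsMin R B) (hQ : IsParabolic R Q) (h : B ⊆ Q) {i : ι}
    (hi' : i ∉ levi R Q) : cow R B i ∈ aReal R (levi R Q) := by
  rw [hB.aReal_levi hQ h]
  intro j hj
  exact hB.root'_cow_ne hj.1 fun e => hi' (e ▸ hj.2)

theorem IsMin.cowRel_eq_zero (hB : IsMin R B) (hQ : IsParabolic R Q) (h : B ⊆ Q) {i : ι}
    (hi' : i ∉ levi R Q) : cowRel R B Q i = 0 :=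
  projUpper_of_mem_aReal R (hB.cow_mem_aReal hQ h hi')

theorem root'_cowRel {i j : ι} (hj : j ∈ levi R Q) :
    R.root' j (cowRel R B Q i) = R.root' j (cow R B i) := root'_projUpper R hj _

theorem cowRel_mem (i : ι) : cowRel R B Q i ∈ corootSpan R (levi R Q) := projUpper_mem R _ _

theorem cowRel_mem_univ (i : ι) : cowRel R B Q i ∈ corootSpan R Set.univ :=
  corootSpan_mono R (Set.subset_univ _) (cowRel_mem i)

theorem IsMin.cowRel_univ (hB : IsMin R B) (i : ι) : cowRel R B Set.univ i = cow R B i := by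
  rw [cowRel, levi_univ]
  exact projUpper_of_mem R (hB.cow_spec i).1

theorem IsMin.cowRel_mem_aReal (hB : IsMin R B) (hP : IsParabolic R P) (h : B ⊆ P) (hPQ : P ⊆ Q)
    {i : ι} (hi' : i ∉ levi R P) : cowRel R B Q i ∈ aReal R (levi R P) := by
  rw [hB.aReal_levi hP h]
  intro j hj
  change R.root' j _ = 0
  rw [root'_cowRel (levi_mono R hPQ hj.2)]
  exact hB.root'_cow_ne hj.1 fun e => hi' (e ▸ hj.2)

theorem IsMin.ext_of_levi (hB : IsMin R B) (hQ : IsParabolic R Q) (h : B ⊆ Q) {x y : Y}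
    (hx : x ∈ corootSpan R (levi R Q)) (hy : y ∈ corootSpan R (levi R Q))
    (hxy : ∀ j ∈ minimalSimple R B ∩ levi R Q, R.root' j x = R.root' j y) : x = y := by
  refine sub_eq_zero.1 (eq_zero_of_mem R (sub_mem hx hy) ?_)
  rw [hB.aReal_levi hQ h]
  intro j hj
  change R.root' j _ = 0
  rw [map_sub, hxy j hj, sub_self]

theorem toLinearMap_sub_projUpper {S : Set ι} (x : X) {H : Y} (hH : H ∈ aReal R S) :
    R.toLinearMap (x - projUpper R.flip S x) H = R.toLinearMap x H := by
  rw [map_sub, LinearMap.sub_apply, apply_eq_zero_of_mem_flip (projUpper_mem R.flip S x) hH,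
    sub_zero]

/-- Projecting the coweights of `B` to $a_T^{M_Q}$ keeps their pairings with the roots of $M_Q$, and
these pairings characterize the dual basis. One family `cow R B` thus governs all $B\subset P\subset
Q$. -/
theorem IsMin.coweights_eq (hB : IsMin R B) (hP : IsParabolic R P) (hQ : IsParabolic R Q)
    (h : B ⊆ P) (hPQ : P ⊆ Q) :
    coweights R P Q = cowRel R B Q '' (minimalSimple R B ∩ (levi R Q \ levi R P)) := by
  have hBQ := h.trans hPQ
  ext H
  simp only [coweights, hB.simpleRoots_eq hP hQ h hPQ, Set.mem_ofPred_eq, aRel, Submodule.mem_inf]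
  constructor
  · rintro ⟨⟨h1, h2⟩, _, ⟨i, hi, rfl⟩, h3, h4⟩
    refine ⟨i, hi, hB.ext_of_levi hQ hBQ (cowRel_mem i) h2 fun j hj => ?_⟩
    rw [root'_cowRel hj.2]
    change R.toLinearMap (R.root i - projUpper R.flip (levi R P) (R.root i)) H = 1 at h3
    by_cases hij : j = i
    · subst hij
      rw [hB.root'_cow_self hj.1, ← h3, toLinearMap_sub_projUpper _ h1]
    · rw [hB.root'_cow_ne hj.1 hij]
      by_cases hjP : j ∈ levi R P
      · exact (h1 j hjP).symm
      · have := h4 _ ⟨j, ⟨hj.1, hj.2, hjP⟩, rfl⟩ (fun e => by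
          have e2 := congrArg (fun x => R.toLinearMap x (cowRel R B Q j)) e
          have hm := hB.cowRel_mem_aReal hP h hPQ (i := j) hjP
          simp only [toLinearMap_sub_projUpper _ hm] at e2
          change R.root' j _ = R.root' i _ at e2
          rw [root'_cowRel hj.2, root'_cowRel hi.2.1, hB.root'_cow_self hj.1,
            hB.root'_cow_ne hi.1 (Ne.symm hij)] at e2
          exact one_ne_zero e2)
        change R.toLinearMap (R.root j - projUpper R.flip (levi R P) (R.root j)) H = 0 at this
        rw [toLinearMap_sub_projUpper _ h1] at this
        exact this.symm
  · rintro ⟨i, hi, rfl⟩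
    have hm := hB.cowRel_mem_aReal hP h hPQ (i := i) hi.2.2
    refine ⟨⟨hm, cowRel_mem i⟩, _, ⟨i, hi, rfl⟩, ?_, ?_⟩
    · rw [toLinearMap_sub_projUpper _ hm]
      change R.root' i _ = 1
      rw [root'_cowRel hi.2.1, hB.root'_cow_self hi.1]
    · rintro _ ⟨j, hj, rfl⟩ hne
      rw [toLinearMap_sub_projUpper _ hm]
      change R.root' j _ = 0
      rw [root'_cowRel hj.2.1, hB.root'_cow_ne hj.1]
      rintro rfl
      exact hne rfl

theorem IsMin.injOn_cowRel (hB : IsMin R B) :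
    Set.InjOn (cowRel R B Q) (minimalSimple R B ∩ (levi R Q \ levi R P)) := by
  intro i hi j hj e
  by_contra hij
  have e2 := congrArg (R.root' i) e
  rw [root'_cowRel hi.2.1, root'_cowRel hi.2.1, hB.root'_cow_self hi.1,
    hB.root'_cow_ne hi.1 hij] at e2
  exact one_ne_zero e2

theorem IsMin.coweights_univ_eq (hB : IsMin R B) (hP : IsParabolic R P) (h : B ⊆ P) :
    coweights R P Set.univ = cow R B '' (minimalSimple R B \ levi R P) := by
  rw [hB.coweights_eq hP (isParabolic_univ R) h (Set.subset_univ _), levi_univ,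
    Set.sdiff_eq (Set.univ), Set.univ_inter]
  exact Set.image_congr fun i _ => hB.cowRel_univ i

theorem IsMin.simpleCoroots_univ_eq (hB : IsMin R B) (hQ : IsParabolic R Q) (h : B ⊆ Q) :
    simpleCoroots R Q Set.univ = cor R Q '' (minimalSimple R B \ levi R Q) := by
  rw [hB.simpleCoroots_eq hQ (isParabolic_univ R) h (Set.subset_univ _), levi_univ,
    Set.sdiff_eq (Set.univ), Set.univ_inter]
  rfl

theorem IsMin.wt_cor (hB : IsMin R B) (hQ : IsParabolic R Q) (h : B ⊆ Q) {i : ι}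
    (hi : i ∈ minimalSimple R B) (hi' : i ∉ levi R Q) (j : ι) :
    wt R B i (cor R Q j) = wt R B i (R.coroot j) := by
  have h1 := projUpper_mem R (levi R Q) (R.coroot j)
  rw [hB.corootSpan_levi hQ h] at h1
  rw [cor, map_sub, sub_eq_self]
  have := hB.wt_eq_zero_of_mem hi hi' h1
  exact this

theorem IsMin.injOn_cor (hB : IsMin R B) (hQ : IsParabolic R Q) (h : B ⊆ Q) :
    Set.InjOn (cor R Q) (minimalSimple R B \ levi R Q) := by
  intro i hi j hj e
  by_contra hij
  have e2 := congrArg (wt R B i) e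
  rw [hB.wt_cor hQ h hi.1 hi.2, hB.wt_cor hQ h hi.1 hi.2, hB.wt_coroot_self hi.1,
    hB.wt_coroot_ne hi.1 hj.1 (Ne.symm hij)] at e2
  exact one_ne_zero e2

theorem IsMin.projRel_univ (hB : IsMin R B) (y : Y) :
    projRel R Q Set.univ y = ∑ i ∈ simpleRel R B Q Set.univ, wt R B i y • cor R Q i := by
  obtain ⟨z, hz, e⟩ := hB.sum_wt_add y
  have h1 : projRel R Q Set.univ z = 0 := by
    rw [projRel, LinearMap.sub_apply, levi_univ, projUpper_of_mem_aReal R hz,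
      projUpper_of_mem_aReal R (aReal_anti R (Set.subset_univ _) hz), sub_zero]
  have h2 : ∀ i, projRel R Q Set.univ (R.coroot i) = cor R Q i := fun i => by
    rw [projRel, LinearMap.sub_apply, levi_univ,
      projUpper_of_mem R (Submodule.subset_span (Set.mem_image_of_mem _ (Set.mem_univ i)))]
    rfl
  conv_lhs => rw [e]
  rw [map_add, h1, add_zero, map_sum]
  symm
  classical
  refine Finset.sum_subset_zero_on_sdiff (Finset.filter_subset _ _) (fun i hi => ?_)
    fun i _ => by rw [map_smul, h2]
  rw [Finset.mem_sdiff, mem_simpleRel_univ, mem_simple] at hi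
  have : i ∈ levi R Q := by
    by_contra h3
    exact hi.2 ⟨hi.1, h3⟩
  rw [map_smul, h2, cor_eq_zero R this, smul_zero]

/-- `coords` is an arbitrary choice, but the fundamental weights read off every coefficient, so any
valid choice takes these values. The weights of `B` serve for every $Q\supset B$ because $\varpi_i$
kills the coroots of $M_Q$ if $i\notin M_Q$. -/
theorem IsMin.coords_eq (hB : IsMin R B) (hQ : IsParabolic R Q) (h : B ⊆ Q) (y : Y) {i : ι}
    (hi : i ∈ minimalSimple R B) (hi' : i ∉ levi R Q) :
    coords (simpleCoroots R Q Set.univ) (projRel R Q Set.univ y) (cor R Q i) = wt R B i y := by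
  have key : ∀ c : Y → ℝ, ∑ᶠ v ∈ simpleCoroots R Q Set.univ, c v • v =
      ∑ j ∈ simpleRel R B Q Set.univ, c (cor R Q j) • cor R Q j := by
    intro c
    rw [hB.simpleCoroots_univ_eq hQ h, finsum_mem_image (hB.injOn_cor hQ h)]
    refine finsum_mem_eq_finite_toFinset_sum _ (Set.toFinite _) |>.trans ?_
    refine Finset.sum_congr (Finset.ext fun j => ?_) fun _ _ => rfl
    rw [Set.Finite.mem_toFinset, mem_simpleRel_univ]
    rfl
  have : Nonempty ι := ⟨i⟩
  have hspec := Classical.epsilon_spec (p := fun c : Y → ℝ =>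
    projRel R Q Set.univ y = ∑ᶠ v ∈ simpleCoroots R Q Set.univ, c v • v)
    ⟨fun v => wt R B (Function.invFunOn (cor R Q) (minimalSimple R B \ levi R Q) v) y, by
      rw [key, hB.projRel_univ]
      refine Finset.sum_congr rfl fun j hj => ?_
      rw [mem_simpleRel_univ] at hj
      rw [(hB.injOn_cor hQ h).leftInvOn_invFunOn.eq ⟨hj.1, hj.2⟩]⟩
  rw [key] at hspec
  have e := congrArg (wt R B i) hspec
  have h2 : ∀ g : ι → ℝ, wt R B i (∑ j ∈ simpleRel R B Q Set.univ, g j • cor R Q j) = g i := by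
    intro g
    rw [map_sum, Finset.sum_eq_single i]
    · rw [map_smul, hB.wt_cor hQ h hi hi', hB.wt_coroot_self hi, smul_eq_mul, mul_one]
    · intro j hj hij
      rw [mem_simpleRel_univ] at hj
      rw [map_smul, hB.wt_cor hQ h hi hi', hB.wt_coroot_ne hi hj.1 hij, smul_zero]
    · intro h3
      exact absurd (mem_simpleRel_univ R |>.2 ⟨hi, hi'⟩) h3
  rw [h2] at e
  rw [coords, ← e, hB.projRel_univ, h2]

theorem IsMin.bracket_eq (hB : IsMin R B) (hQ : IsParabolic R Q) (h : B ⊆ Q) (ξ : Y) :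
    bracket R Q Set.univ ξ =
      ∑ i ∈ simpleRel R B Q Set.univ, ((⌊wt R B i ξ⌋ + 1 : ℤ) : ℝ) • cor R Q i := by
  rw [bracket]
  conv_lhs => rw [hB.simpleCoroots_univ_eq hQ h, finsum_mem_image (hB.injOn_cor hQ h)]
  refine finsum_mem_eq_finite_toFinset_sum _ (Set.toFinite _) |>.trans ?_
  refine Finset.sum_congr (Finset.ext fun j => ?_) fun j hj => ?_
  · rw [Set.Finite.mem_toFinset, mem_simpleRel_univ]
    rfl
  · rw [mem_simpleRel_univ] at hj
    rw [← hB.simpleCoroots_univ_eq hQ h, hB.coords_eq hQ h ξ hj.1 hj.2]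

/-- The coweights attached to simple roots outside $M_Q$ form a basis. So $(-1)^{\dim a_Q^G}$ counts
the omitted simple roots, which is the sign of the inclusion-exclusion in `IsMin.prod_sub_eq`. -/
theorem IsMin.finrank_aRel (hB : IsMin R B) (hQ : IsParabolic R Q) (h : B ⊆ Q) :
    Module.finrank ℝ (aRel R Q Set.univ) = (simpleRel R B Q Set.univ).card := by
  have hli : LinearIndependent ℝ (fun i : simpleRel R B Q Set.univ => cow R B i) := by
    rw [linearIndependent_iff']
    intro s g hg i hi
    have e := congrArg (R.root' i) hg
    have hi2 := (mem_simpleRel_univ R).1 i.2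
    rw [map_sum, Finset.sum_eq_single i] at e
    · rwa [map_smul, hB.root'_cow_self hi2.1, map_zero, smul_eq_mul, mul_one] at e
    · intro j _ hij
      rw [map_smul, hB.root'_cow_ne hi2.1 (fun e => hij (Subtype.ext e.symm)), smul_zero]
    · intro h3
      exact absurd hi h3
  have hsp : aRel R Q Set.univ =
      Submodule.span ℝ (Set.range fun i : simpleRel R B Q Set.univ => cow R B i) := by
    apply le_antisymm
    · intro y hy
      rw [aRel, levi_univ] at hy
      rw [← hB.sum_cow hy.2]
      refine sum_mem fun i hi => ?_
      by_cases hiQ : i ∈ levi R Q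
      · have : R.root' i y = 0 := hy.1 i hiQ
        rw [this, zero_smul]
        exact zero_mem _
      · exact Submodule.smul_mem _ _ (Submodule.subset_span
          ⟨⟨i, (mem_simpleRel_univ R).2 ⟨by simpa using hi, hiQ⟩⟩, rfl⟩)
    · rw [Submodule.span_le]
      rintro _ ⟨⟨i, hi⟩, rfl⟩
      rw [mem_simpleRel_univ] at hi
      refine ⟨hB.cow_mem_aReal hQ h hi.2, ?_⟩
      rw [levi_univ]
      exact (hB.cow_spec i).1
  rw [hsp, finrank_span_eq_card hli, Fintype.card_coe]

/-- Parabolics containing `B` are determined by the simple roots in their Levi. -/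
theorem IsMin.parabolic_le (hB : IsMin R B) {Q Q' : Set ι} (hQ : IsParabolic R Q)
    (hQ' : IsParabolic R Q') (h : B ⊆ Q) (h' : B ⊆ Q')
    (e : minimalSimple R B ∩ levi R Q ⊆ levi R Q') : Q ⊆ Q' := by
  intro i hi
  rcases mem_or_neg_mem R hB.1 i with h1 | ⟨j, hj, ej⟩
  · exact h' h1
  · have hj' : j ∈ levi R Q := ⟨h hj, i, hi, by rw [ej, neg_neg]⟩
    have h2 := hB.root_mem_closure_levi hQ h hj hj'
    obtain ⟨H, rfl⟩ := hQ'
    have h3 : ∀ x ∈ AddSubmonoid.closure (R.root '' (minimalSimple R B ∩ levi R Q)),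
        R.toLinearMap x H = 0 := by
      intro x hx
      induction hx using AddSubmonoid.closure_induction with
      | mem x hx =>
        obtain ⟨j, hj, rfl⟩ := hx
        exact levi_subset_aReal H j (e hj)
      | zero => simp
      | add x y _ _ hx hy => rw [map_add, LinearMap.add_apply, hx, hy, add_zero]
    have h4 := h3 _ h2
    rw [ej, map_neg, LinearMap.neg_apply, neg_eq_zero] at h4
    exact ge_of_eq h4

/-- The point with coordinate $0$ at the simple roots in `J` and $1$ at the others defines such a
set. With `IsMin.parabolic_le` this parametrizes the parabolics containing `B` by sets of simple
roots. -/
theorem IsMin.exists_parabolic (hB : IsMin R B) (J : Set ι) :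
    ∃ Q, IsParabolic R Q ∧ B ⊆ Q ∧ ∀ i ∈ minimalSimple R B, i ∈ levi R Q ↔ i ∈ J := by
  classical
  obtain ⟨w, hw, hw'⟩ := hB.exists_cow fun i => if i ∈ J then 0 else 1
  refine ⟨par R w, isParabolic_par R w, fun i hi => ?_, fun i hi => ?_⟩
  · have h3 : ∀ x ∈ AddSubmonoid.closure (R.root '' minimalSimple R B),
        0 ≤ R.toLinearMap x w := by
      intro x hx
      induction hx using AddSubmonoid.closure_induction with
      | mem x hx =>
        obtain ⟨j, hj, rfl⟩ := hx
        have := hw' j hj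
        change 0 ≤ R.root' j w
        rw [this]
        split_ifs <;> norm_num
      | zero => simp
      | add x y _ _ hx hy =>
        rw [map_add, LinearMap.add_apply]
        exact add_nonneg hx hy
    exact h3 _ (hB.root_mem_closure hi)
  · rw [levi_par, Set.mem_ofPred_eq, hw' i hi]
    split_ifs with h <;> simp [h]

end Parabolic

end Cofamily

end

noncomputable section

namespace Cofamily

set_option linter.unusedSectionVars false

open Complex

/-! ### Common denominators for weights and projections. -/

section Parabolic

variable {ι X Y : Type*} [AddCommGroup X] [Module ℝ X] [AddCommGroup Y] [Module ℝ Y]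
  (R : RootPairing ι ℝ X Y) [Finite ι] [R.IsCrystallographic]

theorem exists_pairing_int (i j : ι) : ∃ z : ℤ, R.root' i (R.coroot j) = z := by
  obtain ⟨m, hm⟩ := RootPairing.exists_value (P := R) (S := ℤ) i j
  exact ⟨m, hm.symm⟩

/-- Cramer's rule for the integral matrix of pairings. Its determinant is nonzero because a kernel
vector would lie both in the coroot span and in the common kernel of the roots. -/
theorem exists_denominator_of_linearIndepOn {S : Set ι} (hS : LinearIndepOn ℝ R.coroot S) :
    ∃ d : ℕ, 1 ≤ d ∧ ∀ H ∈ corootSpan R S, (∀ i ∈ S, ∃ z : ℤ, R.root' i H = z) →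
      (d : ℝ) • H ∈ AddSubgroup.closure (R.coroot '' S) := by
  classical
  have : Fintype ι := Fintype.ofFinite ι
  choose p hp using exists_pairing_int R
  let A : Matrix S S ℤ := fun i j => p i j
  have hdet : A.det ≠ 0 := by
    intro h0
    have h1 : (A.map (Int.cast : ℤ → ℝ)).det = 0 := by
      have := (Int.castRingHom ℝ).map_det A
      rw [h0, map_zero] at this
      exact this.symm
    obtain ⟨v, hv, hv'⟩ := Matrix.exists_mulVec_eq_zero_iff.2 h1
    have h2 : ∑ j, v j • R.coroot j = 0 := by
      refine eq_zero_of_mem R (S := S) (sum_mem fun j _ => Submodule.smul_mem _ _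
        (Submodule.subset_span (Set.mem_image_of_mem _ j.2))) fun i hi => ?_
      change R.root' i _ = 0
      rw [map_sum]
      have := congrFun hv' ⟨i, hi⟩
      simp only [Matrix.mulVec, dotProduct, Matrix.map_apply, Pi.zero_apply] at this
      rw [← this]
      refine Finset.sum_congr rfl fun j _ => ?_
      rw [map_smul, hp, smul_eq_mul, mul_comm]
    exact hv (funext fun j => (Fintype.linearIndependent_iff.1 hS) v h2 j)
  refine ⟨A.det.natAbs, Int.natAbs_pos.2 hdet, fun H hH hi => ?_⟩
  rw [corootSpan, Set.image_eq_range, Submodule.mem_span_range_iff_exists_fun] at hH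
  obtain ⟨x, rfl⟩ := hH
  choose z hz using fun i : S => hi i i.2
  have hAx : (A.map (Int.cast : ℤ → ℝ)).mulVec x = fun i => (z i : ℝ) := by
    funext i
    rw [← hz i, map_sum]
    refine Finset.sum_congr rfl fun j _ => ?_
    rw [map_smul, hp, smul_eq_mul, mul_comm]
    rfl
  have hx : ∀ j, ∃ m : ℤ, (A.det : ℝ) * x j = m := by
    intro j
    have h1 : (A.map (Int.cast : ℤ → ℝ)).adjugate.mulVec
        ((A.map (Int.cast : ℤ → ℝ)).mulVec x) = (A.det : ℝ) • x := by
      rw [Matrix.mulVec_mulVec, Matrix.adjugate_mul, Matrix.smul_mulVec, Matrix.one_mulVec]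
      have := (Int.castRingHom ℝ).map_det A
      change (A.det : ℝ) = (A.map (Int.cast : ℤ → ℝ)).det at this
      rw [this]
    have h2 : (A.map (Int.cast : ℤ → ℝ)).adjugate = A.adjugate.map (Int.cast : ℤ → ℝ) :=
      ((Int.castRingHom ℝ).map_adjugate A).symm
    have h3 := congrFun h1 j
    rw [hAx, h2] at h3
    refine ⟨∑ k, A.adjugate j k * z k, ?_⟩
    rw [Pi.smul_apply, smul_eq_mul] at h3
    rw [← h3]
    push_cast
    rfl
  have hx' : ∀ j, ∃ m : ℤ, (A.det.natAbs : ℝ) * x j = m := by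
    intro j
    obtain ⟨m, hm⟩ := hx j
    rcases Int.natAbs_eq A.det with h | h
    · refine ⟨m, ?_⟩
      rw [← hm, ← Int.cast_natCast, ← h]
    · refine ⟨-m, ?_⟩
      push_cast
      have : (A.det.natAbs : ℤ) = -A.det := by omega
      rw [← hm, ← neg_mul, ← Int.cast_natCast, this, Int.cast_neg]
  rw [Finset.smul_sum]
  refine sum_mem fun j _ => ?_
  obtain ⟨m, hm⟩ := hx' j
  rw [smul_smul, hm, Int.cast_smul_eq_zsmul]
  exact zsmul_mem (AddSubgroup.subset_closure (Set.mem_image_of_mem _ j.2)) m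

theorem exists_denominator : ∃ d : ℕ, 1 ≤ d ∧ ∀ S : Set ι, LinearIndepOn ℝ R.coroot S →
    ∀ H ∈ corootSpan R S, (∀ i ∈ S, ∃ z : ℤ, R.root' i H = z) →
      (d : ℝ) • H ∈ AddSubgroup.closure (R.coroot '' S) := by
  classical
  have : Fintype (Set ι) := Fintype.ofFinite _
  have h : ∀ S : Set ι, ∃ d : ℕ, 1 ≤ d ∧ (LinearIndepOn ℝ R.coroot S →
      ∀ H ∈ corootSpan R S, (∀ i ∈ S, ∃ z : ℤ, R.root' i H = z) →
      (d : ℝ) • H ∈ AddSubgroup.closure (R.coroot '' S)) := by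
    intro S
    by_cases hS : LinearIndepOn ℝ R.coroot S
    · obtain ⟨d, h1, h2⟩ := exists_denominator_of_linearIndepOn R hS
      exact ⟨d, h1, fun _ => h2⟩
    · exact ⟨1, le_rfl, fun h => absurd h hS⟩
  choose d h1 h2 using h
  refine ⟨∏ S, d S, Nat.one_le_iff_ne_zero.2 (Finset.prod_ne_zero_iff.2 fun S _ =>
    Nat.one_le_iff_ne_zero.1 (h1 S)), fun S hS H hH hi => ?_⟩
  rw [← Finset.mul_prod_erase _ _ (Finset.mem_univ S), mul_comm, Nat.cast_mul, mul_smul,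
    Nat.cast_smul_eq_nsmul]
  exact nsmul_mem (h2 S hS H hH hi) _

theorem exists_int_of_mem_closure {S : Set Y} {f : Module.Dual ℝ Y}
    (hf : ∀ y ∈ S, ∃ z : ℤ, f y = z) {y : Y} (hy : y ∈ AddSubgroup.closure S) :
    ∃ z : ℤ, f y = z := by
  induction hy using AddSubgroup.closure_induction with
  | mem x hx => exact hf x hx
  | zero => exact ⟨0, by simp⟩
  | add x y _ _ hx hy =>
    obtain ⟨a, ha⟩ := hx
    obtain ⟨b, hb⟩ := hy
    exact ⟨a + b, by rw [map_add, ha, hb]; push_cast; rfl⟩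
  | neg x _ hx =>
    obtain ⟨a, ha⟩ := hx
    exact ⟨-a, by rw [map_neg, ha]; push_cast; rfl⟩

variable {R} {B P Q : Set ι}

theorem IsMin.wt_int (hB : IsMin R B) {i : ι} (hi : i ∈ minimalSimple R B) {y : Y}
    (hy : y ∈ AddSubgroup.closure (R.coroot '' minimalSimple R B)) :
    ∃ z : ℤ, wt R B i y = z := by
  classical
  refine exists_int_of_mem_closure ?_ hy
  rintro _ ⟨j, hj, rfl⟩
  rw [(hB.wt_spec hi).1 j hj]
  exact ⟨if j = i then 1 else 0, by split_ifs <;> simp⟩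

theorem root'_int (i : ι) {S : Set ι} {y : Y} (hy : y ∈ AddSubgroup.closure (R.coroot '' S)) :
    ∃ z : ℤ, R.root' i y = z := by
  refine exists_int_of_mem_closure ?_ hy
  rintro _ ⟨j, -, rfl⟩
  exact exists_pairing_int R i j

theorem IsMin.sum_cow_rel (hB : IsMin R B) {y : Y} (hy : y ∈ aReal R (levi R P))
    (hy' : y ∈ corootSpan R Set.univ) :
    ∑ i ∈ simpleRel R B P Set.univ, R.root' i y • cow R B i = y := by
  classical
  conv_rhs => rw [← hB.sum_cow hy']
  refine Finset.sum_subset_zero_on_sdiff (Finset.filter_subset _ _) (fun i hi => ?_)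
    fun i _ => rfl
  rw [Finset.mem_sdiff, mem_simpleRel_univ, mem_simple] at hi
  have : i ∈ levi R P := by
    by_contra h3
    exact hi.2 ⟨hi.1, h3⟩
  have h0 : R.root' i y = 0 := hy i this
  rw [h0, zero_smul]

theorem IsMin.cow_sub_cowRel (hB : IsMin R B) (i : ι) : cow R B i = cowRel R B Q i +
    ∑ j ∈ simpleRel R B Q Set.univ, wt R B j (cow R B i) • cor R Q j := by
  rw [← hB.projRel_univ, projRel, LinearMap.sub_apply, levi_univ,
    projUpper_of_mem R (hB.cow_spec i).1, cowRel]
  abel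

end Parabolic

/-! ### Complex forms, the period lattice and existence of dual triplets. -/

section Complexified

variable {ι X Y : Type*} [AddCommGroup X] [Module ℝ X] [NormedAddCommGroup Y] [NormedSpace ℝ Y]
  [FiniteDimensional ℝ Y] [Finite ι] (R : RootPairing ι ℝ X Y) {M : Set ι}

theorem extend_of_mem (l : aC R M) {H : Y} (hH : H ∈ aReal R M) : extend R l H = l ⟨H, hH⟩ := by
  change l (projLower R M H) = _
  congr 1
  apply Subtype.ext
  rw [projLower_apply, projUpper_of_mem_aReal R hH, sub_zero]

theorem extend_add (l l' : aC R M) (H : Y) :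
    extend R (l + l') H = extend R l H + extend R l' H := rfl

theorem extend_smul (c : ℂ) (l : aC R M) (H : Y) : extend R (c • l) H = c * extend R l H := rfl

theorem extend_zero (H : Y) : extend R (0 : aC R M) H = 0 := rfl

theorem aC_smul_zero (c : ℂ) : c • (0 : aC R M) = 0 := by
  ext H
  exact mul_zero c

theorem extend_neg (l : aC R M) (H : Y) : extend R (-l) H = -extend R l H := rfl

theorem extend_toC (x : X) {H : Y} (hH : H ∈ aReal R M) :
    extend R (toC R M x) H = (R.toLinearMap x H : ℂ) := by
  rw [extend_of_mem R _ hH]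
  rfl

theorem extend_projC {Q : Set ι} (l : aC R M) {H : Y} (hH : H ∈ aReal R M) :
    extend R (projC R Q l) H = extend R l (projUpper R (levi R Q) H) := by
  rw [extend_of_mem R _ hH]
  rfl

section Lattice

variable {R} [R.IsCrystallographic]

theorem scaled_mem {S : Set Y} {b : ℕ} (hb : 1 ≤ b) {v : Y} (hv : v ∈ S) {c : ℝ}
    (hc : ∃ z : ℤ, b * c = z) : c • v ∈ scaledLattice b S := by
  obtain ⟨z, hz⟩ := hc
  have hb' : (b : ℝ) ≠ 0 := by positivity
  have : c • v = z • ((b : ℝ)⁻¹ • v) := by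
    rw [← Int.cast_smul_eq_zsmul ℝ, smul_smul, ← hz]
    congr 1
    field_simp
  rw [this]
  exact zsmul_mem (AddSubgroup.subset_closure (Set.mem_image_of_mem _ hv)) z

theorem exists_lattice_bounds : ∃ b b' : ℕ, 1 ≤ b ∧ 1 ≤ b' ∧
    ∀ B P Q : Set ι, IsMin R B → IsParabolic R P → IsParabolic R Q → B ⊆ P → P ⊆ Q →
      AddSubgroup.closure (coweights R P Set.univ) ≤
        AddSubgroup.closure (coweights R P Q) ⊔ scaledLattice b (simpleCoroots R Q Set.univ) ∧
      AddSubgroup.closure (coweights R P Q) ⊔ scaledLattice b (simpleCoroots R Q Set.univ) ≤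
        scaledLattice b' (coweights R P Set.univ) := by
  classical
  obtain ⟨d, hd, h⟩ := exists_denominator R
  have hd0 : (d : ℝ) ≠ 0 := by positivity
  -- One factor `d` clears the coordinates $\varpi_j(\varpi_i^\vee)$, whence $b=d$. In the second
  -- inclusion the vectors $\frac1d v$, $v\in\Delta_Q^\vee$, already carry that denominator, and
  -- projecting a coroot to $a_Q$ costs another one, whence $b'=d^2$.
  refine ⟨d, d * d, hd, Nat.one_le_iff_ne_zero.2 (by positivity), ?_⟩
  intro B P Q hB hP hQ hBP hPQ
  have hBQ := hBP.trans hPQ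
  rw [hB.coweights_univ_eq hP hBP, hB.coweights_eq hP hQ hBP hPQ,
    hB.simpleCoroots_univ_eq hQ hBQ]
  have hliQ : LinearIndepOn ℝ R.coroot (minimalSimple R B ∩ levi R Q) :=
    hB.linearIndepOn_coroot.mono Set.inter_subset_left
  constructor
  · rw [AddSubgroup.closure_le]
    rintro _ ⟨i, hi, rfl⟩
    rw [SetLike.mem_coe, hB.cow_sub_cowRel (Q := Q) i]
    refine add_mem ?_ (sum_mem fun j hj => ?_)
    · by_cases hiQ : i ∈ levi R Q
      · exact AddSubgroup.mem_sup_left (AddSubgroup.subset_closure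
          (Set.mem_image_of_mem _ ⟨hi.1, hiQ, hi.2⟩))
      · rw [hB.cowRel_eq_zero hQ hBQ hiQ]
        exact zero_mem _
    · rw [mem_simpleRel_univ] at hj
      have hm : cor R Q j ∈ cor R Q '' (minimalSimple R B \ levi R Q) := ⟨j, hj, rfl⟩
      have h1 := h _ hB.linearIndepOn_coroot (cow R B i)
        (by rw [← hB.corootSpan_univ]; exact (hB.cow_spec i).1) (fun k hk => by
          rw [(hB.cow_spec i).2 k hk]
          exact ⟨if k = i then 1 else 0, by split_ifs <;> simp⟩)
      obtain ⟨z, hz⟩ := hB.wt_int hj.1 h1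
      rw [map_smul, smul_eq_mul] at hz
      exact AddSubgroup.mem_sup_right (scaled_mem hd hm ⟨z, hz⟩)
  · have key : ∀ y ∈ aReal R (levi R P), y ∈ corootSpan R Set.univ →
        (∀ i, ∃ z : ℤ, ((d * d : ℕ) : ℝ) * R.root' i y = z) →
        y ∈ scaledLattice (d * d) (cow R B '' (minimalSimple R B \ levi R P)) := by
      intro y hy hy' hz
      rw [← hB.sum_cow_rel hy hy']
      refine sum_mem fun i hi => ?_
      rw [mem_simpleRel_univ] at hi
      have hm : cow R B i ∈ cow R B '' (minimalSimple R B \ levi R P) := ⟨i, hi, rfl⟩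
      exact scaled_mem (Nat.one_le_iff_ne_zero.2 (by positivity)) hm (hz i)
    refine sup_le ((AddSubgroup.closure_le _).2 ?_) ((AddSubgroup.closure_le _).2 ?_)
    · rintro _ ⟨i, hi, rfl⟩
      refine key _ (hB.cowRel_mem_aReal hP hBP hPQ hi.2.2) (cowRel_mem_univ i) fun k => ?_
      have h1 := h _ hliQ (cowRel R B Q i) (by
          rw [← hB.corootSpan_levi hQ hBQ]; exact cowRel_mem i) (fun k hk => by
          rw [root'_cowRel hk.2, (hB.cow_spec i).2 k hk.1]
          exact ⟨if k = i then 1 else 0, by split_ifs <;> simp⟩)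
      obtain ⟨z, hz⟩ := root'_int k h1
      rw [map_smul, smul_eq_mul] at hz
      exact ⟨d * z, by push_cast; rw [← hz]; ring⟩
    · rintro _ ⟨_, ⟨i, hi, rfl⟩, rfl⟩
      refine key _ (Submodule.smul_mem _ _ (aReal_anti R (levi_mono R hPQ) (cor_mem_aReal R Q i)))
        (Submodule.smul_mem _ _ (cor_mem_univ R Q i)) fun k => ?_
      have h1 := h _ hliQ (projUpper R (levi R Q) (R.coroot i)) (by
          rw [← hB.corootSpan_levi hQ hBQ]; exact projUpper_mem R _ _) (fun k hk => by
          rw [root'_projUpper R hk.2]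
          exact exists_pairing_int R k i)
      obtain ⟨z, hz⟩ := root'_int k h1
      obtain ⟨w, hw⟩ := exists_pairing_int R k i
      rw [map_smul, smul_eq_mul] at hz
      refine ⟨d * w - z, ?_⟩
      rw [map_smul, cor, map_sub, hw, smul_eq_mul]
      push_cast
      rw [← hz]
      field_simp

end Lattice

/-- The constant `2πi / log q`. -/
def period (q : ℕ) : ℂ := 2 * (Real.pi : ℂ) * I / (Real.log q : ℂ)

/-- The lattice generated by the restrictions of all roots. -/
def lat (q : ℕ) (M : Set ι) : AddSubgroup (aC R M) :=
  AddSubgroup.closure (Set.range fun i => period q • toC R M (R.root i))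

variable {R} [R.IsCrystallographic] {B P Q : Set ι}

theorem toC_eq {x y : X} (h : ∀ H ∈ aReal R M, R.toLinearMap x H = R.toLinearMap y H) :
    toC R M x = toC R M y := by
  ext H
  change ((R.toLinearMap x H : ℝ) : ℂ) = ((R.toLinearMap y H : ℝ) : ℂ)
  rw [h H H.2]

theorem toC_add (x y : X) : toC R M (x + y) = toC R M x + toC R M y := by
  ext H
  change ((R.toLinearMap (x + y) H : ℝ) : ℂ) =
    ((R.toLinearMap x H : ℝ) : ℂ) + ((R.toLinearMap y H : ℝ) : ℂ)
  rw [map_add, LinearMap.add_apply]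
  push_cast
  rfl

theorem toC_neg (x : X) : toC R M (-x) = -toC R M x := by
  ext H
  change ((R.toLinearMap (-x) H : ℝ) : ℂ) = -((R.toLinearMap x H : ℝ) : ℂ)
  rw [map_neg, LinearMap.neg_apply]
  push_cast
  rfl

theorem toC_zero : toC R M 0 = 0 := by
  ext H
  change ((R.toLinearMap 0 H : ℝ) : ℂ) = 0
  simp

theorem periodLattice_eq_closure (q : ℕ) (hB : IsMin R B) (hP : P ∈ parabolicsOfLevi R M)
    (h : B ⊆ P) : periodLattice R q M P = AddSubgroup.closure
      ((fun i => period q • toC R M (R.root i)) '' (minimalSimple R B \ levi R P)) := by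
  rw [periodLattice, hB.simpleRoots_eq hP.1 (isParabolic_univ R) h (Set.subset_univ _), levi_univ,
    Set.sdiff_eq (Set.univ), Set.univ_inter, Set.image_image]
  congr 1
  refine Set.image_congr fun i _ => ?_
  rw [period]
  congr 1
  refine toC_eq fun H hH => ?_
  rw [← hP.2] at hH
  exact toLinearMap_sub_projUpper _ hH

/-- Roots are integral combinations of simple roots, and those in $M$ restrict to zero on $a_M$. So
the simple roots outside $M$ generate the restrictions of all roots, a lattice in which `P` no
longer occurs. -/
theorem periodLattice_eq (q : ℕ) (hP : P ∈ parabolicsOfLevi R M) :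
    periodLattice R q M P = lat R q M := by
  obtain ⟨B, hB, h⟩ := exists_isMin_subset R hP.1
  rw [periodLattice_eq_closure q hB hP h]
  apply le_antisymm
  · refine AddSubgroup.closure_mono ?_
    rintro _ ⟨i, -, rfl⟩
    exact ⟨i, rfl⟩
  · rw [lat, AddSubgroup.closure_le]
    have key : ∀ x ∈ AddSubmonoid.closure (R.root '' minimalSimple R B),
        period q • toC R M x ∈ AddSubgroup.closure
        ((fun i => period q • toC R M (R.root i)) '' (minimalSimple R B \ levi R P)) := by
      intro x hx
      induction hx using AddSubmonoid.closure_induction with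
      | mem x hx =>
        obtain ⟨j, hj, rfl⟩ := hx
        by_cases hjP : j ∈ levi R P
        · have : toC R M (R.root j) = toC R M 0 := toC_eq fun H hH => by
            rw [← hP.2] at hH
            rw [hH j hjP, map_zero, LinearMap.zero_apply]
          rw [this, toC_zero, aC_smul_zero]
          exact zero_mem _
        · exact AddSubgroup.subset_closure ⟨j, ⟨hj, hjP⟩, rfl⟩
      | zero =>
        rw [toC_zero, aC_smul_zero]
        exact zero_mem _
      | add x y _ _ hx hy =>
        rw [toC_add, smul_add]
        exact add_mem hx hy
    rintro _ ⟨i, rfl⟩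
    rcases mem_or_neg_mem R hB.1 i with h1 | ⟨j, hj, ej⟩
    · exact key _ (hB.root_mem_closure h1)
    · have := key _ (hB.root_mem_closure hj)
      rw [ej, toC_neg, smul_neg] at this
      exact neg_mem_iff.1 this

theorem IsMin.aC_ext (hB : IsMin R B) (hP : P ∈ parabolicsOfLevi R M)
    {l l' : aC R M} (h0 : ∀ H ∈ aReal R Set.univ, extend R l H = extend R l' H)
    (h1 : ∀ i ∈ minimalSimple R B \ levi R P,
      extend R l (cow R B i) = extend R l' (cow R B i)) : l = l' := by
  ext ⟨H, hH⟩
  rw [← extend_of_mem R l hH, ← extend_of_mem R l' hH]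
  have hz := sub_projUpper_mem R Set.univ H
  set y := projUpper R Set.univ H with hy
  have hyM : y ∈ aReal R (levi R P) := by
    rw [hP.2]
    have : H - (H - y) = y := by abel
    rw [← this]
    exact sub_mem hH (aReal_anti R (Set.subset_univ _) hz)
  have e : H = y + (H - y) := by abel
  rw [e, map_add, map_add, h0 _ hz]
  congr 1
  rw [← hB.sum_cow_rel hyM (projUpper_mem R _ _), map_sum, map_sum]
  refine Finset.sum_congr rfl fun i hi => ?_
  rw [mem_simpleRel_univ] at hi
  rw [map_smul, map_smul, h1 i hi]

theorem period_ne_zero {q : ℕ} (hq : 1 < q) : period q ≠ 0 := by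
  have : 0 < Real.log q := Real.log_pos (by exact_mod_cast hq)
  have h2 : (Real.log q : ℂ) ≠ 0 := by exact_mod_cast this.ne'
  rw [period]
  have := Real.pi_ne_zero
  have h3 : (Real.pi : ℂ) ≠ 0 := by exact_mod_cast this
  exact div_ne_zero (mul_ne_zero (mul_ne_zero two_ne_zero h3) I_ne_zero) h2

theorem extend_lat_center {q : ℕ} {n : aC R M} (hn : n ∈ lat R q M) {H : Y}
    (hH : H ∈ aReal R Set.univ) : extend R n H = 0 := by
  induction hn using AddSubgroup.closure_induction with
  | mem x hx =>
    obtain ⟨i, rfl⟩ := hx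
    have h0 : R.toLinearMap (R.root i) H = 0 := hH i trivial
    rw [extend_smul, extend_toC R _ (aReal_anti R (Set.subset_univ _) hH), h0, ofReal_zero,
      mul_zero]
  | zero => rfl
  | add x y _ _ hx hy => rw [extend_add, hx, hy, add_zero]
  | neg x _ hx => rw [extend_neg, hx, neg_zero]

theorem extend_lat_int {q : ℕ} {n : aC R M} (hn : n ∈ lat R q M) {H : Y} (hHM : H ∈ aReal R M)
    (hH : ∀ i, ∃ z : ℤ, R.root' i H = z) : ∃ z : ℤ, extend R n H = period q * z := by
  induction hn using AddSubgroup.closure_induction with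
  | mem x hx =>
    obtain ⟨i, rfl⟩ := hx
    obtain ⟨z, hz⟩ := hH i
    have hz' : R.toLinearMap (R.root i) H = z := hz
    refine ⟨z, ?_⟩
    rw [extend_smul, extend_toC R _ hHM, hz', ofReal_intCast]
  | zero => exact ⟨0, by simp [extend_zero]⟩
  | add x y _ _ hx hy =>
    obtain ⟨a, ha⟩ := hx
    obtain ⟨b, hb⟩ := hy
    exact ⟨a + b, by rw [extend_add, ha, hb]; push_cast; ring⟩
  | neg x _ hx =>
    obtain ⟨a, ha⟩ := hx
    exact ⟨-a, by rw [extend_neg, ha]; push_cast; ring⟩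

theorem IsMin.root'_cow_int (hB : IsMin R B) (i j : ι) :
    ∃ z : ℤ, R.root' i (cow R B j) = z := by
  classical
  have key : ∀ x ∈ AddSubmonoid.closure (R.root '' minimalSimple R B),
      ∃ z : ℤ, R.toLinearMap x (cow R B j) = z := by
    intro x hx
    induction hx using AddSubmonoid.closure_induction with
    | mem x hx =>
      obtain ⟨k, hk, rfl⟩ := hx
      refine ⟨if k = j then 1 else 0, ?_⟩
      have := (hB.cow_spec j).2 k hk
      rw [RootPairing.root'] at this
      rw [this]
      split_ifs <;> simp
    | zero => exact ⟨0, by simp⟩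
    | add x y _ _ hx hy =>
      obtain ⟨a, ha⟩ := hx
      obtain ⟨b, hb⟩ := hy
      exact ⟨a + b, by rw [map_add, LinearMap.add_apply, ha, hb]; push_cast; rfl⟩
  rcases mem_or_neg_mem R hB.1 i with h1 | ⟨k, hk, ek⟩
  · exact key _ (hB.root_mem_closure h1)
  · obtain ⟨z, hz⟩ := key _ (hB.root_mem_closure hk)
    rw [ek, map_neg, LinearMap.neg_apply] at hz
    exact ⟨-z, by push_cast; rw [← hz, neg_neg]⟩

theorem IsMin.mem_lat (hB : IsMin R B) (hP : P ∈ parabolicsOfLevi R M) (h : B ⊆ P) {q : ℕ}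
    {n : aC R M} (h0 : ∀ H ∈ aReal R Set.univ, extend R n H = 0)
    {z : ι → ℤ} (h1 : ∀ i ∈ minimalSimple R B \ levi R P,
      extend R n (cow R B i) = period q * z i) :
    n = ∑ i ∈ simpleRel R B P Set.univ, z i • (period q • toC R M (R.root i)) ∧
      n ∈ lat R q M := by
  have key : n = ∑ i ∈ simpleRel R B P Set.univ, z i • (period q • toC R M (R.root i)) := by
    have hmem : ∑ i ∈ simpleRel R B P Set.univ, z i • (period q • toC R M (R.root i)) ∈
        lat R q M := sum_mem fun i _ => zsmul_mem (AddSubgroup.subset_closure (Set.mem_range_self i)) _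
    have hsum : ∀ H, extend R (∑ i ∈ simpleRel R B P Set.univ,
        z i • (period q • toC R M (R.root i))) H =
        ∑ i ∈ simpleRel R B P Set.univ, z i * (period q * extend R (toC R M (R.root i)) H) := by
      intro H
      have : ∀ s : Finset ι, extend R (∑ i ∈ s, z i • (period q • toC R M (R.root i))) H =
          ∑ i ∈ s, z i * (period q * extend R (toC R M (R.root i)) H) := by
        classical
        intro s
        induction s using Finset.induction_on with
        | empty => simp [extend_zero]
        | insert a s ha ih =>
          rw [Finset.sum_insert ha, Finset.sum_insert ha, extend_add, ih,
            ← Int.cast_smul_eq_zsmul ℂ, extend_smul, extend_smul]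
      exact this _
    refine hB.aC_ext hP (fun H hH => ?_) fun i hi => ?_
    · rw [h0 H hH, extend_lat_center hmem hH]
    · have hcM : cow R B i ∈ aReal R M := by
        rw [← hP.2]
        exact hB.cow_mem_aReal hP.1 h hi.2
      rw [h1 i hi, hsum, Finset.sum_eq_single i]
      · rw [extend_toC R _ hcM]
        have := hB.root'_cow_self hi.1
        rw [RootPairing.root'] at this
        rw [this]
        push_cast
        ring
      · intro j hj hij
        rw [mem_simpleRel_univ] at hj
        have := hB.root'_cow_ne hj.1 hij
        rw [RootPairing.root'] at this
        rw [extend_toC R _ hcM, this]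
        simp
      · intro h3
        exact absurd ((mem_simpleRel_univ R).2 ⟨hi.1, hi.2⟩) h3
  refine ⟨key, ?_⟩
  rw [key]
  exact sum_mem fun i _ => zsmul_mem (AddSubgroup.subset_closure (Set.mem_range_self i)) _

theorem exists_representatives (hM : IsLevi R M) {q : ℕ} (hq : 1 < q) {b : ℕ} (hb : 1 ≤ b) :
    ∃ N : Finset (aC R M), (∀ n ∈ N, n ∈ lat R q M) ∧
      ∀ x ∈ lat R q M, ∃! n, n ∈ N ∧ ∃ y ∈ lat R q M, x - n = b • y := by
  classical
  obtain ⟨P, hP⟩ := hM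
  change P ∈ parabolicsOfLevi R M at hP
  obtain ⟨B, hB, h⟩ := exists_isMin_subset R hP.1
  have hbz : (b : ℤ) ≠ 0 := by positivity
  have hcM : ∀ i ∈ minimalSimple R B \ levi R P, cow R B i ∈ aReal R M := by
    intro i hi
    rw [← hP.2]
    exact hB.cow_mem_aReal hP.1 h hi.2
  let s := simpleRel R B P Set.univ
  let f : (ι → ℤ) → aC R M := fun z => ∑ i ∈ s, z i • (period q • toC R M (R.root i))
  have hf : ∀ z, f z ∈ lat R q M := fun z =>
    sum_mem fun i _ => zsmul_mem (AddSubgroup.subset_closure (Set.mem_range_self i)) _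
  have hfadd : ∀ z w, f (z + w) = f z + f w := fun z w => by
    simp only [f, Pi.add_apply, add_zsmul, Finset.sum_add_distrib]
  have hfsmul : ∀ z, f (fun i => b * z i) = b • f z := fun z => by
    simp only [f, Finset.smul_sum]
    refine Finset.sum_congr rfl fun i _ => ?_
    rw [mul_zsmul, natCast_zsmul]
  have hfsurj : ∀ x ∈ lat R q M, ∃ z, x = f z ∧
      ∀ i ∈ minimalSimple R B \ levi R P, extend R x (cow R B i) = period q * z i := by
    intro x hx
    have h1 : ∀ i : ι, ∃ z : ℤ, i ∈ minimalSimple R B \ levi R P →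
        extend R x (cow R B i) = period q * z := by
      intro i
      by_cases hi : i ∈ minimalSimple R B \ levi R P
      · obtain ⟨z, hz⟩ := extend_lat_int hx (hcM i hi) (fun j => hB.root'_cow_int j i)
        exact ⟨z, fun _ => hz⟩
      · exact ⟨0, fun h => absurd h hi⟩
    choose z hz using h1
    exact ⟨z, (hB.mem_lat hP h (fun H hH => extend_lat_center hx hH) hz).1, hz⟩
  have hfext : ∀ z, ∀ i ∈ minimalSimple R B \ levi R P,
      extend R (f z) (cow R B i) = period q * z i := by
    intro z i hi
    have key : ∀ t : Finset ι, extend R (∑ j ∈ t, z j • (period q • toC R M (R.root j)))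
        (cow R B i) = ∑ j ∈ t, z j * (period q * (R.root' j (cow R B i) : ℂ)) := by
      intro t
      induction t using Finset.induction_on with
      | empty => simp [extend_zero]
      | insert a t ha ih =>
        rw [Finset.sum_insert ha, Finset.sum_insert ha, extend_add, ih,
          ← Int.cast_smul_eq_zsmul ℂ, extend_smul, extend_smul, extend_toC R _ (hcM i hi)]
    rw [key, Finset.sum_eq_single i]
    · rw [hB.root'_cow_self hi.1]
      push_cast
      ring
    · intro j hj hij
      rw [hB.root'_cow_ne ((mem_simpleRel_univ R).1 hj).1 hij]
      simp
    · intro h3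
      exact absurd ((mem_simpleRel_univ R).2 ⟨hi.1, hi.2⟩) h3
  have hfcongr : ∀ z w, (∀ i ∈ s, z i = w i) → f z = f w := fun z w e =>
    Finset.sum_congr rfl fun i hi => by rw [e i hi]
  -- In coordinates with respect to the restricted simple roots, the representatives are the vectors
  -- with entries in $[0,b)$; existence and uniqueness are division with remainder.
  refine ⟨(Fintype.piFinset fun _ : s => Finset.range b).image fun k =>
    f fun i => if hi : i ∈ s then k ⟨i, hi⟩ else 0, ?_, ?_⟩
  · intro n hn
    obtain ⟨k, -, rfl⟩ := Finset.mem_image.1 hn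
    exact hf _
  · intro x hx
    obtain ⟨z, rfl, hz⟩ := hfsurj x hx
    refine ⟨f fun i => z i % b, ⟨?_, f fun i => z i / b, hf _, ?_⟩, ?_⟩
    · refine Finset.mem_image.2 ⟨fun i => (z i % b).toNat, ?_, ?_⟩
      · rw [Fintype.mem_piFinset]
        intro i
        rw [Finset.mem_range]
        have h1 := Int.emod_nonneg (z i) hbz
        have h2 := Int.emod_lt_of_pos (z i) (by positivity : (0 : ℤ) < b)
        omega
      · refine hfcongr _ _ fun i hi => ?_
        rw [dif_pos hi]
        exact Int.toNat_of_nonneg (Int.emod_nonneg (z i) hbz)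
    · rw [← hfsmul, sub_eq_iff_eq_add', ← hfadd]
      refine hfcongr _ _ fun i _ => ?_
      exact (Int.emod_add_mul_ediv (z i) b).symm
    · rintro n ⟨hn, y, hy, e⟩
      obtain ⟨k, hk, rfl⟩ := Finset.mem_image.1 hn
      obtain ⟨w, rfl, hw⟩ := hfsurj y hy
      refine hfcongr _ _ fun i hi => ?_
      have hi' := (mem_simpleRel_univ R).1 hi
      rw [sub_eq_iff_eq_add, ← hfsmul, ← hfadd] at e
      have e2 := congrArg (fun l => extend R l (cow R B i)) e
      simp only [hfext _ i hi', Pi.add_apply, dif_pos hi] at e2 ⊢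
      have e3 := mul_left_cancel₀ (period_ne_zero hq) e2
      have e4 : z i = b * w i + k ⟨i, hi⟩ := by exact_mod_cast e3
      have h5 := Finset.mem_range.1 (Fintype.mem_piFinset.1 hk ⟨i, hi⟩)
      rw [e4, Int.add_comm, Int.add_mul_emod_self_left]
      exact (Int.emod_eq_of_lt (by positivity) (by exact_mod_cast h5)).symm

theorem exists_isDualTriplet (hM : IsLevi R M) {q : ℕ} (hq : 1 < q) :
    ∃ (N : Finset (aC R M)) (b b' : ℕ), IsDualTriplet R q M N b b' := by
  obtain ⟨b, b', hb, hb', h⟩ := exists_lattice_bounds (R := R)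
  obtain ⟨N, hN, hN'⟩ := exists_representatives hM hq hb'
  refine ⟨N, b, b', hb, hb', fun P hP Q hQ => ?_, fun P hP Q hQ => ?_, fun P hP => ?_,
    fun P hP => ?_⟩
  · obtain ⟨B, hB, hBP⟩ := exists_isMin_subset R hP.1
    exact (h B P Q hB hP.1 hQ.1 hBP hQ.2).1
  · obtain ⟨B, hB, hBP⟩ := exists_isMin_subset R hP.1
    exact (h B P Q hB hP.1 hQ.1 hBP hQ.2).2
  · rw [periodLattice_eq q hP]
    exact hN
  · rw [periodLattice_eq q hP]
    exact hN'

end Complexified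

end Cofamily

end

noncomputable section

namespace Cofamily

set_option linter.unusedSectionVars false

open Complex

/-! ### Regularized summation against a character. -/

section RegSum

variable {Γ Γ' : Type*} [AddCommGroup Γ] [AddCommGroup Γ']

/-- Iterated difference operators. -/
def diffs : List (Γ × ℂ) → (Γ → ℂ) → Γ → ℂ
  | [], A => A
  | v :: l, A => diffs l fun H => A H - v.2 * A (H - v.1)

/-- `A` has regularized sum `s` with respect to the character `χ`: some product of difference
operators, acting injectively on multiples of `χ`, makes `A χ` summable. -/
def RegSum (χ : Γ → ℂ) (A : Γ → ℂ) (s : ℂ) : Prop :=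
  ∃ l : List (Γ × ℂ), (∀ v ∈ l, v.2 * χ v.1 ≠ 1) ∧
    HasSum (fun H => diffs l A H * χ H) (s * (l.map fun v => 1 - v.2 * χ v.1).prod)

theorem diffs_append (l l' : List (Γ × ℂ)) (A : Γ → ℂ) : diffs (l ++ l') A = diffs l' (diffs l A) := by
  induction l generalizing A with
  | nil => rfl
  | cons v l ih => exact ih _

theorem diffs_diff (l : List (Γ × ℂ)) (v : Γ × ℂ) (A : Γ → ℂ) :
    diffs l (fun H => A H - v.2 * A (H - v.1)) =
      fun H => diffs l A H - v.2 * diffs l A (H - v.1) := by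
  induction l generalizing A with
  | nil => rfl
  | cons w l ih =>
    change diffs l _ = fun H => diffs l _ H - v.2 * diffs l _ (H - v.1)
    rw [← ih]
    congr 1
    funext H
    have : H - w.1 - v.1 = H - v.1 - w.1 := by abel
    simp only [this]
    ring

/-- Difference operators commute, so either list may act first; this is what allows two
regularizations to be compared. -/
theorem diffs_append' (l l' : List (Γ × ℂ)) (A : Γ → ℂ) : diffs (l ++ l') A = diffs l (diffs l' A) := by
  induction l' generalizing A with
  | nil => rw [List.append_nil]; rfl
  | cons v l' ih =>
    rw [diffs_append]
    change diffs l' _ = diffs l (diffs l' _)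
    rw [← ih, diffs_append, diffs_diff l v]

theorem diffs_add (l : List (Γ × ℂ)) (A A' : Γ → ℂ) :
    diffs l (fun H => A H + A' H) = fun H => diffs l A H + diffs l A' H := by
  induction l generalizing A A' with
  | nil => rfl
  | cons v l ih =>
    change diffs l _ = fun H => diffs l _ H + diffs l _ H
    rw [← ih]
    congr 1
    funext H
    ring

theorem diffs_smul (l : List (Γ × ℂ)) (c : ℂ) (A : Γ → ℂ) :
    diffs l (fun H => c * A H) = fun H => c * diffs l A H := by
  induction l generalizing A with
  | nil => rfl
  | cons v l ih =>
    change diffs l _ = fun H => c * diffs l _ H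
    rw [← ih]
    congr 1
    funext H
    ring

variable {χ : Γ → ℂ}

/-- Shifting the summation variable shows that the operator attached to $(v,c)$ multiplies a
convergent sum by $1-c\chi(v)$, the factor built into `RegSum`. -/
theorem hasSum_diffs (hχ : ∀ x y, χ (x + y) = χ x * χ y) {A : Γ → ℂ} {s : ℂ}
    (h : HasSum (fun H => A H * χ H) s) (l : List (Γ × ℂ)) :
    HasSum (fun H => diffs l A H * χ H) (s * (l.map fun v => 1 - v.2 * χ v.1).prod) := by
  induction l generalizing A s with
  | nil => simpa [diffs] using h
  | cons v l ih =>
    have h1 : HasSum (fun H => A (H - v.1) * χ H) (s * χ v.1) := by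
      have h2 := ((Equiv.subRight v.1).hasSum_iff.2 h).mul_right (χ v.1)
      refine h2.congr_fun fun H => ?_
      simp only [Function.comp_apply, Equiv.subRight_apply]
      rw [mul_assoc, ← hχ, sub_add_cancel]
    have h3 : HasSum (fun H => (A H - v.2 * A (H - v.1)) * χ H) (s * (1 - v.2 * χ v.1)) := by
      rw [mul_one_sub, mul_left_comm]
      refine (h.sub (h1.mul_left v.2)).congr_fun fun H => ?_
      ring
    have h4 := ih h3
    rw [List.map_cons, List.prod_cons, ← mul_assoc]
    exact h4

theorem RegSum.of_hasSum {A : Γ → ℂ} {s : ℂ} (h : HasSum (fun H => A H * χ H) s) :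
    RegSum χ A s := ⟨[], by simp, by simpa [diffs] using h⟩

theorem RegSum.add (hχ : ∀ x y, χ (x + y) = χ x * χ y) {A A' : Γ → ℂ} {s s' : ℂ}
    (h : RegSum χ A s) (h' : RegSum χ A' s') : RegSum χ (fun H => A H + A' H) (s + s') := by
  obtain ⟨l, hl, h1⟩ := h
  obtain ⟨l', hl', h1'⟩ := h'
  refine ⟨l ++ l', fun v hv => (List.mem_append.1 hv).elim (hl v) (hl' v), ?_⟩
  have h2 := hasSum_diffs hχ h1 l'
  have h2' := hasSum_diffs hχ h1' l
  rw [← diffs_append] at h2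
  rw [← diffs_append'] at h2'
  rw [diffs_add, List.map_append, List.prod_append, add_mul, ← mul_assoc]
  have h3 : s' * ((l.map fun v => 1 - v.2 * χ v.1).prod * (l'.map fun v => 1 - v.2 * χ v.1).prod) =
      s' * (l'.map fun v => 1 - v.2 * χ v.1).prod * (l.map fun v => 1 - v.2 * χ v.1).prod := by ring
  rw [h3]
  refine (h2.add h2').congr_fun fun H => ?_
  ring

theorem RegSum.const_mul {A : Γ → ℂ} {s : ℂ} (h : RegSum χ A s) (c : ℂ) :
    RegSum χ (fun H => c * A H) (c * s) := by
  obtain ⟨l, hl, h1⟩ := h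
  refine ⟨l, hl, ?_⟩
  rw [diffs_smul, mul_assoc]
  refine (h1.mul_left c).congr_fun fun H => ?_
  ring

theorem RegSum.sum (hχ : ∀ x y, χ (x + y) = χ x * χ y) {κ : Type*} (t : Finset κ)
    {A : κ → Γ → ℂ} {s : κ → ℂ} (h : ∀ i ∈ t, RegSum χ (A i) (s i)) :
    RegSum χ (fun H => ∑ i ∈ t, A i H) (∑ i ∈ t, s i) := by
  classical
  induction t using Finset.induction_on with
  | empty =>
    simp only [Finset.sum_empty]
    exact RegSum.of_hasSum (by simp)
  | insert a t ha ih =>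
    simp only [Finset.sum_insert ha]
    exact (h a (Finset.mem_insert_self _ _)).add hχ
      (ih fun i hi => h i (Finset.mem_insert_of_mem hi))

/-- Applying both lists of operators computes one convergent sum in two ways. The extra factors are
nonzero by the condition imposed on the lists, and they cancel. -/
theorem RegSum.unique (hχ : ∀ x y, χ (x + y) = χ x * χ y) {A : Γ → ℂ} {s t : ℂ}
    (h : RegSum χ A s) (h' : RegSum χ A t) : s = t := by
  obtain ⟨l, hl, h1⟩ := h
  obtain ⟨l', hl', h1'⟩ := h'
  have h2 := hasSum_diffs hχ h1 l'
  have h2' := hasSum_diffs hχ h1' l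
  rw [← diffs_append] at h2
  rw [← diffs_append'] at h2'
  have h3 := h2.unique h2'
  have hne : ∀ l : List (Γ × ℂ), (∀ v ∈ l, v.2 * χ v.1 ≠ 1) → (l.map fun v => 1 - v.2 * χ v.1).prod ≠ 0 := by
    intro l hl h0
    rw [List.prod_eq_zero_iff, List.mem_map] at h0
    obtain ⟨v, hv, h0⟩ := h0
    exact hl v hv (sub_eq_zero.1 h0).symm
  have h4 := hne l hl
  have h4' := hne l' hl'
  apply mul_right_cancel₀ h4
  apply mul_right_cancel₀ h4'
  rw [h3]
  ring

/-- A function invariant under a translation on which `χ` is non-trivial has regularized sum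
zero. -/
theorem RegSum.zero_of_invariant {A : Γ → ℂ} {v : Γ} (hv : χ v ≠ 1)
    (h : ∀ H, A (H - v) = A H) : RegSum χ A 0 := by
  refine ⟨[(v, 1)], by simpa using hv, ?_⟩
  simp only [diffs, h, one_mul, sub_self, zero_mul]
  exact hasSum_zero

theorem diffs_mul {ψ : Γ → ℂ} (hψ : ∀ x y, ψ (x + y) = ψ x * ψ y) (l : List (Γ × ℂ))
    (A : Γ → ℂ) : diffs (l.map fun v => (v.1, v.2 * ψ v.1)) (fun H => A H * ψ H) =
      fun H => diffs l A H * ψ H := by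
  induction l generalizing A with
  | nil => rfl
  | cons v l ih =>
    change diffs (l.map fun v => (v.1, v.2 * ψ v.1)) _ = fun H => diffs l _ H * ψ H
    rw [← ih]
    congr 1
    funext H
    have : ψ H = ψ (H - v.1) * ψ v.1 := by rw [← hψ, sub_add_cancel]
    simp only
    linear_combination v.2 * A (H - v.1) * this

/-- Twisting by a character. -/
theorem RegSum.mul_char {ψ : Γ → ℂ} (hψ : ∀ x y, ψ (x + y) = ψ x * ψ y) {A : Γ → ℂ} {s : ℂ}
    (h : RegSum (fun H => χ H * ψ H) A s) : RegSum χ (fun H => A H * ψ H) s := by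
  obtain ⟨l, hl, h1⟩ := h
  refine ⟨l.map fun v => (v.1, v.2 * ψ v.1), fun v hv => ?_, ?_⟩
  · obtain ⟨w, hw, rfl⟩ := List.mem_map.1 hv
    refine fun h => hl w hw ?_
    rw [← h]
    ring
  · rw [diffs_mul hψ, List.map_map]
    have e : ((fun v : Γ × ℂ => 1 - v.2 * χ v.1) ∘ fun v : Γ × ℂ => (v.1, v.2 * ψ v.1)) =
        fun v => 1 - v.2 * (χ v.1 * ψ v.1) := by
      funext v
      simp only [Function.comp_apply]
      ring
    rw [e]
    refine h1.congr_fun fun H => ?_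
    ring

/-- Extension by zero commutes with differences along the subgroup, so sums over a lattice can be
computed in coordinates and then compared inside the ambient space, where different lattices meet.
-/
theorem RegSum.map (e : Γ' →+ Γ) (he : Function.Injective e) {A : Γ → ℂ}
    (hA : ∀ x, x ∉ Set.range e → A x = 0) {s : ℂ}
    (h : RegSum (fun x => χ (e x)) (fun x => A (e x)) s) : RegSum χ A s := by
  obtain ⟨l, hl, h1⟩ := h
  have key : ∀ (l : List (Γ' × ℂ)) (A : Γ → ℂ), (∀ x, x ∉ Set.range e → A x = 0) →
      (∀ x, x ∉ Set.range e → diffs (l.map (Prod.map e id)) A x = 0) ∧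
      ∀ x, diffs (l.map (Prod.map e id)) A (e x) = diffs l (fun x => A (e x)) x := by
    intro l
    induction l with
    | nil => exact fun A hA => ⟨hA, fun x => rfl⟩
    | cons v l ih =>
      intro A hA
      have h1 := ih (fun H => A H - v.2 * A (H - e v.1)) (fun x hx => by
        rw [hA x hx, hA, mul_zero, sub_zero]
        rintro ⟨y, hy⟩
        exact hx ⟨y + v.1, by rw [map_add, hy, sub_add_cancel]⟩)
      refine ⟨h1.1, fun x => ?_⟩
      refine (h1.2 x).trans ?_
      simp only [← map_sub]
      rfl
  refine ⟨l.map (Prod.map e id), ?_, ?_⟩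
  · intro v hv
    obtain ⟨w, hw, rfl⟩ := List.mem_map.1 hv
    exact hl w hw
  · rw [← he.hasSum_iff fun x hx => by rw [(key l A hA).1 x hx, zero_mul], List.map_map]
    refine h1.congr_fun fun x => ?_
    simp only [Function.comp_apply]
    rw [(key l A hA).2]

end RegSum

/-! ### Regularized sums of product functions on $\mathbb Z^I$. -/

section Pi

theorem summable_norm_pi_prod_fin {κ : Type*} (n : ℕ) (g : Fin n → κ → ℂ) (s : Fin n → ℂ)
    (h : ∀ i, Summable fun k => ‖g i k‖) (h' : ∀ i, HasSum (g i) (s i)) :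
    (Summable fun k : Fin n → κ => ‖∏ i, g i (k i)‖) ∧
      HasSum (fun k : Fin n → κ => ∏ i, g i (k i)) (∏ i, s i) := by
  induction n with
  | zero =>
    have h0 := hasSum_unique (fun k : Fin 0 → κ => (1 : ℂ))
    simp only [Finset.univ_eq_empty, Finset.prod_empty, norm_one]
    exact ⟨(hasSum_unique (fun k : Fin 0 → κ => (1 : ℝ))).summable, h0⟩
  | succ n ih =>
    obtain ⟨h1, h2⟩ := ih (fun i => g i.succ) (fun i => s i.succ) (fun i => h _) (fun i => h' _)
    let E : κ × (Fin n → κ) ≃ (Fin (n + 1) → κ) := Fin.consEquiv fun _ => κ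
    have hE : ∀ p : κ × (Fin n → κ), ∏ i, g i (E p i) = g 0 p.1 * ∏ i, g i.succ (p.2 i) :=
      fun p => by
        rw [Fin.prod_univ_succ]
        rfl
    let G : (Fin n → κ) → ℂ := fun k => ∏ i, g i.succ (k i)
    have h1' : Summable fun k => ‖G k‖ := h1
    have hs := summable_mul_of_summable_norm (R := ℂ) (f := g 0) (g := G) (h 0) h1'
    have h3 := (h 0).mul_norm h1'
    have h4 := HasSum.mul (h' 0) h2 hs
    rw [Fin.prod_univ_succ]
    have e1 : ((fun k : Fin (n + 1) → κ => ‖∏ i, g i (k i)‖) ∘ E) =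
        fun p => ‖g 0 p.1 * ∏ i, g i.succ (p.2 i)‖ :=
      funext fun p => by rw [Function.comp_apply, hE]
    have e2 : ((fun k : Fin (n + 1) → κ => ∏ i, g i (k i)) ∘ E) =
        fun p => g 0 p.1 * ∏ i, g i.succ (p.2 i) :=
      funext fun p => by rw [Function.comp_apply, hE]
    rw [← e1] at h3
    rw [← e2] at h4
    exact ⟨E.summable_iff.1 h3, E.hasSum_iff.1 h4⟩

theorem summable_norm_pi_prod {κ I : Type*} [Fintype I] (g : I → κ → ℂ) (s : I → ℂ)
    (h : ∀ i, Summable fun k => ‖g i k‖) (h' : ∀ i, HasSum (g i) (s i)) :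
    (Summable fun k : I → κ => ‖∏ i, g i (k i)‖) ∧
      HasSum (fun k : I → κ => ∏ i, g i (k i)) (∏ i, s i) := by
  let e := Fintype.equivFin I
  obtain ⟨h1, h2⟩ := summable_norm_pi_prod_fin _ (fun i => g (e.symm i)) (fun i => s (e.symm i))
    (fun i => h _) (fun i => h' _)
  let E : (I → κ) ≃ (Fin (Fintype.card I) → κ) := Equiv.arrowCongr e (Equiv.refl κ)
  have hE : ∀ k : I → κ, ∏ i, g (e.symm i) (E k i) = ∏ i, g i (k i) := fun k =>
    Fintype.prod_equiv e.symm _ _ fun i => rfl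
  rw [← Fintype.prod_equiv e.symm (fun i => s (e.symm i)) s fun i => rfl]
  constructor
  · refine ((E.summable_iff).2 h1).congr fun k => ?_
    simp only [Function.comp_apply, hE]
  · refine ((E.hasSum_iff).2 h2).congr_fun fun k => ?_
    simp only [Function.comp_apply, hE]

open Classical in
theorem diffs_pi {I : Type*} [Fintype I] (l : List I) (hl : l.Nodup) (S : I → ℤ → ℂ) :
    diffs (l.map fun i => (Pi.single i 1, (1 : ℂ))) (fun k : I → ℤ => ∏ i, S i (k i)) =
      fun k => ∏ i, if i ∈ l then S i (k i) - S i (k i - 1) else S i (k i) := by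
  induction l generalizing S with
  | nil => simp [diffs]
  | cons j l ih =>
    rw [List.nodup_cons] at hl
    change diffs (l.map fun i => (Pi.single i 1, (1 : ℂ))) _ = _
    have e : (fun H : I → ℤ => ∏ i, S i (H i) - 1 * ∏ i, S i ((H - Pi.single j 1 : I → ℤ) i)) =
        fun H => ∏ i, Function.update S j (fun m => S j m - S j (m - 1)) i (H i) := by
      funext H
      rw [← Finset.mul_prod_erase _ _ (Finset.mem_univ j),
        ← Finset.mul_prod_erase _ _ (Finset.mem_univ j),
        ← Finset.mul_prod_erase _ _ (Finset.mem_univ j)]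
      have h1 : ∏ i ∈ Finset.univ.erase j, S i ((H - Pi.single j 1 : I → ℤ) i) =
          ∏ i ∈ Finset.univ.erase j, S i (H i) := Finset.prod_congr rfl fun i hi => by
        rw [Pi.sub_apply, Pi.single_eq_of_ne (Finset.ne_of_mem_erase hi), sub_zero]
      have h2 : ∏ i ∈ Finset.univ.erase j,
          Function.update S j (fun m => S j m - S j (m - 1)) i (H i) =
          ∏ i ∈ Finset.univ.erase j, S i (H i) := Finset.prod_congr rfl fun i hi => by
        rw [Function.update_of_ne (Finset.ne_of_mem_erase hi)]
      rw [h1, h2, Function.update_self, Pi.sub_apply, Pi.single_eq_same]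
      ring
    rw [e, ih hl.2]
    funext k
    refine Finset.prod_congr rfl fun i _ => ?_
    by_cases hij : i = j
    · subst hij
      rw [if_neg hl.1, if_pos (List.mem_cons_self), Function.update_self]
    · rw [Function.update_of_ne hij]
      simp [hij]

/-- One unit difference per coordinate replaces each `S i` by its increments and produces the
factors $1-x_i$; the increments have absolutely convergent series, so their product can be summed
coordinatewise. -/
theorem RegSum.pi {I : Type*} [Fintype I] {χ : (I → ℤ) → ℂ} {x : I → ℂ}
    (hχ : ∀ k, χ k = ∏ i, x i ^ k i) (hx : ∀ i, x i ≠ 1) {S : I → ℤ → ℂ} {t : I → ℂ}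
    (hS : ∀ i, Summable fun k : ℤ => ‖(S i k - S i (k - 1)) * x i ^ k‖)
    (ht : ∀ i, HasSum (fun k : ℤ => (S i k - S i (k - 1)) * x i ^ k) (t i)) :
    RegSum χ (fun k => ∏ i, S i (k i)) (∏ i, t i / (1 - x i)) := by
  classical
  have hs : ∀ i, χ (Pi.single i 1) = x i := fun i => by
    rw [hχ, Finset.prod_eq_single i]
    · simp
    · intro j _ hj
      simp [Pi.single_eq_of_ne hj]
    · simp
  refine ⟨Finset.univ.toList.map fun i => (Pi.single i 1, (1 : ℂ)), ?_, ?_⟩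
  · intro v hv
    obtain ⟨i, -, rfl⟩ := List.mem_map.1 hv
    rw [hs, one_mul]
    exact hx i
  · rw [diffs_pi _ (Finset.nodup_toList _), List.map_map]
    have e : ((Finset.univ.toList : List I).map
        ((fun v : (I → ℤ) × ℂ => 1 - v.2 * χ v.1) ∘ fun i => (Pi.single i 1, (1 : ℂ)))).prod = ∏ i, (1 - x i) := by
      rw [Finset.prod_map_toList]
      exact Finset.prod_congr rfl fun i _ => by rw [Function.comp_apply, hs, one_mul]
    rw [e, ← Finset.prod_mul_distrib]
    have h2 := (summable_norm_pi_prod _ _ hS ht).2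
    have e2 : ∏ i, t i / (1 - x i) * (1 - x i) = ∏ i, t i := Finset.prod_congr rfl fun i _ =>
      div_mul_cancel₀ _ (sub_ne_zero.2 (hx i).symm)
    rw [e2]
    refine h2.congr_fun fun k => ?_
    simp only [Finset.mem_toList, Finset.mem_univ, if_true]
    rw [hχ, ← Finset.prod_mul_distrib]

end Pi

end Cofamily

end

noncomputable section

namespace Cofamily

set_option linter.unusedSectionVars false

open Complex

/-! ### Laurent coefficients and their partial sums. -/

section Laurent

theorem exists_laurent {f : ℂ → ℂ} {ρ : ℝ} (hρ : 1 < ρ)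
    (hm : MeromorphicOn f (Metric.ball 0 ρ))
    (hd : DifferentiableOn ℂ f (Metric.ball 0 ρ \ {0})) :
    ∃ (c : ℤ → ℂ) (K : ℕ), (∀ k : ℤ, k < -K → c k = 0) ∧
      ∀ z : ℂ, z ≠ 0 → ‖z‖ < ρ → HasSum (fun k : ℤ => c k * z ^ k) (f z) := by
  have h0 : (0 : ℂ) ∈ Metric.ball 0 ρ := Metric.mem_ball_self (by linarith)
  -- A power of $z$ clears the possible pole at $0$, the Taylor series of the result converges on
  -- the whole disc, and dividing by the power shifts the index by `n`.
  obtain ⟨n, hn⟩ := hm 0 h0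
  set g : ℂ → ℂ := fun z => (z - 0) ^ n • f z with hg
  have hgd : DifferentiableOn ℂ g (Metric.ball 0 ρ) := by
    intro z hz
    by_cases hz0 : z = 0
    · subst hz0
      exact hn.differentiableAt.differentiableWithinAt
    · have hopen : IsOpen (Metric.ball (0 : ℂ) ρ \ {0}) :=
        Metric.isOpen_ball.sdiff isClosed_singleton
      have h1 : DifferentiableAt ℂ f z := hd.differentiableAt (hopen.mem_nhds ⟨hz, hz0⟩)
      have h2 : DifferentiableAt ℂ (fun z : ℂ => (z - 0) ^ n) z := by fun_prop
      exact (h2.smul h1).differentiableWithinAt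
  let a : ℕ → ℂ := fun m => ((m.factorial : ℂ))⁻¹ * iteratedDeriv m g 0
  have ha : ∀ z : ℂ, ‖z‖ < ρ → HasSum (fun m => a m * z ^ m) (g z) := by
    intro z hz
    have := Complex.hasSum_taylorSeries_on_ball hgd (z := z) (by simpa using hz)
    refine this.congr_fun fun m => ?_
    simp only [a, smul_eq_mul, sub_zero]
    ring
  refine ⟨fun k => if 0 ≤ k + n then a (k + n).toNat else 0, n, fun k hk => ?_,
    fun z hz0 hz => ?_⟩
  · show (if 0 ≤ k + n then a (k + n).toNat else 0) = 0
    rw [if_neg (by omega)]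
  · let e : ℕ → ℤ := fun m => m - n
    have he : Function.Injective e := fun m m' h => by
      simp only [e] at h
      omega
    rw [← he.hasSum_iff]
    · have h1 := (ha z hz).mul_right (z ^ (-(n : ℤ)))
      have h2 : g z * z ^ (-(n : ℤ)) = f z := by
        simp only [hg, sub_zero, smul_eq_mul, zpow_neg, zpow_natCast]
        field_simp
      rw [h2] at h1
      refine h1.congr_fun fun m => ?_
      show (if 0 ≤ (m : ℤ) - n + n then a ((m : ℤ) - n + n).toNat else 0) * z ^ ((m : ℤ) - n) = _
      rw [sub_add_cancel, if_pos (Int.natCast_nonneg m), Int.toNat_natCast,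
        sub_eq_add_neg, zpow_add₀ hz0, zpow_natCast]
      simp only [a]
      ring
    · intro k hk
      show (if 0 ≤ k + n then a (k + n).toNat else 0) * z ^ k = 0
      rw [if_neg, zero_mul]
      intro h
      exact hk ⟨(k + n).toNat, by simp only [e]; omega⟩

/-- `S` consists of the partial sums of the Laurent coefficients, formally the coefficients of
$f(z)/(1-z)$. Since $\rho>1$, the partial sums tend to $f(1)$, and comparison with a radius $t$
strictly between $1$ and $\rho$ bounds the tail by a multiple of $t^{-k}$. -/
theorem exists_coeff {f : ℂ → ℂ} {ρ : ℝ} (hρ : 1 < ρ)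
    (hm : MeromorphicOn f (Metric.ball 0 ρ))
    (hd : DifferentiableOn ℂ f (Metric.ball 0 ρ \ {0})) :
    ∃ (S : ℤ → ℂ) (C η : ℝ) (K : ℕ), 0 < C ∧ 0 < η ∧ η < 1 ∧ (∀ k : ℤ, k < -K → S k = 0) ∧
      (∀ k, ‖S k - f 1‖ ≤ C * η ^ k) ∧ (∀ k, ‖S k‖ ≤ C) ∧
      ∀ z : ℂ, z ≠ 0 → ‖z‖ < ρ → Summable (fun k : ℤ => ‖(S k - S (k - 1)) * z ^ k‖) ∧
        HasSum (fun k : ℤ => (S k - S (k - 1)) * z ^ k) (f z) := by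
  obtain ⟨c, K, hK, hc⟩ := exists_laurent hρ hm hd
  obtain ⟨t, ht1, htρ⟩ := exists_between hρ
  have ht0 : (0 : ℝ) < t := by linarith
  have hs1 : HasSum c (f 1) := by simpa using hc 1 one_ne_zero (by simpa using hρ)
  have hst : Summable fun k : ℤ => ‖c k‖ * t ^ k := by
    have h1 := (hc (t : ℂ) (by exact_mod_cast ht0.ne')
      (by rwa [Complex.norm_real, Real.norm_of_nonneg ht0.le])).summable.norm
    refine h1.congr fun k => ?_
    rw [norm_mul, norm_zpow, Complex.norm_real, Real.norm_of_nonneg ht0.le]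
  have hS1 : ∀ k : ℤ, Summable fun j : ℤ => if j ≤ k then c j else 0 := fun k =>
    Summable.of_norm_bounded hs1.summable.norm fun j => by
      split_ifs
      · exact le_rfl
      · simp
  let S : ℤ → ℂ := fun k => ∑' j : ℤ, if j ≤ k then c j else 0
  have hdiff : ∀ k, S k - S (k - 1) = c k := by
    intro k
    rw [← (hS1 k).tsum_sub (hS1 (k - 1)), tsum_eq_single k]
    · simp
    · intro j hj
      by_cases h1 : j ≤ k
      · rw [if_pos h1, if_pos (by omega), sub_self]
      · rw [if_neg h1, if_neg (by omega), sub_self]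
  refine ⟨S, (∑' k : ℤ, ‖c k‖ * t ^ k) + (∑' k : ℤ, ‖c k‖) + 1, t⁻¹, K, ?_, by positivity,
    inv_lt_one_of_one_lt₀ ht1, ?_, ?_, ?_, ?_⟩
  · have h1 : 0 ≤ ∑' k : ℤ, ‖c k‖ * t ^ k := tsum_nonneg fun k => by positivity
    have h2 : 0 ≤ ∑' k : ℤ, ‖c k‖ := tsum_nonneg fun k => by positivity
    linarith
  · intro k hk
    have : ∀ j : ℤ, (if j ≤ k then c j else 0) = 0 := fun j => by
      split_ifs with h
      · exact hK j (by omega)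
      · rfl
    simp only [S, this, tsum_zero]
  · intro k
    have h2 : 0 ≤ ∑' k : ℤ, ‖c k‖ := tsum_nonneg fun k => by positivity
    rw [← hs1.tsum_eq, ← (hS1 k).tsum_sub hs1.summable]
    have h1 : ‖∑' j : ℤ, ((if j ≤ k then c j else 0) - c j)‖ ≤
        (∑' k : ℤ, ‖c k‖ * t ^ k) * t⁻¹ ^ k := by
      refine tsum_of_norm_bounded (hst.hasSum.mul_right _) fun j => ?_
      split_ifs with h
      · rw [sub_self, norm_zero]
        positivity
      · rw [zero_sub, norm_neg, inv_zpow, ← zpow_neg, mul_assoc, ← zpow_add₀ ht0.ne']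
        exact le_mul_of_one_le_right (norm_nonneg _) (one_le_zpow₀ ht1.le (by omega))
    refine h1.trans (mul_le_mul_of_nonneg_right (by linarith) (by positivity))
  · intro k
    have h1 : 0 ≤ ∑' k : ℤ, ‖c k‖ * t ^ k := tsum_nonneg fun k => by positivity
    have h2 : ‖S k‖ ≤ ∑' k : ℤ, ‖c k‖ := by
      refine tsum_of_norm_bounded hs1.summable.norm.hasSum fun j => ?_
      split_ifs
      · exact le_rfl
      · simp
    linarith
  · intro z hz0 hz
    simp only [hdiff]
    exact ⟨(hc z hz0 hz).summable.norm, hc z hz0 hz⟩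

/-- The coefficients of a truncated geometric series. -/
theorem hasSum_truncated (ξ : ℝ) (b : ℂ) (z : ℂ) :
    Summable (fun k : ℤ => ‖((if ξ < k then b else 0) - (if ξ < ((k - 1 : ℤ) : ℝ) then b else 0)) *
      z ^ k‖) ∧
    HasSum (fun k : ℤ => ((if ξ < k then b else 0) - (if ξ < ((k - 1 : ℤ) : ℝ) then b else 0)) *
      z ^ k) (b * z ^ (⌊ξ⌋ + 1)) := by
  have key : ∀ k : ℤ, k ≠ ⌊ξ⌋ + 1 →
      ((if ξ < k then b else 0) - (if ξ < ((k - 1 : ℤ) : ℝ) then b else 0)) * z ^ k = 0 := by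
    intro k hk
    by_cases h : ξ < k
    · have h1 : ⌊ξ⌋ < k := Int.floor_lt.2 h
      have h2 : ξ < ((k - 1 : ℤ) : ℝ) := Int.floor_lt.1 (by omega)
      rw [if_pos h, if_pos h2, sub_self, zero_mul]
    · have h2 : ¬ ξ < ((k - 1 : ℤ) : ℝ) := by
        push_cast
        push Not at h ⊢
        linarith
      rw [if_neg h, if_neg h2, sub_self, zero_mul]
  have h0 := hasSum_single (f := fun k : ℤ =>
    ((if ξ < k then b else 0) - (if ξ < ((k - 1 : ℤ) : ℝ) then b else 0)) * z ^ k)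
    (⌊ξ⌋ + 1) fun k hk => key k hk
  have h1 : ξ < ((⌊ξ⌋ + 1 : ℤ) : ℝ) := by
    push_cast
    exact Int.lt_floor_add_one ξ
  have h2 : ¬ ξ < ((⌊ξ⌋ + 1 - 1 : ℤ) : ℝ) := by
    rw [add_sub_cancel_right]
    exact not_lt.2 (Int.floor_le ξ)
  rw [if_pos h1, if_neg h2, sub_zero] at h0
  exact ⟨h0.summable.norm, h0⟩

end Laurent

/-! ### Wall crossing for weighted families of cones. -/

section WallCrossing

/-- The value of `g` on a punctured neighbourhood of `t` is a locally constant function of `t`,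
hence constant on the line, and it equals `g` at the two end points. Jumps at isolated points do no
harm. -/
theorem eq_of_eventually_const {g : ℝ → ℂ}
    (h : ∀ t, ∃ c, ∀ᶠ s in nhdsWithin t {t}ᶜ, g s = c) {a b : ℝ}
    (ha : ∀ᶠ s in nhds a, g s = g a) (hb : ∀ᶠ s in nhds b, g s = g b) : g a = g b := by
  choose c hc using h
  have key : ∀ t d, (∀ᶠ s in nhdsWithin t {t}ᶜ, g s = d) → c t = d := by
    intro t d h
    obtain ⟨s, h1, h2⟩ := ((hc t).and h).exists
    rw [← h1, h2]
  have hloc : IsLocallyConstant c := by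
    rw [IsLocallyConstant.iff_eventually_eq]
    intro t
    have h1 := eventually_eventually_nhdsWithin.2 (hc t)
    rw [eventually_nhdsWithin_iff] at h1
    filter_upwards [h1] with s hs
    by_cases hst : s = t
    · rw [hst]
    · have h2 := hs hst
      refine key s (c t) ?_
      have hop : {t}ᶜ ∈ nhds s := isOpen_compl_singleton.mem_nhds hst
      rw [nhdsWithin_eq_nhds.2 hop] at h2
      exact h2.filter_mono nhdsWithin_le_nhds
  have h1 := hloc.apply_eq_of_preconnectedSpace a b
  rw [key a (g a) (ha.filter_mono nhdsWithin_le_nhds),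
    key b (g b) (hb.filter_mono nhdsWithin_le_nhds)] at h1
  exact h1

variable {V κ ι : Type*} [AddCommGroup V] [Module ℝ V]

theorem eventually_sign (w : Module.Dual ℝ V) (x : V) (y : V) (t : ℝ)
    (h : w (x + t • y) ≠ 0) : ∀ᶠ s in nhds t, (0 < w (x + s • y) ↔ 0 < w (x + t • y)) := by
  have hc : Continuous fun s : ℝ => w (x + s • y) := by
    simp only [map_add, map_smul, smul_eq_mul]
    fun_prop
  rcases lt_or_gt_of_ne h with h1 | h1
  · filter_upwards [hc.continuousAt.eventually (gt_mem_nhds h1)] with s hs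
    exact ⟨fun h => absurd h hs.not_gt, fun h => absurd h h1.not_gt⟩
  · filter_upwards [hc.continuousAt.eventually (lt_mem_nhds h1)] with s hs
    exact ⟨fun _ => h1, fun _ => hs⟩

open Classical in
/-- The weighted number of cones `{w_{Q,i} > 0}` containing a point. -/
def coneCount [Fintype κ] (I : κ → Finset ι) (w : κ → ι → Module.Dual ℝ V) (c : κ → ℂ)
    (η : V) : ℂ :=
  ∑ Q, if ∀ i ∈ I Q, 0 < w Q i η then c Q else 0

-- The involution `σ` matches a facet of one cone with the same facet of a cone of equal weight on
-- the other side. By `hxy` each cone meets the line in at most one facet hyperplane at a time, so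
-- near $x_0$ the count is a constant plus one step function per such hyperplane, and matched steps
-- add up to constants.
open Classical in
theorem coneCount_crossing [Fintype κ] {I : κ → Finset ι} {w : κ → ι → Module.Dual ℝ V}
    {c : κ → ℂ} (σ : κ × ι → κ × ι)
    (hσ : ∀ p : κ × ι, p.2 ∈ I p.1 → (σ p).2 ∈ I (σ p).1 ∧ σ (σ p) = p ∧ c (σ p).1 = c p.1 ∧
      (∃ t : ℝ, 0 < t ∧ w (σ p).1 (σ p).2 = -t • w p.1 p.2) ∧
      ∀ η, w p.1 p.2 η = 0 →
        ((∀ i ∈ I p.1, i ≠ p.2 → 0 < w p.1 i η) ↔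
          ∀ i ∈ I (σ p).1, i ≠ (σ p).2 → 0 < w (σ p).1 i η))
    {x y : V} (hx : ∀ Q, ∀ i ∈ I Q, w Q i x ≠ 0)
    (hxy : ∀ Q, ∀ i ∈ I Q, ∀ j ∈ I Q, i ≠ j → w Q i x * w Q j y ≠ w Q j x * w Q i y) (t : ℝ) :
    ∃ d, ∀ᶠ s in nhdsWithin t {t}ᶜ, coneCount I w c (x + s • y) = d := by
  set x₀ := x + t • y with hx₀
  have huniq : ∀ Q, ∀ i ∈ I Q, ∀ j ∈ I Q, w Q i x₀ = 0 → w Q j x₀ = 0 → i = j := by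
    intro Q i hi j hj h1 h2
    by_contra hij
    apply hxy Q i hi j hj hij
    rw [hx₀, map_add, map_smul, smul_eq_mul] at h1 h2
    have e1 : w Q i x = -(t * w Q i y) := by linarith
    have e2 : w Q j x = -(t * w Q j y) := by linarith
    rw [e1, e2]
    ring
  have hlin : ∀ Q i s, w Q i x₀ = 0 → w Q i (x + s • y) = (s - t) * w Q i y := by
    intro Q i s h
    rw [hx₀, map_add, map_smul, smul_eq_mul] at h
    rw [map_add, map_smul, smul_eq_mul]
    linear_combination h
  have hy : ∀ Q, ∀ i ∈ I Q, w Q i x₀ = 0 → w Q i y ≠ 0 := by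
    intro Q i hi h h'
    have := hlin Q i 0 h
    rw [h', mul_zero, zero_smul, add_zero] at this
    exact hx Q i hi this
  -- the walls through the point `x₀`
  let J : Finset ι := Finset.univ.biUnion I
  let Z : Finset (κ × ι) := (Finset.univ ×ˢ J).filter
    fun p => p.2 ∈ I p.1 ∧ w p.1 p.2 x₀ = 0
  have hZ : ∀ p, p ∈ Z ↔ p.2 ∈ I p.1 ∧ w p.1 p.2 x₀ = 0 := by
    intro p
    simp only [Z, Finset.mem_filter, Finset.mem_product, Finset.mem_univ, true_and,
      and_iff_right_iff_imp]
    exact fun h => Finset.mem_biUnion.2 ⟨p.1, Finset.mem_univ _, h.1⟩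
  let K : κ × ι → ℂ := fun p => if ∀ i ∈ I p.1, i ≠ p.2 → 0 < w p.1 i x₀ then c p.1 else 0
  let F : κ × ι → ℝ → ℂ := fun p s => if 0 < (s - t) * w p.1 p.2 y then K p else 0
  let D : ℂ := ∑ Q, if (∃ i ∈ I Q, w Q i x₀ = 0) then 0 else
    if ∀ i ∈ I Q, 0 < w Q i x₀ then c Q else 0
  have hev : ∀ᶠ s in nhdsWithin t {t}ᶜ, coneCount I w c (x + s • y) = D + ∑ p ∈ Z, F p s := by
    have h1 : ∀ᶠ s in nhdsWithin t {t}ᶜ, ∀ Q, ∀ i ∈ I Q, w Q i x₀ ≠ 0 →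
        (0 < w Q i (x + s • y) ↔ 0 < w Q i x₀) := by
      refine Filter.Eventually.filter_mono nhdsWithin_le_nhds ?_
      rw [Filter.eventually_all]
      intro Q
      rw [Filter.eventually_all_finset]
      intro i _
      by_cases h : w Q i x₀ = 0
      · exact Filter.Eventually.of_forall fun s hs => absurd h hs
      · filter_upwards [eventually_sign (w Q i) x y t h] with s hs _ using hs
    filter_upwards [h1] with s hs
    have hsum : ∑ p ∈ Z, F p s = ∑ Q, ∑ i ∈ (I Q).filter (fun i => w Q i x₀ = 0), F (Q, i) s := by
      rw [Finset.sum_sigma']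
      refine Finset.sum_bij' (fun p _ => ⟨p.1, p.2⟩) (fun p _ => (p.1, p.2)) ?_ ?_ ?_ ?_ ?_
      · intro p hp
        rw [hZ] at hp
        simpa using hp
      · intro p hp
        rw [hZ]
        simpa using hp
      · intro p _; rfl
      · intro p _; rfl
      · intro p _; rfl
    rw [hsum, coneCount, ← Finset.sum_add_distrib]
    refine Finset.sum_congr rfl fun Q _ => ?_
    by_cases hQ : ∃ i ∈ I Q, w Q i x₀ = 0
    · obtain ⟨i, hi, hi0⟩ := hQ
      have hf : (I Q).filter (fun i => w Q i x₀ = 0) = {i} := by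
        ext j
        rw [Finset.mem_filter, Finset.mem_singleton]
        exact ⟨fun h => huniq Q j h.1 i hi h.2 hi0, fun h => h ▸ ⟨hi, hi0⟩⟩
      have hD : (if ∃ i ∈ I Q, w Q i x₀ = 0 then (0 : ℂ) else
          if ∀ i ∈ I Q, 0 < w Q i x₀ then c Q else 0) = 0 := if_pos ⟨i, hi, hi0⟩
      rw [hf, Finset.sum_singleton, hD, zero_add]
      have hiff : (∀ j ∈ I Q, 0 < w Q j (x + s • y)) ↔
          (0 < (s - t) * w Q i y ∧ ∀ j ∈ I Q, j ≠ i → 0 < w Q j x₀) := by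
        constructor
        · intro h
          refine ⟨hlin Q i s hi0 ▸ h i hi, fun j hj hji => ?_⟩
          exact (hs Q j hj fun h0 => hji (huniq Q j hj i hi h0 hi0)).1 (h j hj)
        · rintro ⟨h2, h3⟩ j hj
          by_cases hji : j = i
          · subst hji
            rwa [hlin Q j s hi0]
          · exact (hs Q j hj fun h0 => hji (huniq Q j hj i hi h0 hi0)).2 (h3 j hj hji)
      simp only [F, K, hiff, ite_and]
    · have hD : (if ∃ i ∈ I Q, w Q i x₀ = 0 then (0 : ℂ) else
          if ∀ i ∈ I Q, 0 < w Q i x₀ then c Q else 0) =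
          if ∀ i ∈ I Q, 0 < w Q i x₀ then c Q else 0 := if_neg hQ
      rw [hD]
      push Not at hQ
      have hf : (I Q).filter (fun i => w Q i x₀ = 0) = ∅ :=
        Finset.filter_eq_empty_iff.2 fun i hi => hQ i hi
      rw [hf, Finset.sum_empty, add_zero]
      have hiff : (∀ j ∈ I Q, 0 < w Q j (x + s • y)) ↔ ∀ j ∈ I Q, 0 < w Q j x₀ :=
        forall₂_congr fun j hj => hs Q j hj (hQ j hj)
      simp only [hiff]
  have hσZ : ∀ p ∈ Z, σ p ∈ Z := by
    intro p hp
    rw [hZ] at hp ⊢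
    obtain ⟨h1, -, -, ⟨r, -, h4⟩, -⟩ := hσ p hp.1
    exact ⟨h1, by rw [h4, LinearMap.smul_apply, hp.2, smul_zero]⟩
  have hconst : ∀ s s', s ≠ t → s' ≠ t → ∑ p ∈ Z, F p s = ∑ p ∈ Z, F p s' := by
    intro s s' hs hs'
    rw [← sub_eq_zero, ← Finset.sum_sub_distrib]
    have key : ∀ p ∈ Z, F p s - F p s' + (F (σ p) s - F (σ p) s') = 0 := by
      intro p hp
      rw [hZ] at hp
      obtain ⟨h1, h2, h3, ⟨r, hr, h4⟩, h5⟩ := hσ p hp.1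
      have hK : K (σ p) = K p := by
        simp only [K, h3]
        exact if_congr (h5 x₀ hp.2).symm rfl rfl
      have hyp := hy p.1 p.2 hp.1 hp.2
      -- Off the wall the two opposite forms have opposite signs, so exactly one of the two step
      -- functions is switched on.
      have hF : ∀ s, s ≠ t → F p s + F (σ p) s = K p := by
        intro s hs
        have hst := sub_ne_zero.2 hs
        have hne : (s - t) * w p.1 p.2 y ≠ 0 := mul_ne_zero hst hyp
        simp only [F, hK, h4, LinearMap.smul_apply, smul_eq_mul]
        have e : (s - t) * (-r * w p.1 p.2 y) = -(r * ((s - t) * w p.1 p.2 y)) := by ring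
        rw [e]
        rcases lt_or_gt_of_ne hne with h | h
        · rw [if_neg h.not_gt, if_pos (by nlinarith), zero_add]
        · rw [if_pos h, if_neg (by nlinarith), add_zero]
      have e1 := hF s hs
      have e2 := hF s' hs'
      linear_combination e1 - e2
    refine Finset.sum_involution (fun p _ => σ p) key ?_ (fun p hp => hσZ p hp) ?_
    · intro p hp hne heq
      have := key p hp
      rw [heq] at this
      have h2 : (F p s - F p s') = 0 := by
        linear_combination this / 2
      exact hne h2
    · intro p hp
      exact (hσ p ((hZ p).1 hp).1).2.1
  refine ⟨D + ∑ p ∈ Z, F p (t + 1), ?_⟩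
  filter_upwards [hev, self_mem_nhdsWithin] with s h1 h2
  rw [h1, hconst s (t + 1) h2 (by simp)]

/-- A generic segment meets the facet hyperplanes of each cone one at a time, so
`coneCount_crossing` applies along it. Linear independence makes the forms `G` nonzero, and a small
perturbation of the end point then achieves genericity without changing a sign there. -/
theorem coneCount_const [Fintype κ] {I : κ → Finset ι} {w : κ → ι → Module.Dual ℝ V}
    {c : κ → ℂ} (σ : κ × ι → κ × ι)
    (hσ : ∀ p : κ × ι, p.2 ∈ I p.1 → (σ p).2 ∈ I (σ p).1 ∧ σ (σ p) = p ∧ c (σ p).1 = c p.1 ∧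
      (∃ t : ℝ, 0 < t ∧ w (σ p).1 (σ p).2 = -t • w p.1 p.2) ∧
      ∀ η, w p.1 p.2 η = 0 →
        ((∀ i ∈ I p.1, i ≠ p.2 → 0 < w p.1 i η) ↔
          ∀ i ∈ I (σ p).1, i ≠ (σ p).2 → 0 < w (σ p).1 i η))
    (hli : ∀ Q, LinearIndepOn ℝ (w Q) (I Q))
    {x x' : V} (hx : ∀ Q, ∀ i ∈ I Q, w Q i x ≠ 0) (hx' : ∀ Q, ∀ i ∈ I Q, w Q i x' ≠ 0) :
    coneCount I w c x = coneCount I w c x' := by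
  classical
  -- the forms controlling simultaneous crossings
  let T : Finset (κ × ι × ι) := (Finset.univ ×ˢ
    (Finset.univ.biUnion I ×ˢ Finset.univ.biUnion I)).filter
      fun p => p.2.1 ∈ I p.1 ∧ p.2.2 ∈ I p.1 ∧ p.2.1 ≠ p.2.2
  let G : κ × ι × ι → Module.Dual ℝ V := fun p =>
    w p.1 p.2.1 x • w p.1 p.2.2 - w p.1 p.2.2 x • w p.1 p.2.1
  have hT : ∀ Q, ∀ i ∈ I Q, ∀ j ∈ I Q, i ≠ j → (Q, i, j) ∈ T := by
    intro Q i hi j hj hij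
    simp only [T, Finset.mem_filter, Finset.mem_product, Finset.mem_univ, true_and,
      Finset.mem_biUnion]
    exact ⟨⟨⟨Q, hi⟩, ⟨Q, hj⟩⟩, hi, hj, hij⟩
  have hG : ∀ p : T, G p ≠ 0 := by
    rintro ⟨⟨Q, i, j⟩, hp⟩ h0
    simp only [T, Finset.mem_filter] at hp
    obtain ⟨-, hi, hj, hij⟩ := hp
    have h1 := (linearIndepOn_iff'.1 (hli Q)) {i, j}
      (fun k => if k = j then w Q i x else -w Q j x) (by
        intro k hk
        rcases Finset.mem_insert.1 (Finset.mem_coe.1 hk) with rfl | hk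
        · exact hi
        · rw [Finset.mem_singleton.1 hk]
          exact hj) (by
        rw [Finset.sum_pair hij, if_pos rfl, if_neg hij, neg_smul, neg_add_eq_sub]
        exact h0) j (by simp)
    rw [if_pos rfl] at h1
    exact hx Q i hi h1
  obtain ⟨v, hv⟩ := Module.Dual.exists_forall_ne_zero_of_forall_exists
    (fun p : T => G p) (fun p => by
      by_contra h
      push Not at h
      exact hG p (LinearMap.ext h))
  -- perturb the end point
  have hev : ∀ᶠ s : ℝ in nhdsWithin 0 {0}ᶜ,
      (∀ p : T, G p (x' - x + s • v) ≠ 0) ∧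
      ∀ Q, ∀ i ∈ I Q, (0 < w Q i (x' + s • v) ↔ 0 < w Q i x') ∧ w Q i (x' + s • v) ≠ 0 := by
    refine Filter.Eventually.and ?_ ?_
    · rw [Filter.eventually_all]
      intro p
      by_cases h : G p (x' - x) = 0
      · filter_upwards [self_mem_nhdsWithin] with s hs
        rw [map_add, h, zero_add, map_smul, smul_eq_mul]
        exact mul_ne_zero hs (hv p)
      · have hc : Continuous fun s : ℝ => G p (x' - x + s • v) := by
          simp only [map_add, map_smul, smul_eq_mul]
          fun_prop
        have h2 : ∀ᶠ s : ℝ in nhds 0, G p (x' - x + s • v) ≠ 0 :=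
          hc.continuousAt.eventually_ne (by simpa using h)
        exact h2.filter_mono nhdsWithin_le_nhds
    · refine Filter.Eventually.filter_mono nhdsWithin_le_nhds ?_
      rw [Filter.eventually_all]
      intro Q
      rw [Filter.eventually_all_finset]
      intro i hi
      have hc : Continuous fun s : ℝ => w Q i (x' + s • v) := by
        simp only [map_add, map_smul, smul_eq_mul]
        fun_prop
      have h1 := eventually_sign (w Q i) x' v 0 (by simpa using hx' Q i hi)
      simp only [zero_smul, add_zero] at h1
      have h2 : ∀ᶠ s : ℝ in nhds 0, w Q i (x' + s • v) ≠ 0 :=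
        hc.continuousAt.eventually_ne (by simpa using hx' Q i hi)
      exact h1.and h2
  obtain ⟨s, hs1, hs2⟩ := hev.exists
  set y := x' - x + s • v with hy
  have hend : x + (1 : ℝ) • y = x' + s • v := by
    rw [hy, one_smul]
    abel
  have h1 : coneCount I w c (x' + s • v) = coneCount I w c x' := by
    rw [coneCount, coneCount]
    refine Finset.sum_congr rfl fun Q _ => ?_
    have : (∀ i ∈ I Q, 0 < w Q i (x' + s • v)) ↔ ∀ i ∈ I Q, 0 < w Q i x' :=
      forall₂_congr fun i hi => (hs2 Q i hi).1
    simp only [this]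
  have hxy : ∀ Q, ∀ i ∈ I Q, ∀ j ∈ I Q, i ≠ j → w Q i x * w Q j y ≠ w Q j x * w Q i y := by
    intro Q i hi j hj hij h
    apply hs1 ⟨(Q, i, j), hT Q i hi j hj hij⟩
    simp only [G, LinearMap.sub_apply, LinearMap.smul_apply, smul_eq_mul]
    rw [sub_eq_zero]
    exact h
  have hloc : ∀ t : ℝ, (∀ Q, ∀ i ∈ I Q, w Q i (x + t • y) ≠ 0) →
      ∀ᶠ s in nhds t, coneCount I w c (x + s • y) = coneCount I w c (x + t • y) := by
    intro t ht
    have h2 : ∀ᶠ s in nhds t, ∀ Q, ∀ i ∈ I Q,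
        (0 < w Q i (x + s • y) ↔ 0 < w Q i (x + t • y)) := by
      rw [Filter.eventually_all]
      intro Q
      rw [Filter.eventually_all_finset]
      intro i hi
      exact eventually_sign (w Q i) x y t (ht Q i hi)
    filter_upwards [h2] with s hs
    rw [coneCount, coneCount]
    refine Finset.sum_congr rfl fun Q _ => ?_
    have : (∀ i ∈ I Q, 0 < w Q i (x + s • y)) ↔ ∀ i ∈ I Q, 0 < w Q i (x + t • y) :=
      forall₂_congr fun i hi => hs Q i hi
    simp only [this]
  have h2 := eq_of_eventually_const (g := fun t => coneCount I w c (x + t • y))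
    (fun t => coneCount_crossing σ hσ hx hxy t) (a := 0) (b := 1)
    (hloc 0 (by simpa using hx)) (hloc 1 (by
      rw [hend]
      exact fun Q i hi => (hs2 Q i hi).2))
  simp only [zero_smul, add_zero, hend] at h2
  rw [h2, h1]

end WallCrossing

end Cofamily

end

noncomputable section

namespace Cofamily

set_option linter.unusedSectionVars false

open Complex

/-! ### Refining a parabolic inside its Levi factor. -/

section Refine

variable {ι X Y : Type*} [AddCommGroup X] [Module ℝ X] [AddCommGroup Y] [Module ℝ Y]
  (R : RootPairing ι ℝ X Y)

/-- The subgroup `(P ∩ L) N_Q` of `Q`, where `L` is the Levi factor of `Q`. -/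
def refine (L P Q : Set ι) : Set ι := (Q \ L) ∪ (P ∩ L)

theorem mem_refine {L P Q : Set ι} {j : ι} : j ∈ refine L P Q ↔ j ∈ Q ∧ j ∉ L ∨ j ∈ P ∧ j ∈ L :=
  Iff.rfl

theorem refine_inter (L P Q : Set ι) : refine L P Q ∩ L = P ∩ L := by
  ext j
  simp only [Set.mem_inter_iff, mem_refine]
  tauto

theorem refine_mono {L P P' Q : Set ι} (h : P ∩ L ⊆ P') : refine L P Q ⊆ refine L P' Q := by
  rintro j (hj | hj)
  · exact Or.inl hj
  · exact Or.inr ⟨h hj, hj.2⟩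

variable {R}

theorem refine_subset {L P Q : Set ι} (hQ : Q ∈ parabolicsOfLevi R L) : refine L P Q ⊆ Q := by
  rintro j (hj | hj)
  · exact hj.1
  · exact levi_subset R Q (hQ.2.symm ▸ hj.2)

theorem subset_of_mem_parabolicsOfLevi {L Q : Set ι} (hQ : Q ∈ parabolicsOfLevi R L) : L ⊆ Q :=
  fun _ hj => levi_subset R Q (hQ.2.symm ▸ hj)

theorem refine_eq_lex {L : Set ι} {K H : Y} (hK : levi R (par R K) = L) :
    refine L (par R H) (par R K) = lex R K H := by
  subst hK
  rw [levi_par]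
  ext j
  simp only [mem_refine, lex, Set.mem_ofPred_eq]
  refine or_congr ⟨fun h => lt_of_le_of_ne h.1 (Ne.symm h.2), fun h => ⟨le_of_lt h, h.ne'⟩⟩
    and_comm

/-- The refinement is realized by moving slightly from the point of `Q` towards the point of `P`, by
`refine_eq_lex`, so its Levi factor is the intersection. -/
theorem refine_mem [Finite ι] {L P Q : Set ι} (hQ : Q ∈ parabolicsOfLevi R L)
    (hP : IsParabolic R P) : refine L P Q ∈ parabolicsOfLevi R (L ∩ levi R P) := by
  obtain ⟨⟨K, rfl⟩, h⟩ := hQ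
  obtain ⟨H, rfl⟩ := hP
  change refine L (par R H) (par R K) ∈ _
  have h' : levi R (par R K) = L := h
  rw [refine_eq_lex h']
  refine ⟨isParabolic_lex R K H, ?_⟩
  rw [levi_lex, h']
  rfl

/-- A root of `Q` outside `L` has no negative in `Q`, hence must lie in `P`. So $P\subset Q$ is
recovered from $Q$ and $P\cap L$; this identifies the groups of cancelling terms with $\mathcal
P(L)$. -/
theorem refine_self {L P Q : Set ι} (hQ : Q ∈ parabolicsOfLevi R L) (hP : IsParabolic R P)
    (h : P ⊆ Q) : refine L P Q = P := by
  ext j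
  constructor
  · rintro (hj | hj)
    · rcases mem_or_neg_mem R hP j with h' | ⟨k, hk, e⟩
      · exact h'
      · exact absurd (hQ.2 ▸ (⟨hj.1, k, h hk, e⟩ : j ∈ levi R Q)) hj.2
    · exact hj.1
  · intro hj
    by_cases hL : j ∈ L
    · exact Or.inr ⟨hj, hL⟩
    · exact Or.inl ⟨h hj, hL⟩

theorem refine_isMin [Finite ι] {L B Q : Set ι} (hQ : Q ∈ parabolicsOfLevi R L)
    (hB : IsMin R B) : IsMin R (refine L B Q) := by
  have := refine_mem hQ hB.1
  rwa [hB.2, Set.inter_empty] at this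

/-- A parabolic is determined by its positive half. -/
theorem pos_mem {P : Set ι} (hP : IsParabolic R P) {w : Y} (h : P ⊆ par R w) {j : ι}
    (hj : 0 < R.root' j w) : j ∈ P := by
  rcases mem_or_neg_mem R hP j with h' | ⟨k, hk, e⟩
  · exact h'
  · have h1 : 0 ≤ R.toLinearMap (R.root k) w := h hk
    rw [e, map_neg, LinearMap.neg_apply] at h1
    have : 0 < R.toLinearMap (R.root j) w := hj
    linarith

end Refine

/-! ### Adjacent elements of $\mathcal P(L)$ across a wall. -/

section Opposite

variable {ι X Y : Type*} [AddCommGroup X] [Module ℝ X] [AddCommGroup Y] [Module ℝ Y]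
  {R : RootPairing ι ℝ X Y} [Finite ι] [R.IsCrystallographic]

theorem IsMin.subset_par_cow {B : Set ι} (hB : IsMin R B) (i : ι) : B ⊆ par R (cow R B i) := by
  intro j hj
  have key : ∀ x ∈ AddSubmonoid.closure (R.root '' minimalSimple R B),
      0 ≤ R.toLinearMap x (cow R B i) := by
    intro x hx
    induction hx using AddSubmonoid.closure_induction with
    | mem x hx =>
      obtain ⟨k, hk, rfl⟩ := hx
      change 0 ≤ R.root' k (cow R B i)
      rw [(hB.cow_spec i).2 k hk]
      split_ifs <;> simp
    | zero => simp
    | add x y _ _ hx hy =>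
      rw [map_add, LinearMap.add_apply]
      exact add_nonneg hx hy
  exact key _ (hB.root_mem_closure hj)

/-- As `w` is nonnegative on `B`, a root killed by `w` can split only into roots killed by `w`.
Simplicity of such a root is thus decided inside the hyperplane of `w` and survives a crossing of
the wall. -/
theorem minimalSimple_inter {B : Set ι} {w : Y} (h : B ⊆ par R w) (j : ι)
    (hj : R.root' j w = 0) : j ∈ minimalSimple R B ↔ j ∈ B ∧ ∀ k ∈ B, ∀ l ∈ B,
      R.root' k w = 0 → R.root' l w = 0 → R.root j ≠ R.root k + R.root l := by
  refine and_congr_right fun hjB => ⟨fun h' k hk l hl _ _ => h' k hk l hl,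
    fun h' k hk l hl e => ?_⟩
  have h1 : R.toLinearMap (R.root j) w = R.toLinearMap (R.root k) w + R.toLinearMap (R.root l) w := by
    rw [e, map_add, LinearMap.add_apply]
  have hk' : 0 ≤ R.toLinearMap (R.root k) w := h hk
  have hl' : 0 ≤ R.toLinearMap (R.root l) w := h hl
  have hj' : R.toLinearMap (R.root j) w = 0 := hj
  exact h' k hk l hl (show R.toLinearMap (R.root k) w = 0 by linarith)
    (show R.toLinearMap (R.root l) w = 0 by linarith) e

theorem IsMin.card_simple {B : Set ι} (hB : IsMin R B) :
    (simple R B).card = Module.finrank ℝ (corootSpan R Set.univ) := by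
  have := Fintype.ofFinite (minimalSimple R B)
  rw [hB.corootSpan_univ, corootSpan, Set.image_eq_range]
  have h := finrank_span_eq_card (hB.linearIndepOn_coroot)
  refine Eq.trans ?_ h.symm
  rw [simple, Set.Finite.card_toFinset]

variable (R) in
/-- Adjacent pairs `(Q, i)`, `(Q', i')`: the elements of `𝒫(L)` on the two sides of the wall
orthogonal to the simple root `i`. -/
structure Opp (L B : Set ι) (Q : Set ι) (i : ι) (Q' : Set ι) (i' : ι) : Prop where
  left : Q ∈ parabolicsOfLevi R L
  right : Q' ∈ parabolicsOfLevi R L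
  mem_left : i ∈ minimalSimple R (refine L B Q)
  mem_right : i' ∈ minimalSimple R (refine L B Q')
  notMem_left : i ∉ L
  notMem_right : i' ∉ L
  cow_eq : ∃ s : ℝ, 0 < s ∧ cow R (refine L B Q') i' = -(s • cow R (refine L B Q) i)
  mem_iff : ∀ j, R.root' j (cow R (refine L B Q) i) = 0 → (j ∈ Q ↔ j ∈ Q')

theorem Opp.symm {L B Q Q' : Set ι} {i i' : ι} (h : Opp R L B Q i Q' i') :
    Opp R L B Q' i' Q i := by
  obtain ⟨s, hs, e⟩ := h.cow_eq
  refine ⟨h.right, h.left, h.mem_right, h.mem_left, h.notMem_right, h.notMem_left,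
    ⟨s⁻¹, inv_pos.2 hs, ?_⟩, fun j hj => (h.mem_iff j ?_).symm⟩
  · rw [e, smul_neg, neg_neg, smul_smul, inv_mul_cancel₀ hs.ne', one_smul]
  · rw [e, map_neg, map_smul, neg_eq_zero, smul_eq_mul] at hj
    exact (mul_eq_zero.1 hj).resolve_left hs.ne'

section

variable {L B Q : Set ι} {i : ι} (hB : IsMin R B) (hQ : Q ∈ parabolicsOfLevi R L)

include hB hQ

theorem cow_refine_mem (hi : i ∉ L) : cow R (refine L B Q) i ∈ aReal R L := by
  have := (refine_isMin hQ hB).cow_mem_aReal hQ.1 (refine_subset hQ) (i := i) (by rwa [hQ.2])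
  rwa [hQ.2] at this

theorem subset_par_cow_refine (hi : i ∉ L) : Q ⊆ par R (cow R (refine L B Q) i) := by
  intro j hj
  by_cases hL : j ∈ L
  · exact ge_of_eq (cow_refine_mem hB hQ hi j hL)
  · exact (refine_isMin hQ hB).subset_par_cow i (Or.inl ⟨hj, hL⟩)

theorem Opp.unique {Q' Q'' : Set ι} {i' i'' : ι} (h : Opp R L B Q i Q' i')
    (h' : Opp R L B Q i Q'' i'') : Q' = Q'' ∧ i' = i'' := by
  have key : ∀ {Q' : Set ι} {i' : ι}, Opp R L B Q i Q' i' → ∀ j, j ∈ Q' ↔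
      R.root' j (cow R (refine L B Q) i) < 0 ∨
        R.root' j (cow R (refine L B Q) i) = 0 ∧ j ∈ Q := by
    intro Q' i' h j
    obtain ⟨s, hs, e⟩ := h.cow_eq
    have hsub := subset_par_cow_refine hB h.right h.notMem_right
    have hval : R.root' j (cow R (refine L B Q') i') =
        -(s * R.root' j (cow R (refine L B Q) i)) := by
      rw [e, map_neg, map_smul, smul_eq_mul]
    rcases lt_trichotomy (R.root' j (cow R (refine L B Q) i)) 0 with h1 | h1 | h1
    · have : j ∈ Q' := pos_mem h.right.1 hsub (by rw [hval]; nlinarith)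
      simp [h1, this]
    · simp [h1, h.mem_iff j h1]
    · have : j ∉ Q' := fun hj => by
        have : 0 ≤ R.root' j (cow R (refine L B Q') i') := hsub hj
        rw [hval] at this
        nlinarith
      simp [h1.not_gt, h1.ne', this]
  have hQQ : Q' = Q'' := Set.ext fun j => (key h j).trans (key h' j).symm
  subst hQQ
  refine ⟨rfl, ?_⟩
  by_contra hne
  obtain ⟨s, hs, e⟩ := h.cow_eq
  obtain ⟨s', hs', e'⟩ := h'.cow_eq
  have hB' := refine_isMin h.right hB
  have h1 := hB'.root'_cow_ne h.mem_right (i := i'') hne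
  have h2 := hB'.root'_cow_self h.mem_right
  rw [e', map_neg, map_smul, neg_eq_zero, smul_eq_mul] at h1
  rw [e, map_neg, map_smul, smul_eq_mul, (mul_eq_zero.1 h1).resolve_left hs'.ne', mul_zero,
    neg_zero] at h2
  exact zero_ne_one h2

/-- `Q'` agrees with `Q` on the roots orthogonal to the coweight `w` and takes the negative side of
`w` elsewhere. Simple roots orthogonal to `w` are common to both sides. As both sides have the same
number of simple roots, one more remains for `Q'`, and its coweight must be a negative multiple of
`w`. -/
theorem exists_opp (hi : i ∈ minimalSimple R (refine L B Q)) (hiL : i ∉ L) :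
    ∃ Q' i', Opp R L B Q i Q' i' := by
  classical
  set w := cow R (refine L B Q) i with hw
  have hmin := refine_isMin hQ hB
  have hwL := cow_refine_mem hB hQ hiL
  have hQw := subset_par_cow_refine hB hQ hiL
  rw [← hw] at hwL hQw
  obtain ⟨⟨K, hK⟩, hL⟩ := id hQ
  have hK' : Q = par R K := hK
  have hLw : ∀ j ∈ L, R.root' j w = 0 := hwL
  have hneg : ∀ j, R.root' j (-w) = -R.root' j w := fun j => map_neg _ _
  have hmemQ' : ∀ j, j ∈ lex R (-w) K ↔ R.root' j w < 0 ∨ R.root' j w = 0 ∧ j ∈ Q := by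
    intro j
    change (0 < R.root' j (-w) ∨ R.root' j (-w) = 0 ∧ j ∈ par R K) ↔ _
    rw [hneg, neg_pos, neg_eq_zero, hK']
  have hQ' : lex R (-w) K ∈ parabolicsOfLevi R L := by
    refine ⟨isParabolic_lex R _ _, ?_⟩
    rw [levi_lex, levi_par R (-w), ← hK', hL]
    refine Set.inter_eq_right.2 fun j hj => ?_
    change R.root' j (-w) = 0
    rw [hneg, hLw j hj, neg_zero]
  set Q' := lex R (-w) K
  have hmin' := refine_isMin hQ' hB
  have hB'w : refine L B Q' ⊆ par R (-w) := by
    rintro j (hj | hj)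
    · exact lex_subset R _ _ hj.1
    · change 0 ≤ R.root' j (-w)
      rw [hneg, hLw j hj.2, neg_zero]
  have hBw : refine L B Q ⊆ par R w := hmin.subset_par_cow i
  have hmem : ∀ j, R.root' j w = 0 → (j ∈ refine L B Q ↔ j ∈ refine L B Q') := by
    intro j hj
    rw [mem_refine, mem_refine, hmemQ', hj]
    simp
  have hsimple : ∀ j, R.root' j w = 0 →
      (j ∈ minimalSimple R (refine L B Q) ↔ j ∈ minimalSimple R (refine L B Q')) := by
    intro j hj
    rw [minimalSimple_inter hBw j hj, minimalSimple_inter hB'w j (by rw [hneg, hj, neg_zero]),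
      hmem j hj]
    refine and_congr_right fun _ => ⟨fun h k hk l hl hk0 hl0 => ?_, fun h k hk l hl hk0 hl0 => ?_⟩
    · rw [hneg, neg_eq_zero] at hk0 hl0
      exact h k ((hmem k hk0).2 hk) l ((hmem l hl0).2 hl) hk0 hl0
    · exact h k ((hmem k hk0).1 hk) l ((hmem l hl0).1 hl) (by rw [hneg, hk0, neg_zero])
        (by rw [hneg, hl0, neg_zero])
  have hne : ∀ j ∈ minimalSimple R (refine L B Q), j ≠ i ↔ R.root' j w = 0 := by
    intro j hj
    constructor
    · exact fun h => hmin.root'_cow_ne hj h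
    · rintro h rfl
      rw [hw, hmin.root'_cow_self hj] at h
      exact one_ne_zero h
  -- the remaining simple root
  obtain ⟨i', hi', hi'w⟩ : ∃ i' ∈ minimalSimple R (refine L B Q'), R.root' i' w ≠ 0 := by
    by_contra hcon
    push Not at hcon
    have hsub : simple R (refine L B Q') ⊆ (simple R (refine L B Q)).erase i := by
      intro j hj
      rw [mem_simple] at hj
      have hj' := (hsimple j (hcon j hj)).2 hj
      rw [Finset.mem_erase, mem_simple]
      exact ⟨(hne j hj').2 (hcon j hj), hj'⟩
    have hcard := Finset.card_le_card hsub
    rw [Finset.card_erase_of_mem (by simpa using hi), hmin'.card_simple, ← hmin.card_simple] at hcard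
    have : 0 < (simple R (refine L B Q)).card := Finset.card_pos.2 ⟨i, by simpa using hi⟩
    omega
  have hi'neg : R.root' i' w < 0 := by
    have : 0 ≤ R.root' i' (-w) := hB'w hi'.1
    rw [hneg] at this
    exact lt_of_le_of_ne (by linarith) hi'w
  refine ⟨Q', i', hQ, hQ', hi, hi', hiL, fun h => hi'w (hLw i' h), ?_, fun j hj => ?_⟩
  · have hcow : cow R (refine L B Q') i' =
        R.root' i (cow R (refine L B Q') i') • w := by
      rw [← sub_eq_zero]
      refine hmin.eq_zero (sub_mem (hmin'.cow_spec i').1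
        (Submodule.smul_mem _ _ (hmin.cow_spec i).1)) fun j hj => ?_
      rw [map_sub, map_smul, smul_eq_mul]
      by_cases hji : j = i
      · subst hji
        rw [hw, hmin.root'_cow_self hj, mul_one, sub_self]
      · have h0 := (hne j hj).1 hji
        rw [h0, mul_zero, sub_zero]
        refine hmin'.root'_cow_ne ((hsimple j h0).1 hj) ?_
        rintro rfl
        exact hi'w h0
    refine ⟨-R.root' i (cow R (refine L B Q') i'), ?_, ?_⟩
    · have h1 := hmin'.root'_cow_self hi'
      rw [hcow, map_smul, smul_eq_mul] at h1
      by_contra hcon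
      nlinarith
    · rw [neg_smul, neg_neg]
      exact hcow
  · have hj' : R.root' j w = 0 := hj
    rw [hmemQ' j, hj']
    simp

end

variable {L B Q Q' : Set ι} {i i' : ι}

theorem Opp.root'_eq_zero_iff (h : Opp R L B Q i Q' i') (j : ι) :
    R.root' j (cow R (refine L B Q') i') = 0 ↔ R.root' j (cow R (refine L B Q) i) = 0 := by
  obtain ⟨s, hs, e⟩ := h.cow_eq
  rw [e, map_neg, map_smul, neg_eq_zero, smul_eq_mul, mul_eq_zero]
  exact or_iff_right hs.ne'

theorem Opp.mem_refine_iff (h : Opp R L B Q i Q' i') (j : ι)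
    (hj : R.root' j (cow R (refine L B Q) i) = 0) (P : Set ι) :
    j ∈ refine L P Q ↔ j ∈ refine L P Q' := by
  rw [mem_refine, mem_refine, h.mem_iff j hj]

theorem Opp.mem_simple_iff (hB : IsMin R B) (h : Opp R L B Q i Q' i') (j : ι) :
    j ∈ minimalSimple R (refine L B Q) ∧ j ≠ i ↔ j ∈ minimalSimple R (refine L B Q') ∧ j ≠ i' := by
  have key : ∀ {Q Q' : Set ι} {i i' : ι}, Opp R L B Q i Q' i' →
      j ∈ minimalSimple R (refine L B Q) ∧ j ≠ i →
        j ∈ minimalSimple R (refine L B Q') ∧ j ≠ i' := by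
    rintro Q Q' i i' h ⟨hj, hji⟩
    have hmin := refine_isMin h.left hB
    have hmin' := refine_isMin h.right hB
    have h0 := hmin.root'_cow_ne hj hji
    have h0' := (h.root'_eq_zero_iff j).2 h0
    constructor
    · rw [minimalSimple_inter (hmin.subset_par_cow i) j h0] at hj
      rw [minimalSimple_inter (hmin'.subset_par_cow i') j h0', ← h.mem_refine_iff j h0]
      refine ⟨hj.1, fun k hk l hl hk0 hl0 => ?_⟩
      rw [h.root'_eq_zero_iff] at hk0 hl0
      exact hj.2 k ((h.mem_refine_iff k hk0 B).2 hk) l ((h.mem_refine_iff l hl0 B).2 hl) hk0 hl0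
    · rintro rfl
      have := hmin'.root'_cow_self h.mem_right
      rw [h0'] at this
      exact zero_ne_one this
  exact ⟨key h, key h.symm⟩

/-- All simple coroots other than those of `i` and `i'` are shared, so the two weights are
proportional. The sign follows from the coweights: the invariant form relates weights to coweights
by positive factors, and the two coweights are opposite. -/
theorem Opp.wt_eq (hB : IsMin R B) (h : Opp R L B Q i Q' i') :
    ∃ t : ℝ, 0 < t ∧ wt R (refine L B Q') i' = -t • wt R (refine L B Q) i := by
  have hmin := refine_isMin h.left hB
  have hmin' := refine_isMin h.right hB
  have heq : wt R (refine L B Q') i' =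
      wt R (refine L B Q') i' (R.coroot i) • wt R (refine L B Q) i := by
    ext η
    obtain ⟨z, hz, e⟩ := hmin.sum_wt_add η
    conv_lhs => rw [e]
    rw [map_add, hmin'.wt_aReal h.mem_right hz, add_zero, map_sum, Finset.sum_eq_single i]
    · rw [map_smul, LinearMap.smul_apply, smul_eq_mul, smul_eq_mul, mul_comm]
    · intro j hj hji
      have := (h.mem_simple_iff hB j).1 ⟨by simpa using hj, hji⟩
      rw [map_smul, hmin'.wt_coroot_ne h.mem_right this.1 this.2, smul_zero]
    · intro h'
      exact absurd h.mem_left (by simpa using h')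
  refine ⟨-wt R (refine L B Q') i' (R.coroot i), ?_, by rw [neg_neg]; exact heq⟩
  obtain ⟨b, c, hc, hs, hbc, hb, -⟩ := hmin.exists_form_cow
  obtain ⟨s, hs0, e⟩ := h.cow_eq
  have h1 : c i * wt R (refine L B Q) i (R.coroot i') =
      c i' * R.root' i' (cow R (refine L B Q) i) := by
    rw [← hb i h.mem_left, hs, hbc]
  have h2 := hmin'.root'_cow_self h.mem_right
  rw [e, map_neg, map_smul, smul_eq_mul] at h2
  have h3 := hmin'.wt_coroot_self h.mem_right
  rw [heq, LinearMap.smul_apply, smul_eq_mul] at h3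
  have h4 : R.root' i' (cow R (refine L B Q) i) < 0 := by
    by_contra hcon
    nlinarith
  have h5 : wt R (refine L B Q) i (R.coroot i') < 0 := by
    by_contra hcon
    have := mul_nonneg (hc i).le (not_lt.1 hcon)
    have := mul_neg_of_pos_of_neg (hc i') h4
    linarith
  by_contra hcon
  nlinarith

/-- On the wall the coordinate along the coroot of `i` vanishes, and the expansion involves, besides
the center, only coroots common to both sides. -/
theorem Opp.wt_eq_of_eq_zero (hB : IsMin R B) (h : Opp R L B Q i Q' i') {η : Y}
    (hη : wt R (refine L B Q) i η = 0) {j : ι} (hj : j ∈ minimalSimple R (refine L B Q))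
    (hji : j ≠ i) : wt R (refine L B Q') j η = wt R (refine L B Q) j η := by
  have hmin := refine_isMin h.left hB
  have hmin' := refine_isMin h.right hB
  have hj' := ((h.mem_simple_iff hB j).1 ⟨hj, hji⟩).1
  obtain ⟨z, hz, e⟩ := hmin.sum_wt_add η
  conv_lhs => rw [e]
  rw [map_add, hmin'.wt_aReal hj' hz, add_zero, map_sum, Finset.sum_eq_single j]
  · rw [map_smul, hmin'.wt_coroot_self hj', smul_eq_mul, mul_one]
  · intro k hk hkj
    by_cases hki : k = i
    · rw [hki, hη, zero_smul, map_zero]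
    · have := (h.mem_simple_iff hB k).1 ⟨by simpa using hk, hki⟩
      rw [map_smul, hmin'.wt_coroot_ne hj' this.1 hkj, smul_zero]
  · intro h'
    exact absurd hj (by simpa using h')

end Opposite

end Cofamily

end

noncomputable section

namespace Cofamily

set_option linter.unusedSectionVars false

open Complex

/-! ### The characters $q^{-\langle\lambda,H\rangle}$ and $\vartheta$ as a regularized sum over a
cone. -/

section Complexified

variable {ι X Y : Type*} [AddCommGroup X] [Module ℝ X] [NormedAddCommGroup Y] [NormedSpace ℝ Y]
  [FiniteDimensional ℝ Y] [Finite ι] {R : RootPairing ι ℝ X Y} {M : Set ι} {q : ℕ}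

theorem qpow_add (hq : 1 < q) (l : aC R M) (H H' : Y) :
    qpow R q l (H + H') = qpow R q l H * qpow R q l H' := by
  have : (q : ℂ) ≠ 0 := by exact_mod_cast (by omega : q ≠ 0)
  rw [qpow, map_add, neg_add, cpow_add _ _ this, qpow, qpow]

theorem qpow_add_left (hq : 1 < q) (l l' : aC R M) (H : Y) :
    qpow R q (l + l') H = qpow R q l H * qpow R q l' H := by
  have : (q : ℂ) ≠ 0 := by exact_mod_cast (by omega : q ≠ 0)
  rw [qpow, extend_add, neg_add, cpow_add _ _ this, qpow, qpow]

theorem qpow_zero (l : aC R M) : qpow R q l (0 : Y) = 1 := by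
  rw [qpow, map_zero, neg_zero, cpow_zero]

theorem qpow_ne_zero (hq : 1 < q) (l : aC R M) (H : Y) : qpow R q l H ≠ 0 := by
  have : (q : ℂ) ≠ 0 := by exact_mod_cast (by omega : q ≠ 0)
  rw [qpow, Ne, cpow_eq_zero_iff]
  exact fun h => this h.1

theorem norm_qpow (hq : 1 < q) (l : aC R M) (H : Y) :
    ‖qpow R q l H‖ = (q : ℝ) ^ (-(extend R l H).re) := by
  rw [qpow, norm_natCast_cpow_of_pos (by omega), neg_re]

theorem qpow_intCast_smul (l : aC R M) (k : ℤ) (H : Y) :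
    qpow R q l ((k : ℝ) • H) = qpow R q l H ^ k := by
  rw [qpow, qpow, map_smul, ← cpow_int_mul, Complex.real_smul]
  congr 1
  push_cast
  ring

theorem qpow_sum {κ : Type*} (hq : 1 < q) (l : aC R M) (s : Finset κ) (v : κ → Y) :
    qpow R q l (∑ i ∈ s, v i) = ∏ i ∈ s, qpow R q l (v i) := by
  classical
  induction s using Finset.induction_on with
  | empty => simp [qpow_zero]
  | insert a s ha ih => rw [Finset.sum_insert ha, Finset.prod_insert ha, qpow_add hq, ih]

theorem qpow_inv_smul (l : aC R M) (b : ℕ) (H : Y) :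
    qpow R q ((b : ℂ)⁻¹ • l) H = qpow R q l ((b : ℝ)⁻¹ • H) := by
  rw [qpow, qpow, extend_smul, map_smul, Complex.real_smul]
  push_cast
  rfl

open Classical in
/-- The lattice generated by a family of vectors with a dual family of forms. -/
theorem exists_latticeHom {κ : Type*} (J : Finset κ) (v : κ → Y)
    (f : κ → Module.Dual ℝ Y) (hf : ∀ i ∈ J, ∀ j ∈ J, f i (v j) = if i = j then 1 else 0) :
    ∃ e : (J → ℤ) →+ Y, Function.Injective e ∧ (∀ k, e k = ∑ i : J, (k i : ℝ) • v i) ∧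
      (∀ (k : J → ℤ) (i : J), f i (e k) = k i) ∧
      ∀ H, H ∈ AddSubgroup.closure (v '' J) ↔ H ∈ Set.range e := by
  let e : (J → ℤ) →+ Y :=
    { toFun := fun k => ∑ i : J, (k i : ℝ) • v i
      map_zero' := by simp
      map_add' := fun k k' => by
        simp [add_smul, Finset.sum_add_distrib] }
  have hfe : ∀ (k : J → ℤ) (i : J), f i (e k) = k i := by
    intro k i
    change f i (∑ j : J, (k j : ℝ) • v j) = _
    rw [map_sum, Finset.sum_eq_single i]
    · rw [map_smul, hf i i.2 i i.2, if_pos rfl, smul_eq_mul, mul_one]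
    · intro j _ hji
      rw [map_smul, hf i i.2 j j.2, if_neg (fun h => hji (Subtype.ext h.symm)), smul_zero]
    · intro h
      exact absurd (Finset.mem_univ _) h
  refine ⟨e, fun k k' h => ?_, fun k => rfl, hfe, fun H => ⟨fun hH => ?_, ?_⟩⟩
  · funext i
    have := congrArg (f i) h
    rw [hfe, hfe] at this
    exact_mod_cast this
  · refine AddSubgroup.closure_induction (p := fun H _ => H ∈ Set.range e) ?_ ?_ ?_ ?_ hH
    · rintro _ ⟨i, hi, rfl⟩
      refine ⟨Pi.single ⟨i, hi⟩ 1, ?_⟩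
      change ∑ j : J, ((Pi.single (⟨i, hi⟩ : J) (1 : ℤ) : J → ℤ) j : ℝ) • v j = v i
      rw [Finset.sum_eq_single ⟨i, hi⟩]
      · simp
      · intro j _ hj
        simp [Pi.single_eq_of_ne hj]
      · intro h
        exact absurd (Finset.mem_univ _) h
    · exact ⟨0, map_zero e⟩
    · rintro _ _ _ _ ⟨k, rfl⟩ ⟨k', rfl⟩
      exact ⟨k + k', map_add e k k'⟩
    · rintro _ _ ⟨k, rfl⟩
      exact ⟨-k, map_neg e k⟩
  · rintro ⟨k, rfl⟩
    refine sum_mem fun i _ => ?_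
    have : ((k i : ℤ) : ℝ) • v i = k i • v i := Int.cast_smul_eq_zsmul ℝ _ _
    rw [this]
    have hm : v i ∈ v '' (J : Set κ) := Set.mem_image_of_mem _ i.2
    exact AddSubgroup.zsmul_mem _ (AddSubgroup.subset_closure hm) _

open Classical in
/-- Regularized sums over the lattice generated by a family of vectors. -/
theorem regSum_family {κ : Type*} (hq : 1 < q) (l : aC R M) (J : Finset κ) (v : κ → Y)
    (f : κ → Module.Dual ℝ Y) (hf : ∀ i ∈ J, ∀ j ∈ J, f i (v j) = if i = j then 1 else 0)
    (hx : ∀ i ∈ J, qpow R q l (v i) ≠ 1) {S : κ → ℤ → ℂ} {t : κ → ℂ}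
    (hS : ∀ i ∈ J, Summable fun k : ℤ => ‖(S i k - S i (k - 1)) * qpow R q l (v i) ^ k‖)
    (ht : ∀ i ∈ J, HasSum (fun k : ℤ => (S i k - S i (k - 1)) * qpow R q l (v i) ^ k) (t i)) :
    RegSum (qpow R q l)
      (fun H => if H ∈ AddSubgroup.closure (v '' J) then ∏ i ∈ J, S i ⌊f i H⌋ else 0)
      (∏ i ∈ J, t i / (1 - qpow R q l (v i))) := by
  obtain ⟨e, he, hek, hfe, hrange⟩ := exists_latticeHom J v f hf
  refine RegSum.map e he (fun H hH => if_neg (by rwa [hrange])) ?_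
  rw [← Finset.prod_coe_sort J]
  have h := RegSum.pi (χ := fun k => qpow R q l (e k)) (x := fun i : J => qpow R q l (v i))
    (fun k => by
      rw [hek, qpow_sum hq]
      exact Finset.prod_congr rfl fun i _ => qpow_intCast_smul l _ _)
    (fun i => hx i i.2) (S := fun i : J => S i) (t := fun i : J => t i)
    (fun i => hS i i.2) (fun i => ht i i.2)
  convert h using 2 with k
  rw [if_pos ((hrange _).2 ⟨k, rfl⟩), ← Finset.prod_coe_sort J]
  refine Finset.prod_congr rfl fun i _ => ?_
  rw [hfe, Int.floor_intCast]

variable [R.IsCrystallographic] {B P Q : Set ι}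

theorem IsMin.vartheta_eq (hq : 1 < q) (hB : IsMin R B) (hQ : IsParabolic R Q) (h : B ⊆ Q) (ξ : Y)
    (l : aC R M) : vartheta R q Q Set.univ ξ l = ∏ i ∈ simpleRel R B Q Set.univ,
      qpow R q l (cor R Q i) ^ (⌊wt R B i ξ⌋ + 1) / (1 - qpow R q l (cor R Q i)) := by
  have hset : (minimalSimple R B \ levi R Q) = (simpleRel R B Q Set.univ : Set ι) := by
    ext i
    rw [Finset.mem_coe, mem_simpleRel_univ]
    rfl
  rw [vartheta, hB.simpleCoroots_univ_eq hQ h, finprod_mem_image (hB.injOn_cor hQ h), hset,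
    finprod_mem_coe_finset, hB.bracket_eq hQ h, qpow_sum hq, ← Finset.prod_mul_distrib]
  refine Finset.prod_congr rfl fun i _ => ?_
  rw [qpow_intCast_smul, mul_one_div]

theorem IsMin.varthetaHat_eq (hB : IsMin R B) (hP : IsParabolic R P) (hQ : IsParabolic R Q)
    (h : B ⊆ P) (hPQ : P ⊆ Q) (l : aC R M) : varthetaHat R q P Q l =
      ∏ i ∈ simpleRel R B P Q, 1 / (1 - qpow R q l (cowRel R B Q i)) := by
  rw [varthetaHat, hB.coweights_eq hP hQ h hPQ, finprod_mem_image hB.injOn_cowRel,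
    ← coe_simpleRel, finprod_mem_coe_finset]

theorem closure_scaled (b : ℕ) (S : Set ι) (v : ι → Y) :
    scaledLattice b (v '' S) = AddSubgroup.closure ((fun i => (b : ℝ)⁻¹ • v i) '' S) := by
  rw [scaledLattice, Set.image_image]

/-- The lattice `(1/b) ℤ(Δ_Q^∨)` depends only on the Levi factor of `Q`. -/
theorem scaledLattice_le {L Q' : Set ι} (hQ : Q ∈ parabolicsOfLevi R L)
    (hQ' : Q' ∈ parabolicsOfLevi R L) (b : ℕ) :
    scaledLattice b (simpleCoroots R Q Set.univ) ≤ scaledLattice b (simpleCoroots R Q' Set.univ) := by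
  obtain ⟨B, hB, h⟩ := exists_isMin_subset R hQ.1
  obtain ⟨B', hB', h'⟩ := exists_isMin_subset R hQ'.1
  rw [hB.simpleCoroots_univ_eq hQ.1 h, hB'.simpleCoroots_univ_eq hQ'.1 h', closure_scaled,
    closure_scaled, AddSubgroup.closure_le]
  -- `p` depends only on `L`. It maps simple coroots to the required generators or to zero, and the
  -- coroot lattice does not depend on the minimal parabolic by `IsMin.closure_coroot_le`.
  let p : Y →+ Y := ((b : ℝ)⁻¹ • (LinearMap.id - projUpper R L)).toAddMonoidHom
  have hp : ∀ {Q : Set ι}, Q ∈ parabolicsOfLevi R L → ∀ i, p (R.coroot i) =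
      (b : ℝ)⁻¹ • cor R Q i := by
    intro Q hQ i
    rw [cor, hQ.2]
    rfl
  rintro _ ⟨i, hi, rfl⟩
  simp only [SetLike.mem_coe]
  rw [← hp hQ]
  have hm : R.coroot i ∈ R.coroot '' minimalSimple R B := Set.mem_image_of_mem _ hi.1
  have h1 := hB'.closure_coroot_le hB (AddSubgroup.subset_closure hm)
  refine AddSubgroup.closure_induction (p := fun y _ => p y ∈ AddSubgroup.closure
    ((fun i => (b : ℝ)⁻¹ • cor R Q' i) '' (minimalSimple R B' \ levi R Q'))) ?_ ?_ ?_ ?_ h1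
  · rintro _ ⟨j, hj, rfl⟩
    rw [hp hQ']
    by_cases hjL : j ∈ levi R Q'
    · rw [cor_eq_zero R hjL, smul_zero]
      exact zero_mem _
    · have hm : (b : ℝ)⁻¹ • cor R Q' j ∈ (fun i => (b : ℝ)⁻¹ • cor R Q' i) ''
          (minimalSimple R B' \ levi R Q') := ⟨j, ⟨hj, hjL⟩, rfl⟩
      exact AddSubgroup.subset_closure hm
  · rw [map_zero]
    exact zero_mem _
  · intro x y _ _ hx hy
    rw [map_add]
    exact add_mem hx hy
  · intro x _ hx
    rw [map_neg]
    exact neg_mem hx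

theorem scaledLattice_eq {L Q' : Set ι} (hQ : Q ∈ parabolicsOfLevi R L)
    (hQ' : Q' ∈ parabolicsOfLevi R L) (b : ℕ) :
    scaledLattice b (simpleCoroots R Q Set.univ) = scaledLattice b (simpleCoroots R Q' Set.univ) :=
  le_antisymm (scaledLattice_le hQ hQ' b) (scaledLattice_le hQ' hQ b)

theorem IsMin.wt_scaled (hB : IsMin R B) (hQ : IsParabolic R Q) (h : B ⊆ Q) {b : ℕ} (hb : 1 ≤ b)
    {i : ι} (hi : i ∈ minimalSimple R B) (hi' : i ∉ levi R Q) {H : Y}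
    (hH : H ∈ scaledLattice b (simpleCoroots R Q Set.univ)) : ∃ z : ℤ, b * wt R B i H = z := by
  rw [hB.simpleCoroots_univ_eq hQ h, closure_scaled] at hH
  have hb' : (b : ℝ) ≠ 0 := by positivity
  refine exists_int_of_mem_closure (f := (b : ℝ) • wt R B i) ?_ hH
  rintro _ ⟨j, hj, rfl⟩
  rw [LinearMap.smul_apply, map_smul, hB.wt_cor hQ h hi hi', (hB.wt_spec hi).1 j hj.1]
  split_ifs
  · exact ⟨1, by simp [hb']⟩
  · exact ⟨0, by simp⟩

-- In the coordinates $b\varpi_i$ the lattice is $\mathbb Z^n$ and the shifted cone is a product of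
-- half-lines. The bracket $[c]$, the smallest integer $>c$, is the first index on a half-line cut
-- out by a strict inequality.
open Classical in
theorem IsMin.regSum_vartheta (hq : 1 < q) (hB : IsMin R B) (hQ : IsParabolic R Q) (h : B ⊆ Q)
    {b : ℕ} (hb : 1 ≤ b) (ξ : Y) (l : aC R M)
    (hreg : ∀ v ∈ simpleCoroots R Q Set.univ, qpow R q ((b : ℂ)⁻¹ • l) v ≠ 1) :
    RegSum (qpow R q l) (fun H => if H ∈ scaledLattice b (simpleCoroots R Q Set.univ) then
        (if ∀ i ∈ simpleRel R B Q Set.univ, 0 < wt R B i (H - ξ) then 1 else 0) else 0)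
      (vartheta R q Q Set.univ ((b : ℝ) • ξ) ((b : ℂ)⁻¹ • l)) := by
  have hb' : (0 : ℝ) < b := by positivity
  rw [hB.vartheta_eq hq hQ h]
  have hset : (minimalSimple R B \ levi R Q) = (simpleRel R B Q Set.univ : Set ι) := by
    ext i
    rw [Finset.mem_coe, mem_simpleRel_univ]
    rfl
  simp only [qpow_inv_smul]
  have key := regSum_family hq l (simpleRel R B Q Set.univ) (fun i => (b : ℝ)⁻¹ • cor R Q i)
    (fun i => (b : ℝ) • wt R B i) (fun i hi j hj => by
      rw [mem_simpleRel_univ] at hi hj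
      rw [LinearMap.smul_apply, map_smul, hB.wt_cor hQ h hi.1 hi.2, (hB.wt_spec hi.1).1 j hj.1]
      simp only [eq_comm (a := j)]
      split_ifs <;> simp [hb'.ne'])
    (fun i hi => by
      rw [← qpow_inv_smul]
      refine hreg _ ?_
      rw [hB.simpleCoroots_univ_eq hQ h, hset]
      exact Set.mem_image_of_mem _ hi)
    (S := fun i k => if wt R B i ((b : ℝ) • ξ) < k then 1 else 0)
    (t := fun i => 1 * qpow R q l ((b : ℝ)⁻¹ • cor R Q i) ^ (⌊wt R B i ((b : ℝ) • ξ)⌋ + 1))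
    (fun i _ => (hasSum_truncated _ _ _).1) (fun i _ => (hasSum_truncated _ _ _).2)
  simp only [one_mul] at key
  convert key using 2 with H
  rw [hB.simpleCoroots_univ_eq hQ h, closure_scaled, ← hset]
  by_cases hH : H ∈ AddSubgroup.closure ((fun i => (b : ℝ)⁻¹ • cor R Q i) ''
      (minimalSimple R B \ levi R Q))
  swap
  · rw [if_neg hH, if_neg hH]
  rw [if_pos hH, if_pos hH, Finset.prod_ite_zero]
  simp only [Finset.prod_const_one]
  refine if_congr (forall₂_congr fun i hi => ?_) rfl rfl
  rw [mem_simpleRel_univ] at hi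
  obtain ⟨z, hz⟩ := hB.wt_scaled hQ h hb hi.1 hi.2 (H := H) (by
    rw [hB.simpleCoroots_univ_eq hQ h, closure_scaled]
    exact hH)
  rw [LinearMap.smul_apply, smul_eq_mul, hz, Int.floor_intCast, ← hz, map_smul, map_sub,
    smul_eq_mul, sub_pos]
  exact (mul_lt_mul_iff_right₀ hb').symm

end Complexified

end Cofamily

end

noncomputable section

namespace Cofamily

set_option linter.unusedSectionVars false

open Complex

/-! ### Co-adjacency, gluing Levi subgroups and general position. -/

section Gluing

variable {ι X Y : Type*} [AddCommGroup X] [Module ℝ X] [AddCommGroup Y] [Module ℝ Y]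
  {R : RootPairing ι ℝ X Y} [Finite ι] [R.IsCrystallographic]

/-- A point killed by all simple roots but one is, modulo the center, a multiple of a
fundamental coweight. -/
theorem IsMin.root'_eq_mul (hB : IsMin R B) {i : ι} {H : Y}
    (hH : ∀ j ∈ minimalSimple R B, j ≠ i → R.root' j H = 0) (hi : i ∈ minimalSimple R B) (j : ι) :
    R.root' j H = R.root' i H * R.root' j (cow R B i) := by
  have h0 : projUpper R Set.univ H = R.root' i H • cow R B i := by
    rw [← sub_eq_zero]
    refine hB.eq_zero (sub_mem (projUpper_mem R _ _) (Submodule.smul_mem _ _ (hB.cow_spec i).1))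
      fun k hk => ?_
    rw [map_sub, map_smul, root'_projUpper R (Set.mem_univ k), smul_eq_mul]
    by_cases hki : k = i
    · subst hki
      rw [hB.root'_cow_self hk, mul_one, sub_self]
    · rw [hH k hk hki, hB.root'_cow_ne hk hki, mul_zero, sub_zero]
  rw [← root'_projUpper R (Set.mem_univ j) H, h0, map_smul, smul_eq_mul]

theorem par_smul_pos {t : ℝ} (ht : 0 < t) {H H' : Y}
    (h : ∀ j, R.root' j H = t * R.root' j H') : par R H = par R H' := by
  ext j
  change 0 ≤ R.root' j H ↔ 0 ≤ R.root' j H'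
  rw [h]
  exact mul_nonneg_iff_of_pos_left ht

variable {L B Q Q' P : Set ι} {i i' : ι}

theorem Opp.refine_subset_par (hB : IsMin R B) (h : Opp R L B Q i Q' i') (P : Set ι) :
    refine L P Q ⊆ par R (cow R (refine L B Q) i) :=
  (refine_subset h.left).trans (subset_par_cow_refine hB h.left h.notMem_left)

/-- The refinements share the projections of all simple roots except that of `i`. The latter does
not reappear on the other side: it takes the value $1$ at the coweight `w`, while the simple roots
there take values $\le0$. -/
theorem Opp.coAdjacent (hB : IsMin R B) (h : Opp R L B Q i Q' i') (hP : IsParabolic R P)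
    (hBP : B ∩ L ⊆ P) : CoAdjacent R (refine L P Q) (refine L P Q') := by
  set w := cow R (refine L B Q) i with hw
  have hmin := refine_isMin h.left hB
  have hmin' := refine_isMin h.right hB
  have hPQ := refine_mem h.left hP
  have hPQ' := refine_mem h.right hP
  have hwM : w ∈ aReal R (L ∩ levi R P) :=
    aReal_anti R Set.inter_subset_left (cow_refine_mem hB h.left h.notMem_left)
  have e1 := hmin.simpleRoots_eq hPQ.1 (isParabolic_univ R) (refine_mono hBP) (Set.subset_univ _)
  have e2 := hmin'.simpleRoots_eq hPQ'.1 (isParabolic_univ R) (refine_mono hBP) (Set.subset_univ _)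
  rw [levi_univ, hPQ.2] at e1
  rw [levi_univ, hPQ'.2] at e2
  have hmem : i ∈ minimalSimple R (refine L B Q) ∩ (Set.univ \ (L ∩ levi R P)) :=
    ⟨h.mem_left, trivial, fun h' => h.notMem_left h'.1⟩
  refine ⟨R.root i - projUpper R.flip (L ∩ levi R P) (R.root i), ?_, ?_⟩
  · rw [e1]
    exact Set.mem_image_of_mem _ hmem
  rw [e1, e2]
  have hval : ∀ j, R.toLinearMap (R.root j - projUpper R.flip (L ∩ levi R P) (R.root j)) w =
      R.root' j w := fun j => toLinearMap_sub_projUpper _ hwM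
  ext x
  constructor
  · rintro ⟨hx, j', hj', rfl⟩
    refine ⟨hx, fun hx' => ?_⟩
    have h1 : R.root' j' w = R.root' i w := by
      have := congrArg (fun x => R.toLinearMap x w) (Set.mem_singleton_iff.1 hx')
      simp only at this
      rwa [hval, hval] at this
    obtain ⟨s, hs, e⟩ := h.cow_eq
    have h2 : 0 ≤ R.root' j' (cow R (refine L B Q') i') := hmin'.subset_par_cow i' hj'.1.1
    rw [e, map_neg, map_smul, smul_eq_mul, ← hw, h1, hw, hmin.root'_cow_self h.mem_left] at h2
    linarith
  · rintro ⟨⟨j, hj, rfl⟩, hx⟩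
    have hji : j ≠ i := by
      rintro rfl
      exact hx rfl
    exact ⟨Set.mem_image_of_mem _ hj,
      Set.mem_image_of_mem _ ⟨((h.mem_simple_iff hB j).1 ⟨hj.1, hji⟩).1, hj.2⟩⟩

/-- The gluing Levi consists of the roots orthogonal to `w`. A point killed by them acts on roots as
a multiple of `w` (`IsMin.root'_eq_mul`), which gives maximality and leaves only the parabolics of
`w` and `-w`. -/
theorem Opp.isGluingLevi (hB : IsMin R B) (h : Opp R L B Q i Q' i') :
    IsGluingLevi R (L ∩ levi R P) (refine L P Q) (refine L P Q')
      (levi R (par R (cow R (refine L B Q) i))) := by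
  have hsub' := h.symm.refine_subset_par hB P
  have hsub := h.refine_subset_par hB P
  obtain ⟨s, hs, e⟩ := h.cow_eq
  have hmin := refine_isMin h.left hB
  set w := cow R (refine L B Q) i with hw
  have hiw : R.root' i w = 1 := hmin.root'_cow_self h.mem_left
  have hlevi : ∀ j, j ∈ levi R (par R w) ↔ R.root' j w = 0 := fun j => by
    rw [levi_par]
    rfl
  have hmul : ∀ {H : Y}, levi R (par R w) ⊆ levi R (par R H) → ∀ j,
      R.root' j H = R.root' i H * R.root' j w := by
    intro H hH j
    refine hmin.root'_eq_mul (fun k hk hki => ?_) h.mem_left j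
    have := hH ((hlevi k).2 (hmin.root'_cow_ne hk hki))
    rw [levi_par] at this
    exact this
  have hneg : par R (cow R (refine L B Q') i') = par R (-w) := by
    refine par_smul_pos hs fun j => ?_
    rw [e, map_neg, map_smul, map_neg, smul_eq_mul, mul_neg]
  refine ⟨⟨_, isParabolic_par R w, rfl⟩, fun j hj => ?_, fun hu => ?_, ?_, ?_,
    par R w, par R (-w), hsub, hneg ▸ hsub', ?_⟩
  · exact (hlevi j).2 (cow_refine_mem hB h.left h.notMem_left j hj.1)
  · have : i ∈ levi R (par R w) := hu ▸ trivial
    rw [hlevi, hiw] at this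
    exact one_ne_zero this
  · rintro _ ⟨_, ⟨H, rfl⟩, rfl⟩ hL'
    change levi R (par R w) ⊆ levi R (par R H) at hL'
    change levi R (par R H) = _ ∨ levi R (par R H) = _
    have hm := hmul hL'
    by_cases h0 : R.root' i H = 0
    · right
      refine Set.eq_univ_of_forall fun j => ?_
      rw [levi_par]
      change R.root' j H = 0
      rw [hm, h0, zero_mul]
    · left
      ext j
      rw [hlevi, levi_par]
      change R.root' j H = 0 ↔ _
      rw [hm, mul_eq_zero]
      exact or_iff_right h0
  · ext j
    refine and_congr_left fun hj => ?_
    exact h.mem_refine_iff j ((hlevi j).1 hj) P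
  · ext S
    constructor
    · rintro ⟨⟨H, rfl⟩, hS⟩
      change levi R (par R H) = _ at hS
      change par R H ∈ _
      have hm := hmul hS.ge
      rcases lt_trichotomy (R.root' i H) 0 with h0 | h0 | h0
      · right
        refine par_smul_pos (neg_pos.2 h0) fun j => ?_
        rw [hm j, map_neg]
        ring
      · exfalso
        have : i ∈ levi R (par R H) := by
          rw [levi_par]
          exact h0
        rw [hS, hlevi, hiw] at this
        exact one_ne_zero this
      · left
        exact par_smul_pos h0 hm
    · rintro (rfl | rfl)
      · exact ⟨isParabolic_par R w, rfl⟩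
      · refine ⟨isParabolic_par R _, ?_⟩
        ext j
        rw [levi_par, hlevi]
        change R.root' j (-w) = 0 ↔ _
        rw [map_neg, neg_eq_zero]

/-- For the maximal parabolic $Q$ of $\varpi_i^\vee$ the space $a_Q^G$ is a line, on which $\xi$
projects to $\varpi_i(\xi)$ times the generator of $\mathbb Z(\Delta_Q^\vee)$. The genericity
hypothesis for this $Q$ excludes integers. -/
theorem IsMin.wt_ne_int (hB : IsMin R B) (hi : i ∈ minimalSimple R B)
    (hL : ∀ j ∈ L, R.root' j (cow R B i) = 0) {ξ : Y}
    (hξ : ∀ Q ∈ parabolicsContaining R L, Q ≠ Set.univ →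
      projRel R Q Set.univ ξ ∉ AddSubgroup.closure (simpleCoroots R Q Set.univ)) (z : ℤ) :
    wt R B i ξ ≠ z := by
  intro hz
  have hpar := isParabolic_par R (cow R B i)
  have hBQ := hB.subset_par_cow i
  have hlevi : ∀ j, j ∈ levi R (par R (cow R B i)) ↔ R.root' j (cow R B i) = 0 := fun j => by
    rw [levi_par]
    rfl
  have hi' : i ∉ levi R (par R (cow R B i)) := by
    rw [hlevi, hB.root'_cow_self hi]
    exact one_ne_zero
  refine hξ _ ⟨hpar, fun j hj => ge_of_eq (hL j hj)⟩ (fun hu => ?_) ?_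
  · rw [hu, levi_univ] at hi'
    exact hi' trivial
  · have hs : simpleRel R B (par R (cow R B i)) Set.univ = {i} := by
      ext j
      rw [mem_simpleRel_univ, Finset.mem_singleton, hlevi]
      constructor
      · rintro ⟨hj, hj0⟩
        by_contra hji
        exact hj0 (hB.root'_cow_ne hj hji)
      · rintro rfl
        exact ⟨hi, fun h0 => by
          rw [hB.root'_cow_self hi] at h0
          exact one_ne_zero h0⟩
    rw [hB.projRel_univ, hs, Finset.sum_singleton, hz, Int.cast_smul_eq_zsmul ℝ,
      hB.simpleCoroots_univ_eq hpar hBQ]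
    have hm : cor R (par R (cow R B i)) i ∈ cor R (par R (cow R B i)) ''
        (minimalSimple R B \ levi R (par R (cow R B i))) := ⟨i, ⟨hi, hi'⟩, rfl⟩
    exact AddSubgroup.zsmul_mem _ (AddSubgroup.subset_closure hm) z

theorem exists_simple_of_ne_univ (hB : IsMin R B) (hQ : Q ∈ parabolicsOfLevi R L) (h : B ⊆ Q)
    (hL : L ≠ Set.univ) : ∃ i ∈ minimalSimple R B, i ∉ L := by
  by_contra hcon
  push Not at hcon
  have := hB.parabolic_le (isParabolic_univ R) hQ.1 (Set.subset_univ _) h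
    (fun i hi => hQ.2 ▸ hcon i hi.1)
  have e : Q = Set.univ := Set.univ_subset_iff.1 this
  apply hL
  rw [← hQ.2, e, levi_univ]

end Gluing

/-! ### Vanishing of weighted sums of $\vartheta_Q$ over $\mathcal P(L)$. -/

section Theta

variable {ι X Y : Type*} [AddCommGroup X] [Module ℝ X] [NormedAddCommGroup Y] [NormedSpace ℝ Y]
  [FiniteDimensional ℝ Y] [Finite ι] {R : RootPairing ι ℝ X Y} {M L B : Set ι} {q : ℕ}
  [R.IsCrystallographic]

/-- The facet involution is adjacency: `exists_opp` provides it, `Opp.unique` makes it involutive,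
and `Opp.wt_eq` with `Opp.wt_eq_of_eq_zero` matches the facets. -/
theorem coneCount_levi (hB : IsMin R B) [Fintype (parabolicsOfLevi R L)] {c : Set ι → ℂ}
    (hc : ∀ Q i Q' i', Opp R L B Q i Q' i' → c Q = c Q') {x x' : Y}
    (hx : ∀ Q ∈ parabolicsOfLevi R L, ∀ i ∈ simpleRel R (refine L B Q) Q Set.univ,
      wt R (refine L B Q) i x ≠ 0)
    (hx' : ∀ Q ∈ parabolicsOfLevi R L, ∀ i ∈ simpleRel R (refine L B Q) Q Set.univ,
      wt R (refine L B Q) i x' ≠ 0) :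
    coneCount (fun Q : parabolicsOfLevi R L => simpleRel R (refine L B Q) Q Set.univ)
      (fun Q => wt R (refine L B Q)) (fun Q => c Q) x =
    coneCount (fun Q : parabolicsOfLevi R L => simpleRel R (refine L B Q) Q Set.univ)
      (fun Q => wt R (refine L B Q)) (fun Q => c Q) x' := by
  classical
  let rel : parabolicsOfLevi R L × ι → parabolicsOfLevi R L × ι → Prop :=
    fun p p' => Opp R L B p.1 p.2 p'.1 p'.2
  let σ : parabolicsOfLevi R L × ι → parabolicsOfLevi R L × ι :=
    fun p => if h : ∃ p', rel p p' then h.choose else p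
  have hex : ∀ p : parabolicsOfLevi R L × ι,
      p.2 ∈ simpleRel R (refine L B p.1) p.1 Set.univ → rel p (σ p) := by
    intro p hp
    rw [mem_simpleRel_univ, p.1.2.2] at hp
    obtain ⟨Q', i', h⟩ := exists_opp hB p.1.2 hp.1 hp.2
    have h' : ∃ p', rel p p' := ⟨(⟨Q', h.right⟩, i'), h⟩
    simp only [σ, dif_pos h']
    exact h'.choose_spec
  have hmem : ∀ {p p'}, rel p p' → p'.2 ∈ simpleRel R (refine L B p'.1) p'.1 Set.univ := by
    intro p p' h
    rw [mem_simpleRel_univ, p'.1.2.2]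
    exact ⟨h.mem_right, h.notMem_right⟩
  refine coneCount_const σ (fun p hp => ?_) (fun Q => ?_) (fun Q => hx Q Q.2) (fun Q => hx' Q Q.2)
  · have h := hex p hp
    have h2 := hex (σ p) (hmem h)
    refine ⟨hmem h, ?_, (hc _ _ _ _ h).symm, h.wt_eq hB, fun η hη => ?_⟩
    · have := Opp.unique hB (σ p).1.2 h2 h.symm
      exact Prod.ext (Subtype.ext this.1) this.2
    · have key : ∀ {p p'}, rel p p' → wt R (refine L B p.1) p.2 η = 0 →
          (∀ i ∈ simpleRel R (refine L B p.1) p.1 Set.univ, i ≠ p.2 →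
            0 < wt R (refine L B p.1) i η) →
          ∀ i ∈ simpleRel R (refine L B p'.1) p'.1 Set.univ, i ≠ p'.2 →
            0 < wt R (refine L B p'.1) i η := by
        intro p p' h hη h0 i hi hne
        rw [mem_simpleRel_univ, p'.1.2.2] at hi
        have h1 := (h.mem_simple_iff hB i).2 ⟨hi.1, hne⟩
        rw [h.wt_eq_of_eq_zero hB hη h1.1 h1.2]
        refine h0 i ?_ h1.2
        rw [mem_simpleRel_univ, p.1.2.2]
        exact ⟨h1.1, hi.2⟩
      refine ⟨key h hη, key h.symm ?_⟩
      obtain ⟨t, -, e⟩ := h.wt_eq hB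
      rw [e, LinearMap.smul_apply, hη, smul_zero]
  · have hmin := refine_isMin Q.2 hB
    rw [linearIndepOn_iff']
    intro s g hs h0 i hi
    have hi' := hs hi
    rw [Finset.mem_coe, mem_simpleRel_univ] at hi'
    have := congrArg (fun f => f (R.coroot i)) h0
    simp only [LinearMap.sum_apply, LinearMap.smul_apply, smul_eq_mul, LinearMap.zero_apply] at this
    rw [Finset.sum_eq_single i] at this
    · rwa [hmin.wt_coroot_self hi'.1, mul_one] at this
    · intro j hj hji
      have hj' := hs hj
      rw [Finset.mem_coe, mem_simpleRel_univ] at hj'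
      rw [hmin.wt_coroot_ne hj'.1 hi'.1 hji.symm, mul_zero]
    · intro h
      exact absurd hi h

/-- All indicators live on one lattice depending only on `L`, and general position keeps its points
off the walls. The weighted count is then constant on the lattice and zero elsewhere, hence
invariant under a lattice translation with nontrivial character; such a translation exists because
`L` is proper. -/
theorem sum_vartheta_eq_zero (hq : 1 < q) (hB : IsMin R B) (hL : IsLevi R L)
    (hLu : L ≠ Set.univ) [Fintype (parabolicsOfLevi R L)] {b : ℕ} (hb : 1 ≤ b) {ξ : Y}
    (hξ : ∀ Q ∈ parabolicsContaining R L, Q ≠ Set.univ →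
      projRel R Q Set.univ ((b : ℝ) • ξ) ∉ AddSubgroup.closure (simpleCoroots R Q Set.univ))
    {c : Set ι → ℂ} (hc : ∀ Q i Q' i', Opp R L B Q i Q' i' → c Q = c Q') {l : aC R M}
    (hreg : ∀ Q ∈ parabolicsOfLevi R L, ∀ v ∈ simpleCoroots R Q Set.univ,
      qpow R q ((b : ℂ)⁻¹ • l) v ≠ 1) :
    ∑ Q : parabolicsOfLevi R L,
      c Q * vartheta R q Q Set.univ ((b : ℝ) • ξ) ((b : ℂ)⁻¹ • l) = 0 := by
  classical
  obtain ⟨Q₀, hQ₀, hQL⟩ := hL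
  have hQ₀L : Q₀ ∈ parabolicsOfLevi R L := ⟨hQ₀, hQL⟩
  have hb' : (b : ℝ) ≠ 0 := by positivity
  have hsum := RegSum.sum (fun x y => qpow_add hq l x y) (Finset.univ : Finset (parabolicsOfLevi R L))
    (fun Q _ => ((refine_isMin Q.2 hB).regSum_vartheta hq Q.2.1 (refine_subset Q.2) hb ξ l
      (hreg Q Q.2)).const_mul (c Q))
  have hgen : ∀ H ∈ scaledLattice b (simpleCoroots R Q₀ Set.univ), ∀ Q ∈ parabolicsOfLevi R L,
      ∀ i ∈ simpleRel R (refine L B Q) Q Set.univ, wt R (refine L B Q) i (H - ξ) ≠ 0 := by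
    intro H hH Q hQ i hi h0
    rw [mem_simpleRel_univ] at hi
    rw [scaledLattice_eq hQ₀L hQ] at hH
    have hmin := refine_isMin hQ hB
    obtain ⟨z, hz⟩ := hmin.wt_scaled hQ.1 (refine_subset hQ) hb hi.1 hi.2 hH
    refine hmin.wt_ne_int hi.1 (fun j hj => ?_) hξ z ?_
    · exact cow_refine_mem hB hQ (hQ.2 ▸ hi.2) j hj
    · rw [map_smul, smul_eq_mul, ← hz]
      rw [map_sub, sub_eq_zero] at h0
      rw [h0]
  have hconst : ∀ H ∈ scaledLattice b (simpleCoroots R Q₀ Set.univ),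
      ∀ H' ∈ scaledLattice b (simpleCoroots R Q₀ Set.univ),
      (∑ Q : parabolicsOfLevi R L, c Q *
        (if H ∈ scaledLattice b (simpleCoroots R Q Set.univ) then
          (if ∀ i ∈ simpleRel R (refine L B Q) Q Set.univ,
            0 < wt R (refine L B Q) i (H - ξ) then (1 : ℂ) else 0) else 0)) =
      ∑ Q : parabolicsOfLevi R L, c Q *
        (if H' ∈ scaledLattice b (simpleCoroots R Q Set.univ) then
          (if ∀ i ∈ simpleRel R (refine L B Q) Q Set.univ,
            0 < wt R (refine L B Q) i (H' - ξ) then (1 : ℂ) else 0) else 0) := by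
    have key : ∀ H ∈ scaledLattice b (simpleCoroots R Q₀ Set.univ),
        (∑ Q : parabolicsOfLevi R L, c Q *
        (if H ∈ scaledLattice b (simpleCoroots R Q Set.univ) then
          (if ∀ i ∈ simpleRel R (refine L B Q) Q Set.univ,
            0 < wt R (refine L B Q) i (H - ξ) then (1 : ℂ) else 0) else 0)) =
        coneCount (fun Q : parabolicsOfLevi R L => simpleRel R (refine L B Q) Q Set.univ)
          (fun Q => wt R (refine L B Q)) (fun Q => c Q) (H - ξ) := by
      intro H hH
      refine Finset.sum_congr rfl fun Q _ => ?_
      rw [scaledLattice_eq hQ₀L Q.2] at hH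
      rw [if_pos hH, mul_ite, mul_one, mul_zero]
    intro H hH H' hH'
    rw [key H hH, key H' hH']
    exact coneCount_levi hB hc (hgen H hH) (hgen H' hH')
  obtain ⟨i, hi, hiL⟩ := exists_simple_of_ne_univ (refine_isMin hQ₀L hB) hQ₀L
    (refine_subset hQ₀L) hLu
  have hv : cor R Q₀ i ∈ simpleCoroots R Q₀ Set.univ := by
    rw [(refine_isMin hQ₀L hB).simpleCoroots_univ_eq hQ₀ (refine_subset hQ₀L)]
    exact Set.mem_image_of_mem _ ⟨hi, by rwa [hQL]⟩
  have hvmem : (b : ℝ)⁻¹ • cor R Q₀ i ∈ scaledLattice b (simpleCoroots R Q₀ Set.univ) := by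
    have hm : (b : ℝ)⁻¹ • cor R Q₀ i ∈ (fun v => (b : ℝ)⁻¹ • v) '' simpleCoroots R Q₀ Set.univ :=
      ⟨_, hv, rfl⟩
    exact AddSubgroup.subset_closure hm
  refine RegSum.unique (fun x y => qpow_add hq l x y) hsum
    (RegSum.zero_of_invariant (v := (b : ℝ)⁻¹ • cor R Q₀ i) ?_ fun H => ?_)
  · rw [← qpow_inv_smul]
    exact hreg Q₀ hQ₀L _ hv
  · by_cases hH : H ∈ scaledLattice b (simpleCoroots R Q₀ Set.univ)
    · exact hconst _ (sub_mem hH hvmem) _ hH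
    · have hH' : H - (b : ℝ)⁻¹ • cor R Q₀ i ∉ scaledLattice b (simpleCoroots R Q₀ Set.univ) :=
        fun h => hH (by simpa using add_mem h hvmem)
      have hz : ∀ H, H ∉ scaledLattice b (simpleCoroots R Q₀ Set.univ) →
          (∑ Q : parabolicsOfLevi R L, c Q *
          (if H ∈ scaledLattice b (simpleCoroots R Q Set.univ) then
            (if ∀ i ∈ simpleRel R (refine L B Q) Q Set.univ,
            0 < wt R (refine L B Q) i (H - ξ) then (1 : ℂ) else 0) else 0)) = 0 := by
        intro H hH
        refine Finset.sum_eq_zero fun Q _ => ?_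
        rw [scaledLattice_eq hQ₀L Q.2] at hH
        rw [if_neg hH, mul_zero]
      exact (hz _ hH').trans (hz _ hH).symm

end Theta

end Cofamily

end

noncomputable section

namespace Cofamily

set_option linter.unusedSectionVars false

open Complex

/-! ### Cancellation of the terms with $R\ne G$. -/

section Fibers

variable {ι X Y : Type*} [AddCommGroup X] [Module ℝ X] [AddCommGroup Y] [Module ℝ Y]
  {R : RootPairing ι ℝ X Y} [Finite ι] [R.IsCrystallographic] {B B' P P' Q Q' L : Set ι}

theorem minimalSimple_inter_levi_subset (hQ : Q ∈ parabolicsOfLevi R L)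
    (hQ' : Q' ∈ parabolicsOfLevi R L) (h : B ⊆ Q) (h' : B' ⊆ Q') (hBB : B ∩ L = B' ∩ L) :
    minimalSimple R B ∩ L ⊆ minimalSimple R B' ∩ L := by
  obtain ⟨⟨K, rfl⟩, hK⟩ := hQ
  obtain ⟨⟨K', rfl⟩, hK'⟩ := hQ'
  change levi R (par R K) = L at hK
  change levi R (par R K') = L at hK'
  have e : ∀ j, R.root' j K = 0 ↔ j ∈ L := fun j => by rw [← hK, levi_par]; rfl
  have e' : ∀ j, R.root' j K' = 0 ↔ j ∈ L := fun j => by rw [← hK', levi_par]; rfl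
  have hB : ∀ j ∈ L, j ∈ B ↔ j ∈ B' := fun j hj => by
    have := Set.ext_iff.1 hBB j
    simpa [hj] using this
  rintro j ⟨hj, hjL⟩
  refine ⟨?_, hjL⟩
  rw [minimalSimple_inter h j ((e j).2 hjL)] at hj
  rw [minimalSimple_inter h' j ((e' j).2 hjL)]
  refine ⟨(hB j hjL).1 hj.1, fun k hk l hl hk0 hl0 => ?_⟩
  rw [e'] at hk0 hl0
  exact hj.2 k ((hB k hk0).2 hk) l ((hB l hl0).2 hl) ((e k).2 hk0) ((e l).2 hl0)

theorem minimalSimple_inter_levi (hQ : Q ∈ parabolicsOfLevi R L)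
    (hQ' : Q' ∈ parabolicsOfLevi R L) (h : B ⊆ Q) (h' : B' ⊆ Q') (hBB : B ∩ L = B' ∩ L) :
    minimalSimple R B ∩ L = minimalSimple R B' ∩ L :=
  Set.Subset.antisymm (minimalSimple_inter_levi_subset hQ hQ' h h' hBB)
    (minimalSimple_inter_levi_subset hQ' hQ h' h hBB.symm)

/-- The coweights of `P ⊆ Q` depend only on the Levi factor `L` of `Q` and on `P ∩ L`. -/
theorem coweights_congr (hB : IsMin R B) (hB' : IsMin R B') (hP : IsParabolic R P)
    (hP' : IsParabolic R P') (hPP : levi R P = levi R P') (hQ : Q ∈ parabolicsOfLevi R L)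
    (hQ' : Q' ∈ parabolicsOfLevi R L) (hBP : B ⊆ P) (hBP' : B' ⊆ P') (hPQ : P ⊆ Q)
    (hPQ' : P' ⊆ Q') (hBB : B ∩ L = B' ∩ L) : coweights R P Q = coweights R P' Q' := by
  have hS := minimalSimple_inter_levi hQ hQ' (hBP.trans hPQ) (hBP'.trans hPQ') hBB
  have hS' : minimalSimple R B ∩ (L \ levi R P) = minimalSimple R B' ∩ (L \ levi R P') := by
    rw [hPP, ← Set.inter_sdiff_assoc, hS, Set.inter_sdiff_assoc]
  rw [hB.coweights_eq hP hQ.1 hBP hPQ, hB'.coweights_eq hP' hQ'.1 hBP' hPQ', hQ.2, hQ'.2, hS']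
  refine Set.image_congr fun i hi => ?_
  have hiB : i ∈ minimalSimple R B ∩ L := hS ▸ ⟨hi.1, hi.2.1⟩
  refine hB.ext_of_levi hQ.1 (hBP.trans hPQ) (cowRel_mem i) ?_ fun j hj => ?_
  · have := cowRel_mem (R := R) (B := B') (Q := Q') i
    rwa [hQ'.2, ← hQ.2] at this
  · rw [hQ.2] at hj
    have hj' : j ∈ minimalSimple R B' ∩ L := hS ▸ hj
    rw [root'_cowRel (hQ.2.symm ▸ hj.2), root'_cowRel (hQ'.2.symm ▸ hj.2), (hB.cow_spec i).2 j hj.1,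
      (hB'.cow_spec i).2 j hj'.1]

end Fibers

section Sum

variable {ι X Y : Type*} [AddCommGroup X] [Module ℝ X] [NormedAddCommGroup Y] [NormedSpace ℝ Y]
  [FiniteDimensional ℝ Y] [Finite ι] {R : RootPairing ι ℝ X Y} {M : Set ι} {q : ℕ}
  [R.IsCrystallographic]

variable (R q) in
open Classical in
/-- The contribution of `P ⊆ Q` to `∑_P c_P(φ_P, λ)`. -/
def contribution (b : ℕ) (ξ : Y) (φ : parabolicsOfLevi R M → aC R M → ℂ) (μ : aC R M)
    (P Q : Set ι) : ℂ :=
  (-1) ^ Module.finrank ℝ (aRel R Q Set.univ) * varthetaHat R q P Q μ *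
    (if h : P ∈ parabolicsOfLevi R M then φ ⟨P, h⟩ (projC R Q μ) else 0) *
    vartheta R q Q Set.univ ((b : ℝ) • ξ) ((b : ℂ)⁻¹ • μ)

variable {b : ℕ} {ξ : Y} {φ : parabolicsOfLevi R M → aC R M → ℂ} {Ω : Set (aC R M)} {μ : aC R M}

theorem projC_congr {Q Q' : Set ι} (h : levi R Q = levi R Q') (μ : aC R M) :
    projC R Q μ = projC R Q' μ := by
  rw [projC, projC, h]

/-- The sign, $\hat\vartheta$ and the argument $\lambda^Q$ depend only on $L=M_Q$ and $P\cap L$.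
What is left is the sum of `sum_vartheta_eq_zero` weighted by values of $\varphi$ at $\lambda^Q$.
Adjacent weights agree by the gluing condition: the gluing Levi contains $L$, and $\lambda^Q$
vanishes on $a_L$. -/
theorem sum_fiber_eq_zero (hq : 1 < q) (hb : 1 ≤ b)
    (hξ : ∀ Q ∈ parabolicsContaining R M, Q ≠ Set.univ →
      projRel R Q Set.univ ((b : ℝ) • ξ) ∉ AddSubgroup.closure (simpleCoroots R Q Set.univ))
    (hφ : ∀ P₁ P₂ : parabolicsOfLevi R M, CoAdjacent R P₁.1 P₂.1 →
      ∀ L, IsGluingLevi R M P₁.1 P₂.1 L →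
        ∀ l ∈ Ω, (∀ H : aReal R M, H.1 ∈ aReal R L → l H = 0) → φ P₁ l = φ P₂ l)
    (hΩ : ∀ Q ∈ parabolicsContaining R M, projC R Q μ ∈ Ω)
    (hreg : ∀ Q ∈ parabolicsContaining R M, ∀ v ∈ simpleCoroots R Q Set.univ,
      qpow R q ((b : ℂ)⁻¹ • μ) v ≠ 1)
    {P Q : Set ι} (hP : P ∈ parabolicsOfLevi R M) (hQ : IsParabolic R Q) (hPQ : P ⊆ Q)
    (hQu : Q ≠ Set.univ) [Fintype (parabolicsOfLevi R (levi R Q))] :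
    ∑ Q' : parabolicsOfLevi R (levi R Q),
      contribution R q b ξ φ μ (refine (levi R Q) P Q') Q' = 0 := by
  classical
  have hQL : Q ∈ parabolicsOfLevi R (levi R Q) := ⟨hQ, rfl⟩
  have hML : M ⊆ levi R Q := hP.2 ▸ levi_mono R hPQ
  have hLu : levi R Q ≠ Set.univ := fun h =>
    hQu (Set.univ_subset_iff.1 (h ▸ levi_subset R Q))
  have hcont : ∀ Q' ∈ parabolicsOfLevi R (levi R Q), Q' ∈ parabolicsContaining R M :=
    fun Q' hQ' => ⟨hQ'.1, hML.trans (subset_of_mem_parabolicsOfLevi hQ')⟩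
  have hinter : levi R Q ∩ levi R P = M := by
    rw [hP.2]
    exact Set.inter_eq_right.2 hML
  have hrefine : ∀ Q' ∈ parabolicsOfLevi R (levi R Q),
      refine (levi R Q) P Q' ∈ parabolicsOfLevi R M := fun Q' hQ' => by
    have := refine_mem hQ' hP.1
    rwa [hinter] at this
  obtain ⟨B, hB, hBP⟩ := exists_isMin_subset R hP.1
  let c : Set ι → ℂ := fun Q' =>
    if h : refine (levi R Q) P Q' ∈ parabolicsOfLevi R M then φ ⟨_, h⟩ (projC R Q μ) else 0
  have hc : ∀ Q₁ i Q₂ i', Opp R (levi R Q) B Q₁ i Q₂ i' → c Q₁ = c Q₂ := by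
    intro Q₁ i Q₂ i' h
    simp only [c]
    rw [dif_pos (hrefine Q₁ h.left), dif_pos (hrefine Q₂ h.right)]
    have hglue := h.isGluingLevi hB (P := P)
    rw [hinter] at hglue
    refine hφ ⟨_, hrefine Q₁ h.left⟩ ⟨_, hrefine Q₂ h.right⟩
      (h.coAdjacent hB hP.1 (Set.inter_subset_left.trans hBP)) _ hglue _ (hΩ Q (hcont Q hQL)) ?_
    intro H hH
    rw [← extend_of_mem R _ H.2, extend_projC R μ H.2, projUpper_of_mem_aReal, map_zero]
    refine aReal_anti R (fun j hj => ?_) hH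
    rw [levi_par]
    exact cow_refine_mem hB h.left h.notMem_left j hj
  have key := sum_vartheta_eq_zero hq hB ⟨Q, hQ, rfl⟩ hLu hb
    (fun Q' hQ' => hξ Q' ⟨hQ'.1, hML.trans hQ'.2⟩) hc (l := μ)
    (fun Q' hQ' => hreg Q' (hcont Q' hQ'))
  rw [← mul_zero ((-1) ^ Module.finrank ℝ (aRel R Q Set.univ) * varthetaHat R q P Q μ), ← key,
    Finset.mul_sum]
  refine Finset.sum_congr rfl fun Q' _ => ?_
  have h1 : aRel R Q' Set.univ = aRel R Q Set.univ := by
    rw [aRel, aRel, Q'.2.2]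
  have h2 : varthetaHat R q (refine (levi R Q) P Q') Q' μ = varthetaHat R q P Q μ := by
    rw [varthetaHat, varthetaHat, coweights_congr (refine_isMin Q'.2 hB) hB (hrefine Q' Q'.2).1 hP.1
      ((hrefine Q' Q'.2).2.trans hP.2.symm) Q'.2 hQL
      (refine_mono (Set.inter_subset_left.trans hBP)) hBP (refine_subset Q'.2) hPQ
      (refine_inter _ _ _)]
  rw [contribution, h1, h2, projC_congr Q'.2.2]
  simp only [c]
  ring

theorem contribution_univ (P : Set ι) : contribution R q b ξ φ μ P Set.univ =
    varthetaHat R q P Set.univ μ *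
      (open Classical in
        if h : P ∈ parabolicsOfLevi R M then φ ⟨P, h⟩ (projC R Set.univ μ) else 0) := by
  have h0 : simpleCoroots R Set.univ Set.univ = (∅ : Set Y) := by
    rw [simpleCoroots, Set.image_eq_empty]
    exact Set.eq_empty_of_forall_notMem fun i hi => hi.2.1 hi.1
  have h1 : aRel R Set.univ Set.univ = ⊥ := by
    rw [aRel, inf_comm]
    exact (isCompl_corootSpan R _).inf_eq_bot
  rw [contribution, h1, finrank_bot, pow_zero, one_mul, vartheta, bracket, h0]
  simp [qpow_zero]

theorem sum_contribution (hq : 1 < q) (hb : 1 ≤ b)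
    (hξ : ∀ Q ∈ parabolicsContaining R M, Q ≠ Set.univ →
      projRel R Q Set.univ ((b : ℝ) • ξ) ∉ AddSubgroup.closure (simpleCoroots R Q Set.univ))
    (hφ : ∀ P₁ P₂ : parabolicsOfLevi R M, CoAdjacent R P₁.1 P₂.1 →
      ∀ L, IsGluingLevi R M P₁.1 P₂.1 L →
        ∀ l ∈ Ω, (∀ H : aReal R M, H.1 ∈ aReal R L → l H = 0) → φ P₁ l = φ P₂ l)
    (hΩ : ∀ Q ∈ parabolicsContaining R M, projC R Q μ ∈ Ω)
    (hreg : ∀ Q ∈ parabolicsContaining R M, ∀ v ∈ simpleCoroots R Q Set.univ,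
      qpow R q ((b : ℂ)⁻¹ • μ) v ≠ 1) :
    (∑ᶠ P : parabolicsOfLevi R M, ∑ᶠ Q ∈ parabolicsContaining R P.1,
      (-1) ^ Module.finrank ℝ (aRel R Q Set.univ) * varthetaHat R q P.1 Q μ *
        φ P (projC R Q μ) * vartheta R q Q Set.univ ((b : ℝ) • ξ) ((b : ℂ)⁻¹ • μ)) =
    ∑ᶠ P : parabolicsOfLevi R M, varthetaHat R q P.1 Set.univ μ * φ P (projC R Set.univ μ) := by
  classical
  have := Fintype.ofFinite (Set ι)
  have hT : ∀ (P : parabolicsOfLevi R M) Q,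
      (-1) ^ Module.finrank ℝ (aRel R Q Set.univ) * varthetaHat R q P.1 Q μ *
        φ P (projC R Q μ) * vartheta R q Q Set.univ ((b : ℝ) • ξ) ((b : ℂ)⁻¹ • μ) =
      contribution R q b ξ φ μ P Q := by
    intro P Q
    rw [contribution, dif_pos P.2]
  have hT' : ∀ P : parabolicsOfLevi R M, varthetaHat R q P.1 Set.univ μ *
      φ P (projC R Set.univ μ) = contribution R q b ξ φ μ P Set.univ := by
    intro P
    rw [contribution_univ, dif_pos P.2]
  simp only [hT, hT']
  rw [finsum_eq_sum_of_fintype, finsum_eq_sum_of_fintype]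
  let F : Set ι → Finset (Set ι) := fun P => (parabolicsContaining R P).toFinset
  have hF : ∀ P : parabolicsOfLevi R M, (∑ᶠ Q ∈ parabolicsContaining R P.1,
      contribution R q b ξ φ μ P Q) = contribution R q b ξ φ μ P Set.univ +
        ∑ Q ∈ (F P).erase Set.univ, contribution R q b ξ φ μ P Q := by
    intro P
    rw [finsum_mem_eq_toFinset_sum]
    refine (Finset.add_sum_erase (F P) _ ?_).symm
    exact Set.mem_toFinset.2 ⟨isParabolic_univ R, Set.subset_univ _⟩
  simp only [hF]
  rw [Finset.sum_add_distrib, add_eq_left, Finset.sum_sigma']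
  -- Pairs $(P,Q)$ are grouped by $L=M_Q$ and $P\cap L$. Each group is in bijection with $\mathcal
  -- P(L)$, since $P$ is recovered as a refinement of $Q$.
  let g : (Σ _ : parabolicsOfLevi R M, Set ι) → Set ι × Set ι :=
    fun p => (levi R p.2, p.1.1 ∩ levi R p.2)
  set S : Finset (Σ _ : parabolicsOfLevi R M, Set ι) :=
    Finset.univ.sigma fun P => (F P).erase Set.univ with hS
  have hmem : ∀ p, p ∈ S ↔ p.2 ≠ Set.univ ∧ IsParabolic R p.2 ∧ p.1.1 ⊆ p.2 := by
    intro p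
    simp only [hS, Finset.mem_sigma, Finset.mem_univ, true_and, Finset.mem_erase, F,
      Set.mem_toFinset]
    rfl
  rw [← Finset.sum_fiberwise_of_maps_to (g := g) (t := S.image g)
    fun p hp => Finset.mem_image_of_mem g hp]
  refine Finset.sum_eq_zero fun y hy => ?_
  obtain ⟨⟨P₁, Q₁⟩, hp, rfl⟩ := Finset.mem_image.1 hy
  rw [hmem] at hp
  obtain ⟨hQu, hQ₁, hPQ⟩ := hp
  simp only at hQu hQ₁ hPQ
  have hML : M ⊆ levi R Q₁ := P₁.2.2 ▸ levi_mono R hPQ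
  have hinter : levi R Q₁ ∩ levi R P₁.1 = M := by
    rw [P₁.2.2]
    exact Set.inter_eq_right.2 hML
  have hrefine : ∀ Q' ∈ parabolicsOfLevi R (levi R Q₁),
      refine (levi R Q₁) P₁ Q' ∈ parabolicsOfLevi R M := fun Q' hQ' => by
    have := refine_mem hQ' P₁.2.1
    rwa [hinter] at this
  rw [← sum_fiber_eq_zero hq hb hξ hφ hΩ hreg P₁.2 hQ₁ hPQ hQu]
  have hfib : ∀ p, p ∈ S.filter (fun p => g p = g ⟨P₁, Q₁⟩) ↔
      (p.2 ≠ Set.univ ∧ IsParabolic R p.2 ∧ p.1.1 ⊆ p.2) ∧ levi R p.2 = levi R Q₁ ∧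
        p.1.1 ∩ levi R Q₁ = P₁.1 ∩ levi R Q₁ := by
    intro p
    rw [Finset.mem_filter, hmem]
    refine and_congr_right fun _ => ?_
    simp only [g, Prod.mk.injEq]
    refine and_congr_right fun h => ?_
    rw [h]
  have hpair : ∀ p, p ∈ S.filter (fun p => g p = g ⟨P₁, Q₁⟩) →
      refine (levi R Q₁) P₁ p.2 = p.1.1 := by
    intro p hp
    obtain ⟨⟨h1, h2, h3⟩, h4, h5⟩ := (hfib p).1 hp
    rw [← refine_self ⟨h2, h4⟩ p.1.2.1 h3, refine, refine, h5]
  refine Finset.sum_bij' (fun p hp => ⟨p.2, ((hfib p).1 hp).1.2.1, ((hfib p).1 hp).2.1⟩)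
    (fun Q' _ => ⟨⟨refine (levi R Q₁) P₁ Q', hrefine Q' Q'.2⟩, Q'⟩) ?_ ?_ ?_ ?_ ?_
  · intro p hp
    exact Finset.mem_univ _
  · intro Q' _
    rw [hfib]
    refine ⟨⟨fun hu => hQu ?_, Q'.2.1, refine_subset Q'.2⟩, Q'.2.2, refine_inter _ _ _⟩
    have h := Q'.2.2
    simp only at hu
    rw [hu, levi_univ] at h
    exact Set.univ_subset_iff.1 (h ▸ levi_subset R Q₁)
  · intro p hp
    exact Sigma.ext (Subtype.ext (hpair p hp)) HEq.rfl
  · intro Q' _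
    rfl
  · intro p hp
    exact congrArg (fun P => contribution R q b ξ φ μ P p.2) (hpair p hp).symm

end Sum

end Cofamily

end

noncomputable section

namespace Cofamily

set_option linter.unusedSectionVars false

open Complex

/-! ### Fourier coefficients of the terms of $c_P$. -/

section Coefficients

variable {ι X Y : Type*} [AddCommGroup X] [Module ℝ X] [NormedAddCommGroup Y] [NormedSpace ℝ Y]
  [FiniteDimensional ℝ Y] [Finite ι] {R : RootPairing ι ℝ X Y} {M : Set ι} {q : ℕ}
  [R.IsCrystallographic] {B P Q : Set ι} {b b' : ℕ} {ξ : Y}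

variable (R) in
open Classical in
/-- The Fourier coefficients of `c_P(φ, λ)`. -/
def cCoeff (B P : Set ι) (ξ : Y) (S : ι → ℤ → ℂ) (a : ι → ℂ) (H : Y) : ℂ :=
  if H ∈ AddSubgroup.closure (coweights R P Set.univ) then
    ∏ i ∈ simpleRel R B P Set.univ,
      (S i ⌊R.root' i H⌋ - if wt R B i ξ < wt R B i H then a i else 0) else 0

variable (R) in
open Classical in
/-- The coefficients of the contribution of `Q ⊇ P` to `c_P(φ, λ)`. -/
def mixCoeff (b : ℕ) (B P Q : Set ι) (ξ : Y) (S : ι → ℤ → ℂ) (a : ι → ℂ) (H : Y) : ℂ :=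
  if H ∈ AddSubgroup.closure (coweights R P Q) ⊔ scaledLattice b (simpleCoroots R Q Set.univ) then
    ∏ i ∈ simpleRel R B P Set.univ, (if i ∈ levi R Q then S i ⌊R.root' i H⌋ else
      if wt R B i ξ < wt R B i H then a i else 0) else 0

open Classical in
theorem filter_simpleRel_mem :
    (simpleRel R B P Set.univ).filter (· ∈ levi R Q) = simpleRel R B P Q := by
  ext i
  rw [Finset.mem_filter, mem_simpleRel_univ, mem_simpleRel]
  tauto

open Classical in
theorem filter_simpleRel_notMem (hPQ : P ⊆ Q) :
    (simpleRel R B P Set.univ).filter (fun i => ¬ i ∈ levi R Q) = simpleRel R B Q Set.univ := by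
  ext i
  rw [Finset.mem_filter, mem_simpleRel_univ, mem_simpleRel_univ]
  have : i ∈ levi R P → i ∈ levi R Q := fun h => levi_mono R hPQ h
  tauto

theorem IsMin.root'_cowRel_eq (hB : IsMin R B) {i : ι} (hi : i ∈ minimalSimple R B)
    (hiQ : i ∈ levi R Q) (j : ι) [Decidable (i = j)] :
    R.root' i (cowRel R B Q j) = if i = j then 1 else 0 := by
  rw [root'_cowRel hiQ, (hB.cow_spec j).2 i hi]
  split_ifs <;> rfl

theorem IsMin.wt_cowRel (hB : IsMin R B) (hQ : IsParabolic R Q) (h : B ⊆ Q) {i : ι}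
    (hi : i ∈ minimalSimple R B) (hiQ : i ∉ levi R Q) (j : ι) : wt R B i (cowRel R B Q j) = 0 := by
  refine hB.wt_eq_zero_of_mem hi hiQ ?_
  rw [← hB.corootSpan_levi hQ h]
  exact cowRel_mem j

-- The lattice has a mixed basis: projected coweights for the roots in $M_Q$ and scaled projected
-- coroots for the others, with dual forms the roots and $b\varpi_i$. The first directions
-- contribute the Laurent series of `f i`, the others truncated geometric series. For the latter,
-- `cowRel R B Q i = 0` explains the constant `f i 1`.
open Classical in
theorem IsMin.regSum_mix (hq : 1 < q) (hB : IsMin R B) (hP : IsParabolic R P) (h : B ⊆ P)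
    (hQ : Q ∈ parabolicsContaining R P) (hb : 1 ≤ b) {S : ι → ℤ → ℂ} {f : ι → ℂ → ℂ} {ρ : ℝ}
    (hf : ∀ i ∈ simpleRel R B P Set.univ, ∀ z : ℂ, z ≠ 0 → ‖z‖ < ρ →
      Summable (fun k : ℤ => ‖(S i k - S i (k - 1)) * z ^ k‖) ∧
        HasSum (fun k : ℤ => (S i k - S i (k - 1)) * z ^ k) (f i z)) {μ : aC R M}
    (hμ : ∀ i ∈ simpleRel R B P Set.univ, ‖qpow R q μ (cowRel R B Q i)‖ < ρ)
    (hw : ∀ w ∈ coweights R P Q, qpow R q μ w ≠ 1)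
    (hv : ∀ v ∈ simpleCoroots R Q Set.univ, qpow R q ((b : ℂ)⁻¹ • μ) v ≠ 1) :
    RegSum (qpow R q μ) (mixCoeff R b B P Q ξ S fun i => f i 1)
      (varthetaHat R q P Q μ *
        (∏ i ∈ simpleRel R B P Set.univ, f i (qpow R q μ (cowRel R B Q i))) *
        vartheta R q Q Set.univ ((b : ℝ) • ξ) ((b : ℂ)⁻¹ • μ)) := by
  have hBQ := h.trans hQ.2
  have hb' : (0 : ℝ) < b := by positivity
  let v : ι → Y := fun i => if i ∈ levi R Q then cowRel R B Q i else (b : ℝ)⁻¹ • cor R Q i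
  let F : ι → Module.Dual ℝ Y := fun i =>
    if i ∈ levi R Q then R.root' i else (b : ℝ) • wt R B i
  let S' : ι → ℤ → ℂ := fun i k =>
    if i ∈ levi R Q then S i k else if wt R B i ((b : ℝ) • ξ) < k then f i 1 else 0
  let t : ι → ℂ := fun i => if i ∈ levi R Q then f i (qpow R q μ (cowRel R B Q i)) else
    f i 1 * qpow R q μ ((b : ℝ)⁻¹ • cor R Q i) ^ (⌊wt R B i ((b : ℝ) • ξ)⌋ + 1)
  have hsw := hB.coweights_eq hP hQ.1 h hQ.2
  have hsv := hB.simpleCoroots_univ_eq hQ.1 hBQ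
  have key := regSum_family hq μ (simpleRel R B P Set.univ) v F (fun i hi j hj => by
      rw [mem_simpleRel_univ] at hi hj
      simp only [F, v]
      by_cases hiQ : i ∈ levi R Q
      · rw [if_pos hiQ]
        by_cases hjQ : j ∈ levi R Q
        · rw [if_pos hjQ, hB.root'_cowRel_eq hi.1 hiQ]
        · rw [if_neg hjQ, map_smul, if_neg (show ¬ i = j from fun e => hjQ (e ▸ hiQ))]
          have : R.root' i (cor R Q j) = 0 := cor_mem_aReal R Q j i hiQ
          rw [this, smul_zero]
      · rw [if_neg hiQ, LinearMap.smul_apply]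
        by_cases hjQ : j ∈ levi R Q
        · rw [if_pos hjQ, hB.wt_cowRel hQ.1 hBQ hi.1 hiQ, smul_zero,
            if_neg (show ¬ i = j from fun e => hiQ (e ▸ hjQ))]
        · rw [if_neg hjQ, map_smul, hB.wt_cor hQ.1 hBQ hi.1 hiQ, (hB.wt_spec hi.1).1 j hj.1]
          simp only [eq_comm (a := j)]
          split_ifs <;> simp [hb'.ne'])
    (fun i hi => by
      rw [mem_simpleRel_univ] at hi
      simp only [v]
      split_ifs with hiQ
      · refine hw _ ?_
        rw [hsw]
        exact Set.mem_image_of_mem _ ⟨hi.1, hiQ, hi.2⟩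
      · rw [← qpow_inv_smul]
        refine hv _ ?_
        rw [hsv]
        exact Set.mem_image_of_mem _ ⟨hi.1, hiQ⟩)
    (S := S') (t := t)
    (fun i hi => by
      by_cases hiQ : i ∈ levi R Q
      · simp only [S', v, if_pos hiQ]
        exact (hf i hi _ (qpow_ne_zero hq _ _) (hμ i hi)).1
      · simp only [S', v, if_neg hiQ]
        exact (hasSum_truncated _ _ _).1)
    (fun i hi => by
      by_cases hiQ : i ∈ levi R Q
      · simp only [S', v, t, if_pos hiQ]
        exact (hf i hi _ (qpow_ne_zero hq _ _) (hμ i hi)).2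
      · simp only [S', v, t, if_neg hiQ]
        exact (hasSum_truncated _ _ _).2)
  have hlat : AddSubgroup.closure (v '' simpleRel R B P Set.univ) =
      AddSubgroup.closure (coweights R P Q) ⊔ scaledLattice b (simpleCoroots R Q Set.univ) := by
    rw [hsw, hsv, closure_scaled, ← AddSubgroup.closure_union]
    congr 1
    ext y
    constructor
    · rintro ⟨i, hi, rfl⟩
      rw [Finset.mem_coe, mem_simpleRel_univ] at hi
      by_cases hiQ : i ∈ levi R Q
      · exact Or.inl ⟨i, ⟨hi.1, hiQ, hi.2⟩, by simp only [v, if_pos hiQ]⟩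
      · exact Or.inr ⟨i, ⟨hi.1, hiQ⟩, by simp only [v, if_neg hiQ]⟩
    · rintro (⟨i, hi, rfl⟩ | ⟨i, hi, rfl⟩)
      · exact ⟨i, Finset.mem_coe.2 ((mem_simpleRel_univ R).2 ⟨hi.1, hi.2.2⟩),
          by simp only [v, if_pos hi.2.1]⟩
      · exact ⟨i, Finset.mem_coe.2 ((mem_simpleRel_univ R).2
          ⟨hi.1, fun h' => hi.2 (levi_mono R hQ.2 h')⟩), by simp only [v, if_neg hi.2]⟩
  rw [hlat] at key
  convert key using 1
  · funext H
    rw [mixCoeff]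
    by_cases hH : H ∈ AddSubgroup.closure (coweights R P Q) ⊔
        scaledLattice b (simpleCoroots R Q Set.univ)
    swap
    · rw [if_neg hH, if_neg hH]
    rw [if_pos hH, if_pos hH]
    refine Finset.prod_congr rfl fun i hi => ?_
    rw [mem_simpleRel_univ] at hi
    by_cases hiQ : i ∈ levi R Q
    · simp only [S', F, if_pos hiQ]
    · simp only [S', F, if_neg hiQ]
      refine if_congr ?_ rfl rfl
      obtain ⟨y, hy, y', hy', rfl⟩ := AddSubgroup.mem_sup.1 hH
      have h0 : wt R B i y = 0 := by
        rw [hsw] at hy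
        refine AddSubgroup.closure_induction (p := fun y _ => wt R B i y = 0) ?_ (map_zero _) ?_ ?_ hy
        · rintro _ ⟨j, -, rfl⟩
          exact hB.wt_cowRel hQ.1 hBQ hi.1 hiQ j
        · intro x y _ _ hx hy
          rw [map_add, hx, hy, add_zero]
        · intro x _ hx
          rw [map_neg, hx, neg_zero]
      obtain ⟨z, hz⟩ := hB.wt_scaled hQ.1 hBQ hb hi.1 hiQ hy'
      rw [LinearMap.smul_apply, smul_eq_mul, map_add, h0, zero_add, hz, Int.floor_intCast, ← hz,
        map_smul, smul_eq_mul]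
      exact (mul_lt_mul_iff_right₀ hb').symm
  · rw [hB.varthetaHat_eq hP hQ.1 h hQ.2, hB.vartheta_eq hq hQ.1 hBQ, ← filter_simpleRel_mem,
      ← filter_simpleRel_notMem hQ.2, Finset.prod_filter, Finset.prod_filter,
      ← Finset.prod_mul_distrib, ← Finset.prod_mul_distrib]
    refine Finset.prod_congr rfl fun i hi => ?_
    by_cases hiQ : i ∈ levi R Q
    · simp only [t, v, if_pos hiQ, if_neg (not_not.2 hiQ), mul_one]
      rw [one_div_mul_eq_div]
    · simp only [t, v, if_neg hiQ, if_pos hiQ, one_mul]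
      rw [hB.cowRel_eq_zero hQ.1 hBQ hiQ, qpow_zero, qpow_inv_smul, mul_div_assoc]

theorem qpow_lat (hq : 1 < q) {n : aC R M} (hn : n ∈ lat R q M) {H : Y} (hH : H ∈ aReal R M)
    (h : ∀ i, ∃ z : ℤ, R.root' i H = z) : qpow R q n H = 1 := by
  obtain ⟨z, hz⟩ := extend_lat_int hn hH h
  have hq0 : (q : ℂ) ≠ 0 := by exact_mod_cast (by omega : q ≠ 0)
  have hlog : ((Real.log q : ℝ) : ℂ) ≠ 0 := by
    exact_mod_cast (Real.log_pos (by exact_mod_cast hq)).ne'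
  rw [qpow, hz, cpow_def_of_ne_zero hq0, Complex.exp_eq_one_iff]
  refine ⟨-z, ?_⟩
  rw [period, ← natCast_log]
  field_simp
  push_cast
  ring

theorem IsMin.qpow_period_ne_one (hq : 1 < q) (i : ι) {H : Y}
    (hH : H ∈ aReal R M) (h : ∀ z : ℤ, R.root' i H ≠ z) :
    qpow R q (period q • toC R M (R.root i)) H ≠ 1 := by
  have hq0 : (q : ℂ) ≠ 0 := by exact_mod_cast (by omega : q ≠ 0)
  have hlog : ((Real.log q : ℝ) : ℂ) ≠ 0 := by
    exact_mod_cast (Real.log_pos (by exact_mod_cast hq)).ne'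
  rw [qpow, extend_smul, extend_toC R _ hH, cpow_def_of_ne_zero hq0, Ne, Complex.exp_eq_one_iff]
  rintro ⟨z, hz⟩
  apply h (-z)
  rw [period, ← natCast_log] at hz
  have h2 : (2 * Real.pi * I : ℂ) ≠ 0 := Complex.two_pi_I_ne_zero
  have h3 : -((R.toLinearMap (R.root i) H : ℝ) : ℂ) = z := by
    apply mul_right_cancel₀ h2
    rw [← hz]
    field_simp
  have h4 : (R.toLinearMap (R.root i) H : ℝ) = -(z : ℝ) := by
    have : ((-(R.toLinearMap (R.root i) H) : ℝ) : ℂ) = ((z : ℝ) : ℂ) := by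
      push_cast
      exact h3
    have := Complex.ofReal_injective this
    linarith
  change R.toLinearMap (R.root i) H = _
  rw [h4]
  push_cast
  rfl

theorem coweights_mem_aReal (hP : P ∈ parabolicsOfLevi R M) (Q : Set ι) {H : Y}
    (hH : H ∈ coweights R P Q) : H ∈ aReal R M := by
  have := hH.1.1
  rwa [hP.2] at this

theorem mem_aReal_of_mem_scaled (hP : P ∈ parabolicsOfLevi R M) {H : Y}
    (hH : H ∈ scaledLattice b' (coweights R P Set.univ)) : H ∈ aReal R M ∧
      H ∈ corootSpan R Set.univ := by
  refine AddSubgroup.closure_induction (p := fun H _ => H ∈ aReal R M ∧ H ∈ corootSpan R Set.univ)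
    ?_ ⟨zero_mem _, zero_mem _⟩ ?_ ?_ hH
  · rintro _ ⟨w, hw, rfl⟩
    refine ⟨Submodule.smul_mem _ _ (coweights_mem_aReal hP _ hw), Submodule.smul_mem _ _ ?_⟩
    have := hw.1.2
    rwa [levi_univ] at this
  · exact fun x y _ _ hx hy => ⟨add_mem hx.1 hy.1, add_mem hx.2 hy.2⟩
  · exact fun x _ hx => ⟨neg_mem hx.1, neg_mem hx.2⟩

theorem IsMin.root'_coweight_int (hB : IsMin R B) (hP : IsParabolic R P) (h : B ⊆ P) {H : Y}
    (hH : H ∈ AddSubgroup.closure (coweights R P Set.univ)) (i : ι) :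
    ∃ z : ℤ, R.root' i H = z := by
  refine exists_int_of_mem_closure ?_ hH
  rw [hB.coweights_univ_eq hP h]
  rintro _ ⟨j, -, rfl⟩
  exact hB.root'_cow_int i j

/-- Orthogonality of characters: `H` defines a character of $\Lambda/b'\Lambda$, which is nontrivial
because some simple root takes a non-integral value at `H`. The average over $\mathfrak N$ thereby
removes the points that the lattices of the single terms have in excess of $\mathbb
Z(\hat\Delta_P^\vee)$. -/
theorem sum_qpow_eq_zero (hq : 1 < q) (hP : P ∈ parabolicsOfLevi R M)
    {N : Finset (aC R M)} (hN : IsDualTriplet R q M N b b') {H : Y}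
    (hH : H ∈ scaledLattice b' (coweights R P Set.univ))
    (hH' : H ∉ AddSubgroup.closure (coweights R P Set.univ)) :
    ∑ n ∈ N, qpow R q n H = 0 := by
  classical
  obtain ⟨B, hB, h⟩ := exists_isMin_subset R hP.1
  obtain ⟨haR, hsp⟩ := mem_aReal_of_mem_scaled hP hH
  have hb'0 : (b' : ℝ) ≠ 0 := by
    have := hN.one_le_b'
    positivity
  -- multiples of `b'` act trivially
  have hbH : (b' : ℝ) • H ∈ AddSubgroup.closure (coweights R P Set.univ) := by
    refine AddSubgroup.closure_induction
      (p := fun H _ => (b' : ℝ) • H ∈ AddSubgroup.closure (coweights R P Set.univ)) ?_ ?_ ?_ ?_ hH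
    · rintro _ ⟨w, hw, rfl⟩
      simp only
      rw [smul_smul, mul_inv_cancel₀ hb'0, one_smul]
      exact AddSubgroup.subset_closure hw
    · rw [smul_zero]
      exact zero_mem _
    · intro x y _ _ hx hy
      rw [smul_add]
      exact add_mem hx hy
    · intro x _ hx
      rw [smul_neg]
      exact neg_mem hx
  have htriv : ∀ y ∈ lat R q M, qpow R q (b' • y) H = 1 := by
    intro y hy
    have e : extend R (b' • y) H = extend R y ((b' : ℝ) • H) := by
      rw [map_smul, real_smul, ← Nat.cast_smul_eq_nsmul ℂ, extend_smul]
      push_cast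
      rfl
    have : qpow R q (b' • y) H = qpow R q y ((b' : ℝ) • H) := by
      rw [qpow, e, qpow]
    rw [this]
    exact qpow_lat hq hy (Submodule.smul_mem _ _ haR) (hB.root'_coweight_int hP.1 h hbH)
  -- a lattice element acting non-trivially
  obtain ⟨i, hi, hiz⟩ : ∃ i ∈ simpleRel R B P Set.univ, ∀ z : ℤ, R.root' i H ≠ z := by
    by_contra hcon
    push Not at hcon
    apply hH'
    rw [← hB.sum_cow_rel (P := P) (hP.2.symm ▸ haR) hsp]
    refine sum_mem fun i hi => ?_
    obtain ⟨z, hz⟩ := hcon i hi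
    rw [hz, Int.cast_smul_eq_zsmul ℝ]
    refine AddSubgroup.zsmul_mem _ (AddSubgroup.subset_closure ?_) z
    rw [hB.coweights_univ_eq hP.1 h]
    rw [mem_simpleRel_univ] at hi
    exact Set.mem_image_of_mem _ hi
  set y := period q • toC R M (R.root i) with hy
  have hyl : y ∈ lat R q M := by
    have hm : y ∈ Set.range (fun i => period q • toC R M (R.root i)) := ⟨i, rfl⟩
    exact AddSubgroup.subset_closure hm
  have hyne : qpow R q y H ≠ 1 := IsMin.qpow_period_ne_one hq i haR hiz
  have hNl : ∀ n ∈ N, n ∈ lat R q M := fun n hn => by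
    have := hN.subset_lattice P hP n hn
    rwa [periodLattice_eq q hP] at this
  have hrep : ∀ x ∈ lat R q M, ∃! n, n ∈ N ∧ ∃ y ∈ lat R q M, x - n = b' • y := by
    intro x hx
    have := hN.representatives P hP x (by rwa [periodLattice_eq q hP])
    rwa [periodLattice_eq q hP] at this
  choose! π hπ hπu using fun n (hn : n ∈ N) => hrep (n + y) (add_mem (hNl n hn) hyl)
  have hinj : Set.InjOn π N := by
    intro n hn m hm hnm
    obtain ⟨-, u, hu, e⟩ := hπ n hn
    obtain ⟨-, u', hu', e'⟩ := hπ m hm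
    obtain ⟨k, -, hk⟩ := hrep n (hNl n hn)
    have h1 := hk n ⟨hn, 0, zero_mem _, by rw [sub_self, nsmul_zero]⟩
    have h2 := hk m ⟨hm, u - u', sub_mem hu hu', by
      rw [smul_sub, ← e, ← e', hnm]
      abel⟩
    rw [h1, h2]
  have himage : N.image π = N :=
    Finset.eq_of_subset_of_card_le (Finset.image_subset_iff.2 fun n hn => (hπ n hn).1)
      (Finset.card_image_of_injOn hinj).ge
  have hval : ∀ n ∈ N, qpow R q (π n) H = qpow R q y H * qpow R q n H := by
    intro n hn
    obtain ⟨-, u, hu, e⟩ := hπ n hn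
    have h1 : n + y = π n + b' • u := by
      rw [← e]
      abel
    have h2 : qpow R q (n + y) H = qpow R q (π n) H := by
      rw [h1, qpow_add_left hq, htriv u hu, mul_one]
    rw [← h2, qpow_add_left hq, mul_comm]
  have hsum : ∑ n ∈ N, qpow R q n H = qpow R q y H * ∑ n ∈ N, qpow R q n H := by
    rw [Finset.mul_sum]
    conv_lhs => rw [← himage]
    rw [Finset.sum_image hinj]
    exact Finset.sum_congr rfl hval
  have : (1 - qpow R q y H) * ∑ n ∈ N, qpow R q n H = 0 := by
    rw [sub_mul, one_mul, ← hsum, sub_self]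
  exact (mul_eq_zero.1 this).resolve_left (sub_ne_zero.2 hyne.symm)

open Classical in
/-- Expansion of a product over the parabolic subgroups containing `P`. -/
theorem IsMin.prod_sub_eq (hB : IsMin R B) (hP : IsParabolic R P) (h : B ⊆ P)
    [Fintype (parabolicsContaining R P)] (s t : ι → ℂ) :
    ∏ i ∈ simpleRel R B P Set.univ, (s i - t i) =
      ∑ Q : parabolicsContaining R P, (-1) ^ Module.finrank ℝ (aRel R Q.1 Set.univ) *
        ∏ i ∈ simpleRel R B P Set.univ, if i ∈ levi R Q.1 then s i else t i := by
  simp only [sub_eq_add_neg]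
  rw [Finset.prod_add]
  symm
  refine Finset.sum_bij (fun Q _ => simpleRel R B P Q.1) ?_ ?_ ?_ ?_
  · intro Q _
    rw [Finset.mem_powerset, ← filter_simpleRel_mem]
    exact Finset.filter_subset _ _
  · have key : ∀ Q Q' : parabolicsContaining R P, simpleRel R B P Q.1 = simpleRel R B P Q'.1 →
        Q.1 ⊆ Q'.1 := by
      intro Q Q' e
      refine hB.parabolic_le Q.2.1 Q'.2.1 (h.trans Q.2.2) (h.trans Q'.2.2) fun i hi => ?_
      by_cases hiP : i ∈ levi R P
      · exact levi_mono R Q'.2.2 hiP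
      · have : i ∈ simpleRel R B P Q.1 := (mem_simpleRel R).2 ⟨hi.1, hi.2, hiP⟩
        rw [e, mem_simpleRel] at this
        exact this.2.1
    exact fun Q _ Q' _ e => Subtype.ext (Set.Subset.antisymm (key Q Q' e) (key Q' Q e.symm))
  · intro J hJ
    rw [Finset.mem_powerset] at hJ
    obtain ⟨Q, hQ, hBQ, hQJ⟩ := hB.exists_parabolic (levi R P ∪ J)
    have hPQ : P ⊆ Q := hB.parabolic_le hP hQ h hBQ fun i hi => (hQJ i hi.1).2 (Or.inl hi.2)
    refine ⟨⟨Q, hQ, hPQ⟩, Finset.mem_univ _, ?_⟩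
    ext i
    rw [mem_simpleRel]
    constructor
    · rintro ⟨h1, h2, h3⟩
      exact ((hQJ i h1).1 h2).resolve_left h3
    · intro hi
      have := hJ hi
      rw [mem_simpleRel_univ] at this
      exact ⟨this.1, (hQJ i this.1).2 (Or.inr hi), this.2⟩
  · intro Q _
    have hsdiff : simpleRel R B P Set.univ \ simpleRel R B P Q.1 = simpleRel R B Q.1 Set.univ := by
      rw [← filter_simpleRel_notMem Q.2.2]
      ext i
      rw [Finset.mem_sdiff, Finset.mem_filter, mem_simpleRel_univ, mem_simpleRel]
      tauto
    rw [hsdiff, hB.finrank_aRel Q.2.1 (h.trans Q.2.2), Finset.prod_ite, filter_simpleRel_mem,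
      filter_simpleRel_notMem Q.2.2, Finset.prod_neg]
    ring

end Coefficients

end Cofamily

end

noncomputable section

namespace Cofamily

set_option linter.unusedSectionVars false

open Complex

/-! ### Exponential decay of the combined coefficients. -/

section Decay

theorem summable_pow_natAbs {θ : ℝ} (h0 : 0 ≤ θ) (h1 : θ < 1) :
    Summable fun k : ℤ => θ ^ k.natAbs := by
  refine Summable.of_nat_of_neg ?_ ?_
  · simpa using summable_geometric_of_lt_one h0 h1
  · simpa using summable_geometric_of_lt_one h0 h1

theorem summable_prod_pow {I : Type*} [Fintype I] {θ : ℝ} (h0 : 0 ≤ θ) (h1 : θ < 1) :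
    Summable fun k : I → ℤ => ∏ i, θ ^ (k i).natAbs := by
  have h := summable_pow_natAbs h0 h1
  have hc : Summable fun k : ℤ => ((θ ^ k.natAbs : ℝ) : ℂ) := Complex.summable_ofReal.2 h
  have := (summable_norm_pi_prod (I := I) (fun _ (k : ℤ) => ((θ ^ k.natAbs : ℝ) : ℂ)) _
    (fun _ => hc.norm) (fun _ => hc.hasSum)).1
  refine this.congr fun k => ?_
  rw [← Complex.ofReal_prod, Complex.norm_real, Real.norm_of_nonneg]
  exact Finset.prod_nonneg fun i _ => pow_nonneg h0 _

variable {Y : Type*} [NormedAddCommGroup Y] [NormedSpace ℝ Y] [FiniteDimensional ℝ Y]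

theorem exists_abs_le {κ : Type*} (J : Finset κ) (f : κ → Module.Dual ℝ Y) :
    ∃ E : ℝ, 0 < E ∧ ∀ i ∈ J, ∀ H, |f i H| ≤ E * ‖H‖ := by
  refine ⟨∑ i ∈ J, ‖LinearMap.toContinuousLinearMap (f i)‖ + 1,
    add_pos_of_nonneg_of_pos (Finset.sum_nonneg fun i _ => norm_nonneg _) one_pos,
    fun i hi H => ?_⟩
  have h1 := (LinearMap.toContinuousLinearMap (f i)).le_opNorm H
  refine h1.trans (mul_le_mul_of_nonneg_right ?_ (norm_nonneg _))
  have := Finset.single_le_sum (f := fun i => ‖LinearMap.toContinuousLinearMap (f i)‖)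
    (fun i _ => norm_nonneg _) hi
  linarith

-- Coordinates of a lattice point are bounded by a multiple of its norm, so the exponential is
-- dominated by a product of geometric series in the coordinates.
open Classical in
theorem summable_lattice {κ : Type*} (J : Finset κ) (v : κ → Y)
    (f : κ → Module.Dual ℝ Y) (hf : ∀ i ∈ J, ∀ j ∈ J, f i (v j) = if i = j then 1 else 0)
    {ε : ℝ} (hε : 0 < ε) :
    Summable fun H : Y => if H ∈ AddSubgroup.closure (v '' J) then Real.exp (-(ε * ‖H‖)) else 0 := by
  obtain ⟨e, he, -, hfe, hrange⟩ := exists_latticeHom J v f hf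
  obtain ⟨E, hE, hfE⟩ := exists_abs_le J f
  rw [← he.summable_iff fun H hH => if_neg (by rwa [hrange])]
  set D : ℝ := Fintype.card J * E + 1 with hD
  have hD0 : 0 < D := by positivity
  have hθ : Real.exp (-(ε / D)) < 1 := by
    rw [← Real.exp_zero, Real.exp_lt_exp, neg_lt_zero]
    positivity
  refine Summable.of_nonneg_of_le (fun k => ?_) (fun k => ?_)
    (summable_prod_pow (I := J) (Real.exp_pos _).le hθ)
  · simp only [Function.comp_apply]
    split_ifs
    · positivity
    · exact le_rfl
  · simp only [Function.comp_apply]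
    rw [if_pos ((hrange _).2 ⟨k, rfl⟩), Finset.prod_congr rfl fun i _ =>
      (Real.exp_nat_mul (-(ε / D)) (k i).natAbs).symm, ← Real.exp_sum, Real.exp_le_exp,
      ← Finset.sum_mul]
    have h1 : ∑ i : J, ((k i).natAbs : ℝ) ≤ D * ‖e k‖ := by
      have h2 : ∑ i : J, ((k i).natAbs : ℝ) ≤ ∑ _i : J, E * ‖e k‖ :=
        Finset.sum_le_sum fun i _ => by
          have h3 := hfE i i.2 (e k)
          rw [hfe] at h3
          rwa [Nat.cast_natAbs, Int.cast_abs]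
      rw [Finset.sum_const, nsmul_eq_mul, Finset.card_univ] at h2
      rw [hD, add_mul, mul_assoc]
      have := norm_nonneg (e k)
      linarith
    have h4 : ε / D * ∑ i : J, ((k i).natAbs : ℝ) ≤ ε * ‖e k‖ := by
      calc ε / D * ∑ i : J, ((k i).natAbs : ℝ) ≤ ε / D * (D * ‖e k‖) := by gcongr
        _ = ε * ‖e k‖ := by field_simp
    linarith

theorem exists_posDef_le {V : Submodule ℝ Y} {b : LinearMap.BilinForm ℝ Y}
    (hb : ∀ H ∈ V, H ≠ 0 → 0 < b H H) : ∃ m : ℝ, 0 < m ∧ ∀ H ∈ V, m * ‖H‖ ^ 2 ≤ b H H := by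
  have hcont : Continuous fun H : V => b (H : Y) (H : Y) := by
    let b' : Y →L[ℝ] Y →L[ℝ] ℝ := LinearMap.toContinuousLinearMap
      ((LinearMap.toContinuousLinearMap : (Y →ₗ[ℝ] ℝ) ≃ₗ[ℝ] (Y →L[ℝ] ℝ)).toLinearMap ∘ₗ b)
    have : Continuous fun H : V => b' (H : Y) (H : Y) := by fun_prop
    exact this
  by_cases hne : (Metric.sphere (0 : V) 1).Nonempty
  · obtain ⟨x, hx, hmin⟩ := (isCompact_sphere (0 : V) 1).exists_isMinOn hne hcont.continuousOn
    have hx0 : (x : Y) ≠ 0 := by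
      intro h0
      have : x = 0 := Subtype.ext h0
      rw [this] at hx
      simp at hx
    refine ⟨b x x, hb x x.2 hx0, fun H hH => ?_⟩
    by_cases h0 : H = 0
    · simp [h0]
    have hn : ‖H‖ ≠ 0 := norm_ne_zero_iff.2 h0
    let y : V := ‖H‖⁻¹ • ⟨H, hH⟩
    have hy : y ∈ Metric.sphere (0 : V) 1 := by
      rw [mem_sphere_zero_iff_norm, norm_smul, norm_inv, norm_norm]
      exact inv_mul_cancel₀ hn
    have h1 : b x x ≤ b (y : Y) (y : Y) := hmin hy
    have h2 : b (y : Y) (y : Y) = ‖H‖⁻¹ * (‖H‖⁻¹ * b H H) := by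
      simp only [y, Submodule.coe_smul, map_smul, LinearMap.smul_apply, smul_eq_mul]
    rw [h2] at h1
    calc b x x * ‖H‖ ^ 2 ≤ ‖H‖⁻¹ * (‖H‖⁻¹ * b H H) * ‖H‖ ^ 2 := by gcongr
      _ = b H H := by field_simp
  · refine ⟨1, one_pos, fun H hH => ?_⟩
    by_cases h0 : H = 0
    · simp [h0]
    exfalso
    apply hne
    refine ⟨‖H‖⁻¹ • ⟨H, hH⟩, ?_⟩
    rw [mem_sphere_zero_iff_norm, norm_smul, norm_inv, norm_norm]
    exact inv_mul_cancel₀ (norm_ne_zero_iff.2 h0)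

/-- A factor of the Fourier coefficients is small unless it forces an inequality. -/
theorem exists_factor_bound {S : ℤ → ℂ} {a : ℂ} {C η : ℝ} {K : ℕ} (hC : 0 < C) (hη : 0 < η)
    (hη1 : η < 1) (hK : ∀ k : ℤ, k < -K → S k = 0) (hSa : ∀ k, ‖S k - a‖ ≤ C * η ^ k)
    (hS : ∀ k, ‖S k‖ ≤ C) (x : ℝ) : ∃ C' D : ℝ, 0 < C' ∧ 0 < D ∧ ∀ (k : ℤ) (w : ℝ),
      ∃ s : ℝ, 0 ≤ s ∧ ‖S k - if x < w then a else 0‖ ≤ C' * Real.exp (-s) ∧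
        k * w ≤ D * (|(k : ℝ)| + s * |w|) := by
  set δ : ℝ := -Real.log η with hδ
  have hδ0 : 0 < δ := neg_pos.2 (Real.log_neg hη hη1)
  have hηδ : η = Real.exp (-δ) := by rw [hδ, neg_neg, Real.exp_log hη]
  set C' : ℝ := (C + ‖a‖) * Real.exp (δ * K) with hC'
  have hexp : 1 ≤ Real.exp (δ * K) := Real.one_le_exp (by positivity)
  have hCa : 0 < C + ‖a‖ := by positivity
  have hCC : C + ‖a‖ ≤ C' := le_mul_of_one_le_right hCa.le hexp
  have hC'0 : 0 < C' := by positivity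
  have hkw : ∀ (k : ℤ) (w : ℝ), k * w ≤ (|x| + δ⁻¹) * (|(k : ℝ)| + δ * |(k : ℝ)| * |w|) := by
    intro k w
    have h1 : k * w ≤ |(k : ℝ)| * |w| := by
      rw [← abs_mul]
      exact le_abs_self _
    have h2 : δ⁻¹ * (δ * |(k : ℝ)| * |w|) = |(k : ℝ)| * |w| := by field_simp
    have h3 : 0 ≤ |x| * (|(k : ℝ)| + δ * |(k : ℝ)| * |w|) := by positivity
    have h4 : 0 ≤ δ⁻¹ * |(k : ℝ)| := by positivity
    nlinarith
  have hx : ∀ (k : ℤ) (w : ℝ), k * w ≤ k * x →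
      k * w ≤ (|x| + δ⁻¹) * (|(k : ℝ)| + 0 * |w|) := by
    intro k w h
    have h1 : k * x ≤ |(k : ℝ)| * |x| := by
      rw [← abs_mul]
      exact le_abs_self _
    have h4 : 0 ≤ δ⁻¹ * |(k : ℝ)| := by positivity
    nlinarith
  have hmid : ∀ (k : ℤ), -(K : ℤ) ≤ k → k < 0 → C + ‖a‖ ≤ C' * Real.exp (-(δ * |(k : ℝ)|)) := by
    intro k h1 h2
    rw [hC', mul_assoc, ← Real.exp_add]
    refine le_mul_of_one_le_right hCa.le (Real.one_le_exp ?_)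
    have h3 : |(k : ℝ)| ≤ K := by
      rw [abs_of_neg (by exact_mod_cast h2)]
      have : -(K : ℝ) ≤ k := by exact_mod_cast h1
      linarith
    nlinarith
  -- Two choices of `s` suffice. Where the factor decays, take $s=\delta|k|$; then
  -- $kw\le|k||w|=\delta^{-1}s|w|$ is free. Where it is merely bounded, `k` and `w - x` have
  -- opposite signs, so $kw\le kx$ and $s=0$ works. The finite range $-K\le k<0$ is absorbed in the
  -- factor $e^{\delta K}$ of `C'`.
  refine ⟨C', |x| + δ⁻¹, hC'0, by positivity, fun k w => ?_⟩
  by_cases hxw : x < w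
  · rw [if_pos hxw]
    rcases le_or_gt 0 k with hk | hk
    · refine ⟨δ * |(k : ℝ)|, by positivity, (hSa k).trans ?_, hkw k w⟩
      have : η ^ k = Real.exp (-(δ * |(k : ℝ)|)) := by
        lift k to ℕ using hk
        rw [zpow_natCast, Int.cast_natCast, Nat.abs_cast, hηδ, ← Real.exp_nat_mul]
        congr 1
        ring
      rw [this]
      refine mul_le_mul_of_nonneg_right (le_trans ?_ hCC) (Real.exp_pos _).le
      linarith [norm_nonneg a]
    · rcases lt_or_ge k (-K) with hkK | hkK
      · refine ⟨0, le_rfl, ?_, hx k w ?_⟩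
        · rw [hK k hkK, zero_sub, norm_neg, neg_zero, Real.exp_zero, mul_one]
          linarith
        · have : (k : ℝ) < 0 := by exact_mod_cast hk
          nlinarith
      · refine ⟨δ * |(k : ℝ)|, by positivity, le_trans ?_ (hmid k hkK hk), hkw k w⟩
        exact (norm_sub_le _ _).trans (by linarith [hS k])
  · rw [if_neg hxw, sub_zero]
    rcases le_or_gt 0 k with hk | hk
    · refine ⟨0, le_rfl, ?_, hx k w ?_⟩
      · rw [neg_zero, Real.exp_zero, mul_one]
        linarith [hS k, norm_nonneg a]
      · have : (0 : ℝ) ≤ k := by exact_mod_cast hk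
        nlinarith
    · rcases lt_or_ge k (-K) with hkK | hkK
      · refine ⟨δ * |(k : ℝ)|, by positivity, ?_, hkw k w⟩
        rw [hK k hkK, norm_zero]
        positivity
      · refine ⟨δ * |(k : ℝ)|, by positivity, le_trans ?_ (hmid k hkK hk), hkw k w⟩
        linarith [hS k, norm_nonneg a]

variable {ι X : Type*} [AddCommGroup X] [Module ℝ X] [Finite ι] {R : RootPairing ι ℝ X Y}
  [R.IsCrystallographic] {B P : Set ι}

theorem mem_of_mem_closure_coweights {H : Y}
    (hH : H ∈ AddSubgroup.closure (coweights R P Set.univ)) :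
    H ∈ aReal R (levi R P) ∧ H ∈ corootSpan R Set.univ := by
  refine AddSubgroup.closure_induction
    (p := fun H _ => H ∈ aReal R (levi R P) ∧ H ∈ corootSpan R Set.univ)
    ?_ ⟨zero_mem _, zero_mem _⟩ ?_ ?_ hH
  · rintro w hw
    have h1 := hw.1.2
    rw [levi_univ] at h1
    exact ⟨hw.1.1, h1⟩
  · exact fun x y _ _ hx hy => ⟨add_mem hx.1 hy.1, add_mem hx.2 hy.2⟩
  · exact fun x _ hx => ⟨neg_mem hx.1, neg_mem hx.2⟩

/-- Exponential decay of the Fourier coefficients. -/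
theorem IsMin.exists_cCoeff_bound (hB : IsMin R B) (hP : IsParabolic R P) (h : B ⊆ P) (ξ : Y)
    {S : ι → ℤ → ℂ} {a : ι → ℂ}
    (hS : ∀ i ∈ simpleRel R B P Set.univ, ∃ (C η : ℝ) (K : ℕ), 0 < C ∧ 0 < η ∧ η < 1 ∧
      (∀ k : ℤ, k < -K → S i k = 0) ∧ (∀ k, ‖S i k - a i‖ ≤ C * η ^ k) ∧ ∀ k, ‖S i k‖ ≤ C) :
    ∃ C ε : ℝ, 0 < C ∧ 0 < ε ∧ ∀ H, ‖cCoeff R B P ξ S a H‖ ≤ C * Real.exp (-(ε * ‖H‖)) := by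
  classical
  set I := simpleRel R B P Set.univ with hI
  have hfac : ∀ i, ∃ C' D : ℝ, 0 < C' ∧ 0 < D ∧ (i ∈ I → ∀ (k : ℤ) (w : ℝ),
      ∃ s : ℝ, 0 ≤ s ∧ ‖S i k - if wt R B i ξ < w then a i else 0‖ ≤ C' * Real.exp (-s) ∧
        k * w ≤ D * (|(k : ℝ)| + s * |w|)) := by
    intro i
    by_cases hi : i ∈ I
    · obtain ⟨C, η, K, h1, h2, h3, h4, h5, h6⟩ := hS i hi
      obtain ⟨C', D, h7, h8, h9⟩ := exists_factor_bound h1 h2 h3 h4 h5 h6 (wt R B i ξ)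
      exact ⟨C', D, h7, h8, fun _ => h9⟩
    · exact ⟨1, 1, one_pos, one_pos, fun h => absurd h hi⟩
  choose Cf Df hCf hDf hfac using hfac
  obtain ⟨b, c, hc, hsym, hbc, hbw, hpos⟩ := hB.exists_form_cow
  obtain ⟨m, hm, hbm⟩ := exists_posDef_le hpos
  obtain ⟨E₁, hE₁, hr⟩ := exists_abs_le I (fun i => R.root' i)
  obtain ⟨E₂, hE₂, hw⟩ := exists_abs_le I (fun i => wt R B i)
  set G : ℝ := ∑ i ∈ I, c i * Df i * (E₁ + E₂) + 1 with hG
  have hGi : ∀ i ∈ I, c i * Df i * (E₁ + E₂) ≤ G := fun i hi => by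
    have := Finset.single_le_sum (f := fun i => c i * Df i * (E₁ + E₂)) (fun i _ => by
      have := hc i
      have := hDf i
      positivity) hi
    linarith
  have hGs : ∑ i ∈ I, c i * Df i * (E₁ + E₂) ≤ G := by linarith
  have hG0 : 0 < G := by
    have : 0 ≤ ∑ i ∈ I, c i * Df i * (E₁ + E₂) := Finset.sum_nonneg fun i _ => by
      have := hc i
      have := hDf i
      positivity
    linarith
  -- The inequalities attached to the factors are summed in the positive definite form:
  -- $m\|H\|^2\le\sum c_i\langle\alpha_i,H\rangle\varpi_i(H)\le G\|H\|(1+\sum s_i)$. Hence $\sum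
  -- s_i\ge\frac mG\|H\|-1$, which accounts for the rate and for the extra factor $e$.
  refine ⟨(∏ i ∈ I, Cf i) * Real.exp 1, m / G, mul_pos (Finset.prod_pos fun i _ => hCf i)
    (Real.exp_pos _), by positivity, fun H => ?_⟩
  by_cases hH : H ∈ AddSubgroup.closure (coweights R P Set.univ)
  swap
  · rw [cCoeff, if_neg hH, norm_zero]
    exact mul_nonneg (mul_nonneg (Finset.prod_nonneg fun i _ => (hCf i).le) (Real.exp_pos _).le)
      (Real.exp_pos _).le
  obtain ⟨hHM, hHs⟩ := mem_of_mem_closure_coweights hH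
  rw [cCoeff, if_pos hH, norm_prod]
  have hint := hB.root'_coweight_int hP h hH
  have hsi : ∀ i, ∃ s : ℝ, 0 ≤ s ∧ (i ∈ I →
      ‖S i ⌊R.root' i H⌋ - if wt R B i ξ < wt R B i H then a i else 0‖ ≤ Cf i * Real.exp (-s) ∧
        R.root' i H * wt R B i H ≤ Df i * (|R.root' i H| + s * |wt R B i H|)) := by
    intro i
    by_cases hi : i ∈ I
    · obtain ⟨s, h1, h2, h3⟩ := hfac i hi ⌊R.root' i H⌋ (wt R B i H)
      obtain ⟨z, hz⟩ := hint i
      refine ⟨s, h1, fun _ => ⟨h2, ?_⟩⟩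
      rwa [hz, Int.floor_intCast, ← hz] at h3
    · exact ⟨0, le_rfl, fun h => absurd h hi⟩
  choose s hs0 hs using hsi
  have hprod : ∏ i ∈ I, ‖S i ⌊R.root' i H⌋ - if wt R B i ξ < wt R B i H then a i else 0‖ ≤
      (∏ i ∈ I, Cf i) * Real.exp (-∑ i ∈ I, s i) := by
    rw [← Finset.sum_neg_distrib, Real.exp_sum, ← Finset.prod_mul_distrib]
    exact Finset.prod_le_prod (fun i _ => norm_nonneg _) fun i hi => (hs i hi).1
  refine hprod.trans ?_
  rw [mul_assoc, ← Real.exp_add]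
  refine mul_le_mul_of_nonneg_left (Real.exp_le_exp.2 ?_) (Finset.prod_nonneg fun i _ => (hCf i).le)
  by_cases h0 : H = 0
  · have := Finset.sum_nonneg fun i (_ : i ∈ I) => hs0 i
    rw [h0, norm_zero]
    linarith
  have hn : 0 < ‖H‖ := norm_pos_iff.2 h0
  have hexpand : b H H = ∑ i ∈ I, c i * (R.root' i H * wt R B i H) := by
    have e0 : b H H = b (∑ i ∈ I, R.root' i H • cow R B i) H :=
      congrArg (fun y => b y H) (hB.sum_cow_rel hHM hHs).symm
    rw [e0, map_sum, LinearMap.sum_apply]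
    refine Finset.sum_congr rfl fun i hi => ?_
    rw [mem_simpleRel_univ] at hi
    rw [map_smul, LinearMap.smul_apply, hbw i hi.1, smul_eq_mul]
    ring
  have hle : b H H ≤ ∑ i ∈ I, (c i * Df i * (E₁ + E₂) * ‖H‖ + G * ‖H‖ * s i) := by
    rw [hexpand]
    refine Finset.sum_le_sum fun i hi => ?_
    have h1 := (hs i hi).2
    have h2 := hr i hi H
    have h3 := hw i hi H
    have h4 := hGi i hi
    have hci := hc i
    have hDi := hDf i
    have hsi := hs0 i
    have hcD : 0 < c i * Df i := mul_pos hci hDi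
    calc c i * (R.root' i H * wt R B i H)
        ≤ c i * (Df i * (|R.root' i H| + s i * |wt R B i H|)) := by gcongr
      _ ≤ c i * (Df i * (E₁ * ‖H‖ + s i * (E₂ * ‖H‖))) := by gcongr
      _ = c i * Df i * E₁ * ‖H‖ + (c i * Df i * E₂) * (‖H‖ * s i) := by ring
      _ ≤ c i * Df i * (E₁ + E₂) * ‖H‖ + G * (‖H‖ * s i) := by
          have h5 : c i * Df i * E₂ ≤ G := by
            have : 0 ≤ c i * Df i * E₁ := by positivity
            linarith
          have h6 : 0 ≤ c i * Df i * E₂ * ‖H‖ := by positivity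
          have h7 : c i * Df i * E₂ * (‖H‖ * s i) ≤ G * (‖H‖ * s i) := by gcongr
          linarith
      _ = c i * Df i * (E₁ + E₂) * ‖H‖ + G * ‖H‖ * s i := by ring
  rw [Finset.sum_add_distrib, ← Finset.sum_mul, ← Finset.mul_sum] at hle
  have h1 := hbm H hHs
  have h2 : m * ‖H‖ ^ 2 ≤ G * ‖H‖ * (1 + ∑ i ∈ I, s i) := by
    have := mul_le_mul_of_nonneg_right hGs hn.le
    linarith
  have h3 : m / G * ‖H‖ ≤ 1 + ∑ i ∈ I, s i := by
    rw [div_mul_eq_mul_div, div_le_iff₀ hG0]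
    have h4 : m * ‖H‖ * ‖H‖ ≤ (1 + ∑ i ∈ I, s i) * G * ‖H‖ := by linarith
    exact le_of_mul_le_mul_right h4 hn
  linarith

end Decay

end Cofamily

end

noncomputable section

namespace Cofamily

set_option linter.unusedSectionVars false

open Complex

/-! ### The function $c_P$ as an absolutely convergent series. -/

section CFunction

variable {ι X Y : Type*} [AddCommGroup X] [Module ℝ X] [NormedAddCommGroup Y] [NormedSpace ℝ Y]
  [FiniteDimensional ℝ Y] [Finite ι] {R : RootPairing ι ℝ X Y} {M : Set ι} {q : ℕ}
  [R.IsCrystallographic] {B P Q : Set ι} {b b' : ℕ} {ξ : Y}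

theorem IsDualTriplet.subset_lat {N : Finset (aC R M)} (hN : IsDualTriplet R q M N b b')
    (hP : P ∈ parabolicsOfLevi R M) {n : aC R M} (hn : n ∈ N) : n ∈ lat R q M := by
  have := hN.subset_lattice P hP n hn
  rwa [periodLattice_eq q hP] at this

theorem IsDualTriplet.card_ne_zero {N : Finset (aC R M)} (hN : IsDualTriplet R q M N b b')
    (hP : P ∈ parabolicsOfLevi R M) : (N.card : ℂ) ≠ 0 := by
  obtain ⟨n, hn, -⟩ := hN.representatives P hP 0 (zero_mem _)
  exact_mod_cast (Finset.card_pos.2 ⟨n, hn.1⟩).ne'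

/-- The functions `c_{P,𝔑}(φ, λ)` are regularized sums with coefficients independent of the dual
triplet. -/
theorem IsMin.regSum_cTriplet (hq : 1 < q) (hB : IsMin R B) (hP : P ∈ parabolicsOfLevi R M)
    (h : B ⊆ P) {N : Finset (aC R M)} (hN : IsDualTriplet R q M N b b')
    {S : ι → ℤ → ℂ} {f : ι → ℂ → ℂ} {ρ : ℝ}
    (hf : ∀ i ∈ simpleRel R B P Set.univ, ∀ z : ℂ, z ≠ 0 → ‖z‖ < ρ →
      Summable (fun k : ℤ => ‖(S i k - S i (k - 1)) * z ^ k‖) ∧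
        HasSum (fun k : ℤ => (S i k - S i (k - 1)) * z ^ k) (f i z)) {l : aC R M}
    (hreg : CRegular R q N b P l) {φ : aC R M → ℂ}
    (hφ : ∀ n ∈ N, ∀ Q ∈ parabolicsContaining R P, φ (projC R Q (l + n)) =
      ∏ i ∈ simpleRel R B P Set.univ, f i (qpow R q (l + n) (cowRel R B Q i)))
    (hρ : ∀ n ∈ N, ∀ Q ∈ parabolicsContaining R P, ∀ i ∈ simpleRel R B P Set.univ,
      ‖qpow R q (l + n) (cowRel R B Q i)‖ < ρ) :
    RegSum (qpow R q l) (cCoeff R B P ξ S fun i => f i 1) (cTriplet R q N b ξ P φ l) := by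
  classical
  have := Fintype.ofFinite (parabolicsContaining R P)
  have hχ := fun x y => qpow_add (R := R) hq l x y
  have hterm : ∀ n ∈ N, ∀ Q : parabolicsContaining R P, RegSum (qpow R q l)
      (fun H => (-1) ^ Module.finrank ℝ (aRel R Q.1 Set.univ) *
        (mixCoeff R b B P Q.1 ξ S (fun i => f i 1) H * qpow R q n H))
      ((-1) ^ Module.finrank ℝ (aRel R Q.1 Set.univ) * varthetaHat R q P Q.1 (l + n) *
        φ (projC R Q.1 (l + n)) *
        vartheta R q Q.1 Set.univ ((b : ℝ) • ξ) ((b : ℂ)⁻¹ • (l + n))) := by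
    intro n hn Q
    have h1 := hB.regSum_mix (ξ := ξ) hq hP.1 h Q.2 hN.one_le_b hf (μ := l + n)
      (hρ n hn Q.1 Q.2) (hreg n hn Q.1 Q.2).1 (hreg n hn Q.1 Q.2).2
    rw [← hφ n hn Q.1 Q.2] at h1
    have e : (qpow R q (l + n) : Y → ℂ) = fun H => qpow R q l H * qpow R q n H :=
      funext fun H => qpow_add_left hq l n H
    -- Passing from $\lambda+\nu$ to $\lambda$ twists the coefficients by the character of $\nu$, so
    -- that all terms are summed against one character.
    have h2 := RegSum.mul_char (χ := qpow R q l) (ψ := qpow R q n)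
      (fun x y => qpow_add hq n x y) (by rw [← e]; exact h1)
    have h3 := h2.const_mul ((-1) ^ Module.finrank ℝ (aRel R Q.1 Set.univ))
    convert h3 using 1
    ring
  have hsum := (RegSum.sum hχ N fun n hn => RegSum.sum hχ Finset.univ fun Q _ =>
    hterm n hn Q).const_mul (1 / (N.card : ℂ))
  have e1 : cTriplet R q N b ξ P φ l = (1 / (N.card : ℂ)) * ∑ n ∈ N,
      ∑ Q : parabolicsContaining R P,
        (-1) ^ Module.finrank ℝ (aRel R Q.1 Set.univ) * varthetaHat R q P Q.1 (l + n) *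
        φ (projC R Q.1 (l + n)) *
        vartheta R q Q.1 Set.univ ((b : ℝ) • ξ) ((b : ℂ)⁻¹ • (l + n)) := by
    rw [cTriplet]
    congr 1
    refine Finset.sum_congr rfl fun n _ => ?_
    rw [← finsum_set_coe_eq_finsum_mem, finsum_eq_sum_of_fintype]
  rw [e1]
  convert hsum using 1
  funext H
  rw [Finset.sum_comm]
  have hcard := hN.card_ne_zero hP
  have hle : ∀ Q : parabolicsContaining R P, H ∈ AddSubgroup.closure (coweights R P Set.univ) →
      H ∈ AddSubgroup.closure (coweights R P Q.1) ⊔ scaledLattice b (simpleCoroots R Q.1 Set.univ) :=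
    fun Q hH => hN.lattice_le P hP Q.1 Q.2 hH
  have hge : ∀ Q : parabolicsContaining R P,
      H ∈ AddSubgroup.closure (coweights R P Q.1) ⊔ scaledLattice b (simpleCoroots R Q.1 Set.univ) →
      H ∈ scaledLattice b' (coweights R P Set.univ) :=
    fun Q hH => hN.le_lattice P hP Q.1 Q.2 hH
  -- On $\mathbb Z(\hat\Delta_P^\vee)$ the twists are trivial, every mixed lattice contains `H`, and
  -- the signed sum over `Q` is the expanded product. At all other points the average over
  -- $\mathfrak N$ gives zero.
  by_cases hH : H ∈ AddSubgroup.closure (coweights R P Set.univ)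
  · have hq1 : ∀ n ∈ N, qpow R q n H = 1 := fun n hn =>
      qpow_lat hq (hN.subset_lat hP hn) (hP.2 ▸ (mem_of_mem_closure_coweights hH).1)
        (hB.root'_coweight_int hP.1 h hH)
    rw [cCoeff, if_pos hH, hB.prod_sub_eq hP.1 h, Finset.mul_sum]
    refine Finset.sum_congr rfl fun Q _ => ?_
    rw [Finset.sum_congr rfl fun n hn => by rw [hq1 n hn, mul_one], Finset.sum_const,
      nsmul_eq_mul, ← mul_assoc, one_div_mul_cancel hcard, one_mul, mixCoeff, if_pos (hle Q hH)]
  · rw [cCoeff, if_neg hH]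
    symm
    refine mul_eq_zero_of_right _ (Finset.sum_eq_zero fun Q _ => ?_)
    by_cases hHQ : H ∈ AddSubgroup.closure (coweights R P Q.1) ⊔
        scaledLattice b (simpleCoroots R Q.1 Set.univ)
    · rw [← Finset.mul_sum, ← Finset.mul_sum, sum_qpow_eq_zero hq hP hN (hge Q hHQ) hH, mul_zero,
        mul_zero]
    · refine Finset.sum_eq_zero fun n _ => ?_
      rw [mixCoeff, if_neg hHQ, zero_mul, mul_zero]

section Exponentials

variable {E J : Type*} [NormedAddCommGroup E] [NormedSpace ℝ E]

/-- Evaluation at a vector, as a complex linear form. -/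
def evalC (v : E) : (E →L[ℝ] ℂ) →L[ℂ] ℂ :=
  LinearMap.mkContinuous
    { toFun := fun l => l v
      map_add' := fun _ _ => rfl
      map_smul' := fun _ _ => rfl } ‖v‖ fun l => by
      rw [mul_comm]
      exact l.le_opNorm v

theorem norm_evalC_le (v : E) : ‖evalC v‖ ≤ ‖v‖ :=
  LinearMap.mkContinuous_norm_le _ (norm_nonneg _) _

theorem continuous_eval (v : E) : Continuous fun l : E →L[ℝ] ℂ => l v := (evalC v).continuous

/-- Termwise differentiation: the derivative of a term is $-\log q$ times the term times evaluation
at `p j`, which `hbound` controls; convergence itself is needed at one point only. -/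
theorem differentiableOn_tsum_cpow {q : ℕ} (hq : 1 < q) (a : J → ℂ) (p : J → E)
    {U : Set (E →L[ℝ] ℂ)} (hU : IsOpen U) (hU' : IsPreconnected U) {u : J → ℝ} (hu : Summable u)
    (hbound : ∀ j, ∀ l ∈ U, ‖a j * (q : ℂ) ^ (-(l (p j)))‖ * Real.log q * ‖p j‖ ≤ u j)
    {l₀ : E →L[ℝ] ℂ} (h₀ : l₀ ∈ U) (hs : Summable fun j => a j * (q : ℂ) ^ (-(l₀ (p j)))) :
    DifferentiableOn ℂ (fun l : E →L[ℝ] ℂ => ∑' j, a j * (q : ℂ) ^ (-(l (p j)))) U := by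
  have hq0 : (q : ℂ) ≠ 0 := by exact_mod_cast (by omega : q ≠ 0)
  have hlog : 0 < Real.log q := Real.log_pos (by exact_mod_cast hq)
  have hlogn : ‖Complex.log q‖ = Real.log q := by
    rw [← natCast_log, Complex.norm_real, Real.norm_of_nonneg hlog.le]
  have hderiv : ∀ j, ∀ l ∈ U, HasFDerivAt (fun l : E →L[ℝ] ℂ => a j * (q : ℂ) ^ (-(l (p j))))
      (a j • (((q : ℂ) ^ (-(l (p j))) * Complex.log q) • (-evalC (p j)))) l := by
    intro j l _
    have h1 : HasFDerivAt (fun l : E →L[ℝ] ℂ => -(l (p j))) (-evalC (p j)) l :=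
      (-evalC (p j)).hasFDerivAt
    exact (h1.const_cpow (c := (q : ℂ)) (Or.inl hq0)).const_mul _
  intro l hl
  refine (hasFDerivAt_tsum_of_isPreconnected hu hU hU' hderiv (fun j l hl => ?_) h₀ hs
    hl).differentiableAt.differentiableWithinAt
  rw [smul_smul, norm_smul, norm_neg, ← mul_assoc, norm_mul, hlogn]
  exact (mul_le_mul_of_nonneg_left (norm_evalC_le _) (by positivity)).trans (hbound j l hl)

end Exponentials

theorem continuous_extend (H : Y) : Continuous fun l : aC R M => extend R l H :=
  continuous_eval (projLower R M H)

variable (R M) in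
/-- A tube around the imaginary forms. -/
def tube (B P : Set ι) (δ : ℝ) : Set (aC R M) :=
  {l | ∀ i ∈ simpleRel R B P Set.univ, |(extend R l (cow R B i)).re| < δ}

theorem isOpen_tube (δ : ℝ) : IsOpen (tube R M B P δ) := by
  have e : tube R M B P δ = ⋂ i ∈ simpleRel R B P Set.univ,
      {l | |(extend R l (cow R B i)).re| < δ} := by
    ext l
    simp [tube]
  rw [e]
  refine isOpen_biInter_finset fun i _ => ?_
  have := continuous_extend (R := R) (M := M) (cow R B i)
  exact isOpen_lt (by fun_prop) continuous_const

theorem isPreconnected_tube (δ : ℝ) : IsPreconnected (tube R M B P δ) := by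
  refine Convex.isPreconnected fun l hl l' hl' s t hs ht hst i hi => ?_
  have h1 := abs_lt.1 (hl i hi)
  have h2 := abs_lt.1 (hl' i hi)
  have e : (extend R (s • l + t • l') (cow R B i)).re =
      s * (extend R l (cow R B i)).re + t * (extend R l' (cow R B i)).re := by
    have : extend R (s • l + t • l') (cow R B i) =
        (s : ℂ) * extend R l (cow R B i) + (t : ℂ) * extend R l' (cow R B i) := rfl
    rw [this]
    simp
  rw [e, abs_lt]
  rcases hs.eq_or_lt with rfl | hs'
  · have : t = 1 := by linarith
    subst this
    constructor <;> linarith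
  · constructor <;> nlinarith

variable (R q) in
/-- The function `c_P(φ, λ)`, as a sum of exponentials. -/
def cFun (B P : Set ι) (ξ : Y) (S : ι → ℤ → ℂ) (a : ι → ℂ) (l : aC R M) : ℂ :=
  ∑' H, cCoeff R B P ξ S a H * qpow R q l H

theorem IsMin.exists_tube (hq : 1 < q) (hB : IsMin R B) (hP : P ∈ parabolicsOfLevi R M)
    (h : B ⊆ P) {S : ι → ℤ → ℂ} {a : ι → ℂ} {C ε : ℝ} (hC : 0 < C) (hε : 0 < ε)
    (hA : ∀ H, ‖cCoeff R B P ξ S a H‖ ≤ C * Real.exp (-(ε * ‖H‖))) :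
    ∃ δ : ℝ, 0 < δ ∧
      (∀ l ∈ tube R M B P δ, HasSum (fun H => cCoeff R B P ξ S a H * qpow R q l H)
        (cFun R q B P ξ S a l)) ∧
      DifferentiableOn ℂ (cFun R q B P ξ S a) (tube R M B P δ) := by
  classical
  set I := simpleRel R B P Set.univ with hI
  have hq0 : (q : ℂ) ≠ 0 := by exact_mod_cast (by omega : q ≠ 0)
  have hqR : (0 : ℝ) < q := by positivity
  have hlog : 0 < Real.log q := Real.log_pos (by exact_mod_cast hq)
  obtain ⟨E, hE, hr⟩ := exists_abs_le I (fun i => R.root' i)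
  -- The width is chosen so that the growth of $q^{-\langle\lambda,H\rangle}$ on the tube uses at
  -- most half of the decay rate; a further quarter will absorb the factor $\|H\|$ of the
  -- derivative. The `+ 1` keeps the denominator positive when there are no simple roots.
  set δ : ℝ := ε / (2 * (Real.log q * (I.card * E) + 1)) with hδ
  have hδ0 : 0 < δ := by positivity
  have hδle : Real.log q * (δ * (I.card * E)) ≤ ε / 2 := by
    have h1 : δ * (2 * (Real.log q * (I.card * E) + 1)) = ε := by
      rw [hδ]
      field_simp
    nlinarith
  have hset : (minimalSimple R B \ levi R P) = (I : Set ι) := by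
    ext i
    rw [Finset.mem_coe, hI, mem_simpleRel_univ]
    rfl
  have hclos : AddSubgroup.closure (coweights R P Set.univ) =
      AddSubgroup.closure (cow R B '' (I : Set ι)) := by
    rw [hB.coweights_univ_eq hP.1 h, hset]
  have hdual : ∀ i ∈ I, ∀ j ∈ I, R.root' i (cow R B j) = if i = j then 1 else 0 := by
    intro i hi j _
    rw [hI, mem_simpleRel_univ] at hi
    exact (hB.cow_spec j).2 i hi.1
  have hzero : ∀ H, H ∉ AddSubgroup.closure (coweights R P Set.univ) →
      cCoeff R B P ξ S a H = 0 := fun H hH => by rw [cCoeff, if_neg hH]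
  -- the exponential factors
  have hpow : ∀ l ∈ tube R M B P δ, ∀ H ∈ AddSubgroup.closure (coweights R P Set.univ),
      ‖qpow R q l H‖ ≤ Real.exp (ε / 2 * ‖H‖) := by
    intro l hl H hH
    obtain ⟨hHM, hHs⟩ := mem_of_mem_closure_coweights hH
    rw [norm_qpow hq, Real.rpow_def_of_pos hqR, Real.exp_le_exp]
    have h1 : |(extend R l H).re| ≤ δ * (I.card * E) * ‖H‖ := by
      have e : (extend R l H).re = ∑ i ∈ I, R.root' i H * (extend R l (cow R B i)).re := by
        have e0 : extend R l H = extend R l (∑ i ∈ I, R.root' i H • cow R B i) :=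
          congrArg _ (hB.sum_cow_rel hHM hHs).symm
        rw [e0, map_sum, Complex.re_sum]
        refine Finset.sum_congr rfl fun i _ => ?_
        rw [map_smul, Complex.smul_re, smul_eq_mul]
      rw [e]
      refine (Finset.abs_sum_le_sum_abs _ _).trans ?_
      have : ∀ i ∈ I, |R.root' i H * (extend R l (cow R B i)).re| ≤ E * ‖H‖ * δ := by
        intro i hi
        rw [abs_mul]
        exact mul_le_mul (hr i hi H) (hl i hi).le (abs_nonneg _) (by positivity)
      refine (Finset.sum_le_sum this).trans (le_of_eq ?_)
      rw [Finset.sum_const, nsmul_eq_mul]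
      ring
    have h2 := neg_abs_le (extend R l H).re
    calc Real.log q * -(extend R l H).re ≤ Real.log q * (δ * (I.card * E) * ‖H‖) := by
          refine mul_le_mul_of_nonneg_left (by linarith) hlog.le
      _ = Real.log q * (δ * (I.card * E)) * ‖H‖ := by ring
      _ ≤ ε / 2 * ‖H‖ := by gcongr
  have hnorm : ∀ l ∈ tube R M B P δ, ∀ H ∈ AddSubgroup.closure (coweights R P Set.univ),
      ‖cCoeff R B P ξ S a H * qpow R q l H‖ ≤ C * Real.exp (-(ε / 2 * ‖H‖)) := by
    intro l hl H hH
    rw [norm_mul]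
    refine (mul_le_mul (hA H) (hpow l hl H hH) (norm_nonneg _) (by positivity)).trans (le_of_eq ?_)
    rw [mul_assoc, ← Real.exp_add]
    congr 2
    ring
  have hsumm : ∀ l ∈ tube R M B P δ,
      Summable fun H => cCoeff R B P ξ S a H * qpow R q l H := by
    intro l hl
    refine Summable.of_norm_bounded ((summable_lattice I (cow R B) (fun i => R.root' i) hdual
      (half_pos hε)).mul_left C) fun H => ?_
    rw [← hclos]
    split_ifs with hH
    · exact hnorm l hl H hH
    · rw [hzero H hH, zero_mul, norm_zero, mul_zero]
  refine ⟨δ, hδ0, fun l hl => (hsumm l hl).hasSum, ?_⟩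
  -- holomorphy
  obtain ⟨D, hD, hproj⟩ : ∃ D : ℝ, 0 < D ∧ ∀ H : Y, ‖projLower R M H‖ ≤ D * ‖H‖ := by
    refine ⟨‖LinearMap.toContinuousLinearMap (projLower R M)‖ + 1, by positivity, fun H => ?_⟩
    have h1 := (LinearMap.toContinuousLinearMap (projLower R M)).le_opNorm H
    have h2 := norm_nonneg H
    refine h1.trans ?_
    linarith
  have hbound : ∀ H, ∀ l ∈ tube R M B P δ,
      ‖cCoeff R B P ξ S a H * (q : ℂ) ^ (-(l (projLower R M H)))‖ * Real.log q *
        ‖projLower R M H‖ ≤ (C * Real.log q * D * (4 / ε)) *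
      if H ∈ AddSubgroup.closure (cow R B '' (I : Set ι)) then Real.exp (-(ε / 4 * ‖H‖)) else 0 := by
    intro H l hl
    rw [← hclos]
    split_ifs with hH
    · have h1 := hnorm l hl H hH
      have h2 := hproj H
      have h3 : ‖H‖ ≤ 4 / ε * Real.exp (ε / 4 * ‖H‖) := by
        have := Real.add_one_le_exp (ε / 4 * ‖H‖)
        have h4 : ‖H‖ = 4 / ε * (ε / 4 * ‖H‖) := by field_simp
        calc ‖H‖ = 4 / ε * (ε / 4 * ‖H‖) := h4
          _ ≤ 4 / ε * Real.exp (ε / 4 * ‖H‖) :=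
            mul_le_mul_of_nonneg_left (by linarith) (by positivity)
      calc ‖cCoeff R B P ξ S a H * qpow R q l H‖ * Real.log q * ‖projLower R M H‖
          ≤ C * Real.exp (-(ε / 2 * ‖H‖)) * Real.log q * (D * (4 / ε * Real.exp (ε / 4 * ‖H‖))) := by
            refine mul_le_mul (mul_le_mul_of_nonneg_right h1 hlog.le) (h2.trans ?_) (norm_nonneg _)
              (by positivity)
            exact mul_le_mul_of_nonneg_left h3 hD.le
        _ = C * Real.log q * D * (4 / ε) *
            (Real.exp (-(ε / 2 * ‖H‖)) * Real.exp (ε / 4 * ‖H‖)) := by ring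
        _ = C * Real.log q * D * (4 / ε) * Real.exp (-(ε / 4 * ‖H‖)) := by
            rw [← Real.exp_add]
            congr 2
            ring
    · rw [hzero H hH, zero_mul, norm_zero, zero_mul, zero_mul, mul_zero]
  have h0 : (0 : aC R M) ∈ tube R M B P δ := by
    intro i _
    rw [extend_zero, Complex.zero_re, abs_zero]
    exact hδ0
  exact differentiableOn_tsum_cpow hq (cCoeff R B P ξ S a) (fun H => projLower R M H)
    (isOpen_tube δ) (isPreconnected_tube δ)
    ((summable_lattice I (cow R B) (fun i => R.root' i) hdual (by positivity : 0 < ε / 4)).mul_left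
      (C * Real.log q * D * (4 / ε))) hbound h0 (hsumm 0 h0)

end CFunction

end Cofamily

end

noncomputable section

namespace Cofamily

set_option linter.unusedSectionVars false

open Complex

/-! ### Lattice translates, projections and the continuation of $c_P$. -/

section Translates

variable {ι X Y : Type*} [AddCommGroup X] [Module ℝ X] [NormedAddCommGroup Y] [NormedSpace ℝ Y]
  [FiniteDimensional ℝ Y] [Finite ι] {R : RootPairing ι ℝ X Y} {M : Set ι} {q : ℕ}
  [R.IsCrystallographic] {B P Q : Set ι} {b b' : ℕ} {ξ : Y} {Ω : Set (aC R M)}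

theorem re_extend_imaginary {l : aC R M} (hl : l ∈ imaginary R M) (H : Y) :
    (extend R l H).re = 0 := hl _

theorem re_extend_add_lat {n : aC R M} (hn : n ∈ lat R q M) (l : aC R M) (H : Y) :
    (extend R (l + n) H).re = (extend R l H).re := by
  have hn0 : (extend R n H).re = 0 := by
    refine AddSubgroup.closure_induction (p := fun n _ => (extend R n H).re = 0) ?_ ?_ ?_ ?_ hn
    · rintro _ ⟨i, rfl⟩
      have e : extend R (period q • toC R M (R.root i)) H =
          period q * ((R.toLinearMap (R.root i) (projLower R M H : Y) : ℝ) : ℂ) := rfl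
      have e' : period q = ((2 * Real.pi / Real.log q : ℝ) : ℂ) * I := by
        rw [period]
        push_cast
        ring
      rw [e, e', mul_right_comm, ← ofReal_mul, re_ofReal_mul, I_re, mul_zero]
    · rw [extend_zero, zero_re]
    · intro x y _ _ hx hy
      rw [extend_add, add_re, hx, hy, add_zero]
    · intro x _ hx
      rw [extend_neg, neg_re, hx, neg_zero]
  rw [extend_add, add_re, hn0, add_zero]

theorem add_mem_imaginary {n l : aC R M} (hn : n ∈ lat R q M) (hl : l ∈ imaginary R M) :
    l + n ∈ imaginary R M := by
  intro H
  have h := re_extend_add_lat hn l H.1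
  rwa [re_extend_imaginary hl, extend_of_mem R _ H.2] at h

theorem projC_mem_imaginary {l : aC R M} (hl : l ∈ imaginary R M) (Q : Set ι) :
    projC R Q l ∈ imaginary R M := fun _ => re_extend_imaginary hl _

theorem continuous_comp_right {E : Type*} [NormedAddCommGroup E] [NormedSpace ℝ E]
    (K : E →L[ℝ] E) : Continuous fun l : E →L[ℝ] ℂ => l.comp K :=
  continuous_id.clm_comp continuous_const

theorem continuous_projC (Q : Set ι) : Continuous fun l : aC R M => projC R Q l :=
  continuous_comp_right ((LinearMap.toContinuousLinearMap (projLower R M)).comp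
    ((LinearMap.toContinuousLinearMap (projUpper R (levi R Q))).comp (aReal R M).subtypeL))

theorem continuous_add_form {E : Type*} [NormedAddCommGroup E] [NormedSpace ℝ E]
    (n : E →L[ℝ] ℂ) : Continuous fun l : E →L[ℝ] ℂ => l + n :=
  continuous_id.add continuous_const

theorem IsDualTriplet.exists_translate {N : Finset (aC R M)} (hN : IsDualTriplet R q M N b b')
    (hP : P ∈ parabolicsOfLevi R M) {n : aC R M} (hn : n ∈ lat R q M) :
    ∃ n₀ ∈ N, ∃ y ∈ lat R q M, n = n₀ + b' • y := by
  rw [← periodLattice_eq q hP] at hn ⊢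
  obtain ⟨n₀, ⟨h, y, hy, e⟩, -⟩ := hN.representatives P hP n hn
  exact ⟨n₀, h, y, hy, by rw [← e, add_sub_cancel]⟩

theorem extend_nsmul (k : ℕ) (l : aC R M) (H : Y) : extend R (k • l) H = k * extend R l H := by
  rw [← nsmul_eq_mul]
  rfl

theorem smul_mem_of_mem_scaledLattice {S : Set Y} (hb : 1 ≤ b) {y : Y}
    (hy : y ∈ scaledLattice b S) : (b : ℝ) • y ∈ AddSubgroup.closure S := by
  have hb0 : (b : ℝ) ≠ 0 := by exact_mod_cast (by omega : b ≠ 0)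
  refine AddSubgroup.closure_induction (p := fun y _ => (b : ℝ) • y ∈ AddSubgroup.closure S)
    ?_ ?_ ?_ ?_ hy
  · rintro _ ⟨v, hv, rfl⟩
    change (b : ℝ) • (b : ℝ)⁻¹ • v ∈ _
    rw [smul_inv_smul₀ hb0]
    exact AddSubgroup.subset_closure hv
  · rw [smul_zero]
    exact zero_mem _
  · intro x y _ _ hx hy
    rw [smul_add]
    exact add_mem hx hy
  · intro x _ hx
    rw [smul_neg]
    exact neg_mem hx

/-- The coordinate of $(b'y)^Q$ at $\varpi_i^\vee$ is the value of $y$ at $b'$ times the projected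
coweight, and the second inclusion of a dual triplet puts that vector in $\mathbb
Z(\hat\Delta_P^\vee)$. -/
theorem IsDualTriplet.projC_mem_lat {N : Finset (aC R M)} (hN : IsDualTriplet R q M N b b')
    (hP : P ∈ parabolicsOfLevi R M) (hQ : Q ∈ parabolicsContaining R P) {y : aC R M}
    (hy : y ∈ lat R q M) : projC R Q (b' • y) ∈ lat R q M := by
  obtain ⟨B, hB, h⟩ := exists_isMin_subset R hP.1
  have hcow : ∀ i, i ∉ levi R P → cow R B i ∈ aReal R M := fun i hi =>
    hP.2 ▸ hB.cow_mem_aReal hP.1 h hi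
  have key : ∀ i, ∃ z : ℤ, i ∈ minimalSimple R B \ levi R P →
      extend R (projC R Q (b' • y)) (cow R B i) = period q * z := by
    intro i
    by_cases hi : i ∈ minimalSimple R B \ levi R P
    · rw [extend_projC R _ (hcow i hi.2)]
      change ∃ z : ℤ, _ → extend R (b' • y) (cowRel R B Q i) = _
      have hw : cowRel R B Q i ∈ AddSubgroup.closure (coweights R P Q) := by
        by_cases hiQ : i ∈ levi R Q
        · refine AddSubgroup.subset_closure ?_
          rw [hB.coweights_eq hP.1 hQ.1 h hQ.2]
          exact Set.mem_image_of_mem _ ⟨hi.1, hiQ, hi.2⟩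
        · rw [hB.cowRel_eq_zero hQ.1 (h.trans hQ.2) hiQ]
          exact zero_mem _
      have hw1 := hN.le_lattice P hP Q hQ (AddSubgroup.mem_sup_left hw)
      have hw2 := smul_mem_of_mem_scaledLattice hN.one_le_b' hw1
      obtain ⟨z, hz⟩ := extend_lat_int hy (hP.2 ▸ (mem_of_mem_closure_coweights hw2).1)
        (hB.root'_coweight_int hP.1 h hw2)
      refine ⟨z, fun _ => ?_⟩
      rw [← hz, extend_nsmul, map_smul, real_smul, ofReal_natCast]
    · exact ⟨0, fun h => absurd h hi⟩
  choose z hz using key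
  refine (hB.mem_lat hP h (fun H hH => ?_) hz).2
  rw [extend_projC R _ (aReal_anti R (Set.subset_univ _) hH),
    projUpper_of_mem_aReal R (aReal_anti R (Set.subset_univ _) hH), map_zero]

theorem projC_add (Q : Set ι) (l l' : aC R M) : projC R Q (l + l') = projC R Q l + projC R Q l' :=
  rfl

/-- The projection of $b'\Lambda$ stays in $\Lambda$, so finitely many conditions, one per
representative, control all lattice translates. This keeps the final domain open. -/
theorem IsDualTriplet.projC_add_mem {N : Finset (aC R M)} (hN : IsDualTriplet R q M N b b')
    (hP : P ∈ parabolicsOfLevi R M) (hQ : Q ∈ parabolicsContaining R P)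
    (hΩ : ∀ n ∈ lat R q M, ∀ l ∈ Ω, l + n ∈ Ω) {l : aC R M}
    (h : ∀ n ∈ N, projC R Q (l + n) ∈ Ω) {n : aC R M} (hn : n ∈ lat R q M) :
    projC R Q (l + n) ∈ Ω := by
  obtain ⟨n₀, hn₀, y, hy, rfl⟩ := hN.exists_translate hP hn
  have e : projC R Q (l + (n₀ + b' • y)) = projC R Q (l + n₀) + projC R Q (b' • y) := by
    rw [← add_assoc, projC_add]
  rw [e]
  exact hΩ _ (hN.projC_mem_lat hP hQ hy) _ (h n₀ hn₀)

theorem exists_mem_parabolicsOfLevi (hM : IsLevi R M) (hQ : Q ∈ parabolicsContaining R M) :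
    M ⊆ levi R Q ∧ ∃ P ∈ parabolicsOfLevi R M, Q ∈ parabolicsContaining R P := by
  obtain ⟨P₀, hP₀, e⟩ := hM
  have hMQ : M ⊆ levi R Q := by
    intro i hi
    refine ⟨hQ.2 hi, ?_⟩
    obtain ⟨j, hj⟩ := exists_neg R i
    refine ⟨j, hQ.2 ?_, hj⟩
    rw [← e] at hi ⊢
    exact neg_mem_levi R hi hj
  refine ⟨hMQ, refine (levi R Q) P₀ Q, ?_, hQ.1, refine_subset ⟨hQ.1, rfl⟩⟩
  have := refine_mem (L := levi R Q) ⟨hQ.1, rfl⟩ hP₀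
  rwa [e, Set.inter_eq_right.2 hMQ] at this

/-- Holomorphic continuation of the functions `c_P(φ, λ)`. -/
theorem exists_cFunction (hq : 1 < q) (hP : P ∈ parabolicsOfLevi R M) {φ : aC R M → ℂ}
    (hφ : IsProductForm R q P Ω φ) (ξ : Y) :
    ∃ (T : Set (aC R M)) (C : aC R M → ℂ), IsOpen T ∧ imaginary R M ⊆ T ∧
      DifferentiableOn ℂ C T ∧
      (∀ l ∈ T, (∀ n ∈ lat R q M, ∀ Q ∈ parabolicsContaining R P, projC R Q (l + n) ∈ Ω) →
        ∀ (N : Finset (aC R M)) (b b' : ℕ), IsDualTriplet R q M N b b' →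
          CRegular R q N b P l → C l = cTriplet R q N b ξ P φ l) ∧
      ∀ l ∈ T, l ∈ Ω → ∀ n ∈ lat R q M, projC R Set.univ (l + n) ∈ Ω →
        φ (projC R Set.univ (l + n)) = φ l := by
  classical
  obtain ⟨B, hB, h⟩ := exists_isMin_subset R hP.1
  obtain ⟨r, hr, f, hf, hprod⟩ := hφ
  set I := simpleRel R B P Set.univ with hI
  have hqR : (1 : ℝ) < q := by exact_mod_cast hq
  have hρ : (1 : ℝ) < (q : ℝ) ^ r := Real.one_lt_rpow hqR hr
  have hwts : coweights R P Set.univ = cow R B '' (I : Set ι) := by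
    rw [hB.coweights_univ_eq hP.1 h]
    congr 1
    ext i
    rw [Finset.mem_coe, hI, mem_simpleRel_univ]
    rfl
  have hmem : ∀ i ∈ I, cow R B i ∈ coweights R P Set.univ := fun i hi =>
    hwts ▸ Set.mem_image_of_mem _ hi
  have hcow : ∀ i ∈ I, cow R B i ∈ aReal R M := fun i hi =>
    coweights_mem_aReal hP _ (hmem i hi)
  have hinj : Set.InjOn (cow R B) (I : Set ι) := by
    intro i hi j hj e
    by_contra hij
    have hi' := ((mem_simpleRel_univ R).1 hi).1
    have h1 := hB.root'_cow_self hi'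
    rw [e, hB.root'_cow_ne hi' hij] at h1
    exact zero_ne_one h1
  have hprod' : ∀ l ∈ Ω, (∀ i ∈ I, -r < (extend R l (cow R B i)).re) →
      φ l = ∏ i ∈ I, f (cow R B i) (qpow R q l (cow R B i)) := by
    intro l hl hlr
    rw [hprod l hl, hwts, finprod_mem_image hinj, finprod_mem_coe_finset]
    rintro _ hw
    rw [hwts] at hw
    obtain ⟨i, hi, rfl⟩ := hw
    exact hlr i hi
  have hcoeff : ∀ i, ∃ S : ℤ → ℂ, i ∈ I → (∃ (C η : ℝ) (K : ℕ), 0 < C ∧ 0 < η ∧ η < 1 ∧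
      (∀ k : ℤ, k < -K → S k = 0) ∧ (∀ k, ‖S k - f (cow R B i) 1‖ ≤ C * η ^ k) ∧
        ∀ k, ‖S k‖ ≤ C) ∧ ∀ z : ℂ, z ≠ 0 → ‖z‖ < (q : ℝ) ^ r →
      Summable (fun k : ℤ => ‖(S k - S (k - 1)) * z ^ k‖) ∧
        HasSum (fun k : ℤ => (S k - S (k - 1)) * z ^ k) (f (cow R B i) z) := by
    intro i
    by_cases hi : i ∈ I
    · obtain ⟨S, C, η, K, h1, h2, h3, h4, h5, h6, h7⟩ :=
        exists_coeff hρ (hf _ (hmem i hi)).1 (hf _ (hmem i hi)).2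
      exact ⟨S, fun _ => ⟨⟨C, η, K, h1, h2, h3, h4, h5, h6⟩, h7⟩⟩
    · exact ⟨0, fun h => absurd h hi⟩
  choose S hS using hcoeff
  obtain ⟨C, ε, hC, hε, hA⟩ := hB.exists_cCoeff_bound hP.1 h ξ (fun i hi => (hS i hi).1)
  obtain ⟨δ, hδ, hsum, hdiff⟩ := hB.exists_tube hq hP h hC hε hA
  -- The tube gives convergence, and the other conditions keep all Laurent variables in the disc
  -- $|z|<q^r$. Both restrict only real parts, so they hold at imaginary forms and persist under
  -- lattice translates.
  set T : Set (aC R M) := tube R M B P δ ∩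
    ⋂ Q ∈ parabolicsContaining R P, ⋂ i ∈ I, {l | -r < (extend R l (cowRel R B Q i)).re} with hT
  have hTr : ∀ l ∈ T, ∀ Q ∈ parabolicsContaining R P, ∀ i ∈ I,
      -r < (extend R l (cowRel R B Q i)).re := by
    intro l hl Q hQ i hi
    have := hl.2
    simp only [Set.mem_iInter] at this
    exact this Q hQ i hi
  have huniv : Set.univ ∈ parabolicsContaining R P := ⟨isParabolic_univ R, Set.subset_univ _⟩
  refine ⟨T, cFun R q B P ξ S fun i => f (cow R B i) 1, ?_, ?_, ?_, ?_, ?_⟩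
  · refine (isOpen_tube δ).inter (Set.Finite.isOpen_biInter (Set.toFinite _) fun Q _ =>
      isOpen_biInter_finset fun i _ => ?_)
    exact isOpen_lt continuous_const (continuous_re.comp (continuous_extend _))
  · intro l hl
    refine ⟨fun i _ => ?_, ?_⟩
    · rw [re_extend_imaginary hl, abs_zero]
      exact hδ
    · simp only [Set.mem_iInter]
      intro Q _ i _
      change -r < (extend R l (cowRel R B Q i)).re
      rw [re_extend_imaginary hl]
      linarith
  · exact hdiff.mono Set.inter_subset_left
  · intro l hl hΩ N b b' hN hreg
    refine RegSum.unique (fun x y => qpow_add hq l x y) (RegSum.of_hasSum (hsum l hl.1)) ?_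
    refine hB.regSum_cTriplet hq hP h hN (f := fun i => f (cow R B i)) (ρ := (q : ℝ) ^ r)
      (fun i hi => (hS i hi).2) hreg ?_ ?_
    · intro n hn Q hQ
      have e : ∀ i ∈ I, extend R (projC R Q (l + n)) (cow R B i) =
          extend R (l + n) (cowRel R B Q i) := fun i hi => extend_projC R _ (hcow i hi)
      rw [hprod' _ (hΩ n (hN.subset_lat hP hn) Q hQ)]
      · refine Finset.prod_congr rfl fun i hi => ?_
        rw [qpow, e i hi, qpow]
      · intro i hi
        rw [e i hi, re_extend_add_lat (hN.subset_lat hP hn)]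
        exact hTr l hl Q hQ i hi
    · intro n hn Q hQ i hi
      rw [norm_qpow hq, re_extend_add_lat (hN.subset_lat hP hn)]
      refine Real.rpow_lt_rpow_of_exponent_lt hqR ?_
      have := hTr l hl Q hQ i hi
      linarith
  -- The product form sees only the values at coweights, which neither the projection along the
  -- center nor, after exponentiation, a lattice translation changes.
  · intro l hl hlΩ n hn hnΩ
    have hlr : ∀ i ∈ I, -r < (extend R l (cow R B i)).re := by
      intro i hi
      have := hTr l hl _ huniv i hi
      rwa [hB.cowRel_univ] at this
    have e : ∀ i ∈ I, extend R (projC R Set.univ (l + n)) (cow R B i) =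
        extend R (l + n) (cow R B i) := by
      intro i hi
      rw [extend_projC R _ (hcow i hi)]
      change extend R (l + n) (cowRel R B Set.univ i) = _
      rw [hB.cowRel_univ]
    rw [hprod' _ hnΩ, hprod' _ hlΩ hlr]
    · refine Finset.prod_congr rfl fun i hi => ?_
      rw [qpow, e i hi, ← qpow, qpow_add_left hq, qpow_lat hq hn (hcow i hi)
        (hB.root'_coweight_int hP.1 h (AddSubgroup.subset_closure (hmem i hi))), mul_one]
    · intro i hi
      rw [e i hi, re_extend_add_lat hn]
      exact hlr i hi

end Translates

end Cofamily

end

noncomputable section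

namespace Cofamily

set_option linter.unusedSectionVars false

open Complex Filter Topology

/-! ### Approaching a point along a generic line. -/

section Continuation

variable {E : Type*} [NormedAddCommGroup E] [NormedSpace ℝ E]

theorem continuous_line (l d : E →L[ℝ] ℂ) : Continuous fun t : ℝ => l + (t : ℂ) • d :=
  continuous_const.add ((continuous_ofReal).smul continuous_const)

theorem continuous_cpow_eval {q : ℕ} (hq : 1 < q) (v : E) :
    Continuous fun l : E →L[ℝ] ℂ => (q : ℂ) ^ (-(l v)) :=
  (continuous_eval v).neg.const_cpow (Or.inl (by exact_mod_cast (by omega : q ≠ 0)))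

theorem continuousAt_of_differentiableOn {f : (E →L[ℝ] ℂ) → ℂ} {U : Set (E →L[ℝ] ℂ)}
    (hU : IsOpen U) (hf : DifferentiableOn ℂ f U) {l : E →L[ℝ] ℂ} (hl : l ∈ U) :
    ContinuousAt f l :=
  hf.continuousOn.continuousAt (hU.mem_nhds hl)

theorem differentiableOn_sum {κ : Type*} [Fintype κ] {f : κ → (E →L[ℝ] ℂ) → ℂ}
    {U : Set (E →L[ℝ] ℂ)} (hf : ∀ k, DifferentiableOn ℂ (f k) U) :
    DifferentiableOn ℂ (fun l => ∑ k, f k l) U :=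
  DifferentiableOn.fun_sum fun k _ => hf k

theorem line_zero (l d : E →L[ℝ] ℂ) : l + ((0 : ℝ) : ℂ) • d = l := by
  ext v
  simp

theorem tendsto_line {f : (E →L[ℝ] ℂ) → ℂ} {l : E →L[ℝ] ℂ} (hf : ContinuousAt f l)
    (d : E →L[ℝ] ℂ) : Tendsto (fun t : ℝ => f (l + (t : ℂ) • d)) (𝓝[≠] 0) (𝓝 (f l)) := by
  have h0 := line_zero l d
  have h1 : ContinuousAt f (l + ((0 : ℝ) : ℂ) • d) := h0.symm ▸ hf
  have h2 : ContinuousAt (fun t : ℝ => f (l + (t : ℂ) • d)) 0 :=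
    ContinuousAt.comp (f := fun t : ℝ => l + (t : ℂ) • d) h1 (continuous_line l d).continuousAt
  have h3 := h2.tendsto.mono_left (nhdsWithin_le_nhds (s := {0}ᶜ))
  rwa [h0] at h3

theorem eventually_line_mem {l : E →L[ℝ] ℂ} {U : Set (E →L[ℝ] ℂ)} (hU : IsOpen U) (hl : l ∈ U)
    (d : E →L[ℝ] ℂ) : ∀ᶠ t : ℝ in 𝓝[≠] 0, l + (t : ℂ) • d ∈ U := by
  have h0 := line_zero l d
  have h1 : U ∈ 𝓝 (l + ((0 : ℝ) : ℂ) • d) := h0.symm ▸ hU.mem_nhds hl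
  exact nhdsWithin_le_nhds ((continuous_line l d).continuousAt h1)

/-- A real form that is nonzero at every vector of a finite set exists. Along it each real part is a
nonconstant affine function of $t$ and vanishes at most once. -/
theorem exists_direction {S : Set E} (hS : S.Finite) (h : ∀ v ∈ S, v ≠ 0) (l : E →L[ℝ] ℂ) :
    ∃ d : E →L[ℝ] ℂ, ∀ᶠ t : ℝ in 𝓝[≠] 0, ∀ v ∈ S, ((l + (t : ℂ) • d) v).re ≠ 0 := by
  have hfin : Finite S := hS
  obtain ⟨d, hd⟩ : ∃ d : E →L[ℝ] ℂ, ∀ v ∈ S, (d v).re ≠ 0 := by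
    have hex : ∀ v ∈ S, ∃ g : E →L[ℝ] ℝ, g v ≠ 0 := fun v hv => by
      obtain ⟨g, -, hg⟩ := exists_dual_vector ℝ v (norm_ne_zero_iff.2 (h v hv))
      exact ⟨g, by rw [hg]; simpa using h v hv⟩
    obtain ⟨g, hg⟩ := Module.Dual.exists_forall_ne_zero_of_forall_exists (K := ℝ)
      (M := E →L[ℝ] ℝ) (fun v : S => (LinearMap.applyₗ (v : E)).comp
        (ContinuousLinearMap.coeLM ℝ)) fun v => hex v.1 v.2
    refine ⟨ofRealCLM.comp g, fun v hv => ?_⟩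
    change ((g v : ℝ) : ℂ).re ≠ 0
    rw [ofReal_re]
    exact hg ⟨v, hv⟩
  refine ⟨d, hS.eventually_all.2 fun v hv => ?_⟩
  have h1 : ∀ᶠ t : ℝ in 𝓝[≠] 0, t ≠ -(l v).re / (d v).re :=
    nhdsNE_le_cofinite _ (Set.finite_singleton _).compl_mem_cofinite
  filter_upwards [h1] with t ht e
  refine ht ?_
  have e' : (l v).re + t * (d v).re = 0 := by
    have : ((l + (t : ℂ) • d) v).re = (l v).re + t * (d v).re := by simp
    rw [← this, e]
  rw [eq_div_iff (hd v hv)]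
  linarith

end Continuation

/-! ### The identity at points where no denominator vanishes. -/

section Identity

variable {ι X Y : Type*} [AddCommGroup X] [Module ℝ X] [NormedAddCommGroup Y] [NormedSpace ℝ Y]
  [FiniteDimensional ℝ Y] [Finite ι] {R : RootPairing ι ℝ X Y} {M : Set ι} {q : ℕ}
  [R.IsCrystallographic] {B P Q : Set ι} {b b' : ℕ} {ξ : Y} {Ω : Set (aC R M)}

theorem qpow_ne_one_of_re_ne_zero (hq : 1 < q) {l : aC R M} {H : Y}
    (h : (extend R l H).re ≠ 0) : qpow R q l H ≠ 1 := by
  intro e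
  have h1 := norm_qpow hq l H
  have hqR : (1 : ℝ) < q := by exact_mod_cast hq
  rw [e, norm_one] at h1
  have h2 := congrArg Real.log h1
  rw [Real.log_one, Real.log_rpow (by linarith), eq_comm, neg_mul, neg_eq_zero] at h2
  exact (mul_ne_zero h (Real.log_pos hqR).ne') h2

theorem qpow_add_lat_eq (hq : 1 < q) (hP : P ∈ parabolicsOfLevi R M) {n : aC R M}
    (hn : n ∈ lat R q M) (l : aC R M) {w : Y} (hw : w ∈ coweights R P Set.univ) :
    qpow R q (l + n) w = qpow R q l w := by
  obtain ⟨B, hB, h⟩ := exists_isMin_subset R hP.1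
  rw [qpow_add_left hq, qpow_lat hq hn (coweights_mem_aReal hP _ hw)
    (hB.root'_coweight_int hP.1 h (AddSubgroup.subset_closure hw)), mul_one]

theorem varthetaHat_add_lat (hq : 1 < q) (hP : P ∈ parabolicsOfLevi R M) {n : aC R M}
    (hn : n ∈ lat R q M) (l : aC R M) :
    varthetaHat R q P Set.univ (l + n) = varthetaHat R q P Set.univ l :=
  finprod_mem_congr rfl fun w hw => by rw [qpow_add_lat_eq hq hP hn l hw]

theorem continuousAt_varthetaHat (hq : 1 < q) (hP : IsParabolic R P) {l : aC R M}
    (h : ∀ w ∈ coweights R P Set.univ, qpow R q l w ≠ 1) :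
    ContinuousAt (fun l => varthetaHat R q P Set.univ l) l := by
  obtain ⟨B, hB, hBP⟩ := exists_isMin_subset R hP
  have e : (fun l : aC R M => varthetaHat R q P Set.univ l) = fun l =>
      ∏ i ∈ simpleRel R B P Set.univ, 1 / (1 - qpow R q l (cowRel R B Set.univ i)) :=
    funext fun l => hB.varthetaHat_eq hP (isParabolic_univ R) hBP (Set.subset_univ _) l
  rw [e]
  refine tendsto_finsetProd _ fun i hi => ?_
  have hc : ContinuousAt (fun l : aC R M => qpow R q l (cowRel R B Set.univ i)) l :=
    (continuous_cpow_eval hq _).continuousAt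
  refine ContinuousAt.div continuousAt_const (continuousAt_const.sub hc) (sub_ne_zero.2 ?_)
  refine (h _ ?_).symm
  rw [hB.coweights_eq hP (isParabolic_univ R) hBP (Set.subset_univ _), ← coe_simpleRel]
  exact Set.mem_image_of_mem _ hi

theorem coweights_ne_zero {w : Y} (hw : w ∈ coweights R P Q) : w ≠ 0 := by
  rintro rfl
  obtain ⟨-, α, -, h, -⟩ := hw
  rw [map_zero] at h
  exact zero_ne_one h

theorem simpleCoroots_ne_zero (hQ : IsParabolic R Q) {v : Y}
    (hv : v ∈ simpleCoroots R Q Set.univ) : v ≠ 0 := by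
  obtain ⟨B, hB, h⟩ := exists_isMin_subset R hQ
  rw [hB.simpleCoroots_univ_eq hQ h] at hv
  obtain ⟨i, hi, rfl⟩ := hv
  intro e
  have h1 := hB.wt_cor hQ h hi.1 hi.2 i
  rw [e, map_zero, hB.wt_coroot_self hi.1] at h1
  exact zero_ne_one h1

theorem simpleCoroots_mem_aReal (hM : M ⊆ levi R Q) {v : Y}
    (hv : v ∈ simpleCoroots R Q Set.univ) : v ∈ aReal R M := by
  obtain ⟨i, -, rfl⟩ := hv
  exact aReal_anti R hM (sub_projUpper_mem R _ _)

/-- For each $\nu$ the sum over `P` leaves only the terms with $R=G$. These do not depend on $\nu$,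
by periodicity of $\hat\vartheta_P^G$ and by `hinv`, so the average over $\mathfrak N$ disappears.
-/
theorem sum_cTriplet (hq : 1 < q) (hM : IsLevi R M) {φ : parabolicsOfLevi R M → aC R M → ℂ}
    (hφ : IsPeriodicCofamily R q Ω φ) {N : Finset (aC R M)} (hN : IsDualTriplet R q M N b b')
    (hξ : ∀ Q ∈ parabolicsContaining R M, Q ≠ Set.univ →
      projRel R Q Set.univ ((b : ℝ) • ξ) ∉ AddSubgroup.closure (simpleCoroots R Q Set.univ))
    {l : aC R M}
    (hΩ : ∀ n ∈ lat R q M, ∀ Q ∈ parabolicsContaining R M, projC R Q (l + n) ∈ Ω)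
    (hreg : ∀ n ∈ lat R q M, ∀ Q ∈ parabolicsContaining R M, ∀ v ∈ simpleCoroots R Q Set.univ,
      qpow R q ((b : ℂ)⁻¹ • (l + n)) v ≠ 1)
    (hinv : ∀ P, ∀ n ∈ lat R q M, φ P (projC R Set.univ (l + n)) = φ P l) :
    ∑ᶠ P : parabolicsOfLevi R M, cTriplet R q N b ξ P.1 (φ P) l =
      ∑ᶠ P : parabolicsOfLevi R M, varthetaHat R q P.1 Set.univ l * φ P l := by
  have := Fintype.ofFinite (parabolicsOfLevi R M)
  obtain ⟨P₀, hP₀⟩ := hM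
  have hcard := hN.card_ne_zero hP₀
  simp only [cTriplet]
  rw [finsum_eq_sum_of_fintype, ← Finset.mul_sum, Finset.sum_comm]
  have key : ∀ n ∈ N, ∑ P : parabolicsOfLevi R M, ∑ᶠ Q ∈ parabolicsContaining R P.1,
      (-1) ^ Module.finrank ℝ (aRel R Q Set.univ) * varthetaHat R q P.1 Q (l + n) *
        φ P (projC R Q (l + n)) *
        vartheta R q Q Set.univ ((b : ℝ) • ξ) ((b : ℂ)⁻¹ • (l + n)) =
      ∑ᶠ P : parabolicsOfLevi R M, varthetaHat R q P.1 Set.univ l * φ P l := by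
    intro n hn
    have hn' := hN.subset_lat hP₀ hn
    rw [← finsum_eq_sum_of_fintype, sum_contribution hq hN.one_le_b hξ hφ.gluing (hΩ n hn')
      (hreg n hn')]
    refine finsum_congr fun P => ?_
    rw [varthetaHat_add_lat hq P.2 hn', hinv P n hn']
  rw [Finset.sum_congr rfl key, Finset.sum_const, nsmul_eq_mul, ← mul_assoc,
    one_div_mul_cancel hcard, one_mul]

end Identity

end Cofamily

end

noncomputable section

namespace Cofamily

set_option linter.unusedSectionVars false

open Complex Filter Topology

/-! ### Passage to the limit. -/

section Formula

variable {ι X Y : Type*} [AddCommGroup X] [Module ℝ X] [NormedAddCommGroup Y] [NormedSpace ℝ Y]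
  [FiniteDimensional ℝ Y] [Finite ι] {R : RootPairing ι ℝ X Y} {M : Set ι} {q : ℕ}
  [R.IsCrystallographic] {b b' : ℕ} {ξ : Y} {Ω U : Set (aC R M)}

/-- All denominators come from finitely many nonzero vectors of $a_M$, so one direction avoids them
simultaneously. -/
theorem IsLevi.finite_vectors (hM : IsLevi R M) : ∃ S : Set (aReal R M), S.Finite ∧
    (∀ v ∈ S, v ≠ 0) ∧
    (∀ P ∈ parabolicsOfLevi R M, ∀ Q ∈ parabolicsContaining R P, ∀ w ∈ coweights R P Q,
      ∃ v ∈ S, (v : Y) = w) ∧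
    ∀ Q ∈ parabolicsContaining R M, ∀ w ∈ simpleCoroots R Q Set.univ, ∃ v ∈ S, (v : Y) = w := by
  set S₁ : Set Y := ⋃ P ∈ parabolicsOfLevi R M, ⋃ Q ∈ parabolicsContaining R P, coweights R P Q
    with hS₁
  set S₂ : Set Y := ⋃ Q ∈ parabolicsContaining R M, simpleCoroots R Q Set.univ with hS₂
  have hmem₁ : ∀ {w}, w ∈ S₁ ↔ ∃ P ∈ parabolicsOfLevi R M, ∃ Q ∈ parabolicsContaining R P,
      w ∈ coweights R P Q := by
    intro w
    simp only [hS₁, Set.mem_iUnion, exists_prop]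
  have hmem₂ : ∀ {w}, w ∈ S₂ ↔ ∃ Q ∈ parabolicsContaining R M,
      w ∈ simpleCoroots R Q Set.univ := by
    intro w
    simp only [hS₂, Set.mem_iUnion, exists_prop]
  have hfin₁ : S₁.Finite := by
    refine Set.Finite.biUnion (Set.toFinite _) fun P hP => Set.Finite.biUnion (Set.toFinite _)
      fun Q hQ => ?_
    obtain ⟨B, hB, h⟩ := exists_isMin_subset R hP.1
    rw [hB.coweights_eq hP.1 hQ.1 h hQ.2]
    exact Set.toFinite _
  have hfin₂ : S₂.Finite :=
    Set.Finite.biUnion (Set.toFinite _) fun Q _ => (Set.toFinite _).image _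
  refine ⟨Subtype.val ⁻¹' (S₁ ∪ S₂),
    (hfin₁.union hfin₂).preimage Subtype.val_injective.injOn, ?_, ?_, ?_⟩
  · rintro v hv rfl
    rcases hv with hv | hv
    · obtain ⟨P, -, Q, -, hw⟩ := hmem₁.1 hv
      exact coweights_ne_zero hw rfl
    · obtain ⟨Q, hQ, hw⟩ := hmem₂.1 hv
      exact simpleCoroots_ne_zero hQ.1 hw rfl
  · intro P hP Q hQ w hw
    exact ⟨⟨w, coweights_mem_aReal hP Q hw⟩, Or.inl (hmem₁.2 ⟨P, hP, Q, hQ, hw⟩), rfl⟩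
  · intro Q hQ w hw
    exact ⟨⟨w, simpleCoroots_mem_aReal (exists_mem_parabolicsOfLevi hM hQ).1 hw⟩,
      Or.inr (hmem₂.2 ⟨Q, hQ, hw⟩), rfl⟩

/-- The formula `φ_M(λ) = ∑_P c_P(φ_P, λ)` away from the zeros of the denominators. -/
theorem sum_cFunction_eq (hq : 1 < q) (hM : IsLevi R M)
    {φ : parabolicsOfLevi R M → aC R M → ℂ} (hφ : IsPeriodicCofamily R q Ω φ)
    (hξ : GeneralPosition R q M ξ) (hU : IsOpen U) (hUΩ : U ⊆ Ω)
    {C : parabolicsOfLevi R M → aC R M → ℂ} (hC : ∀ P, IsCFunction R q U ξ P.1 (φ P) (C P))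
    (hΩ : ∀ l ∈ U, ∀ n ∈ lat R q M, ∀ Q ∈ parabolicsContaining R M, projC R Q (l + n) ∈ Ω)
    (hinv : ∀ l ∈ U, ∀ P, ∀ n ∈ lat R q M, φ P (projC R Set.univ (l + n)) = φ P l)
    {l : aC R M} (hl : l ∈ U)
    (hreg : ∀ P ∈ parabolicsOfLevi R M, ∀ w ∈ coweights R P Set.univ, qpow R q l w ≠ 1) :
    ∑ᶠ P, C P l = ∑ᶠ P : parabolicsOfLevi R M, varthetaHat R q P.1 Set.univ l * φ P l := by
  have := Fintype.ofFinite (parabolicsOfLevi R M)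
  obtain ⟨N, b, b', hN, hGP⟩ := hξ
  obtain ⟨P₀, hP₀⟩ := id hM
  obtain ⟨S, hS, hS0, hS1, hS2⟩ := hM.finite_vectors
  -- Denominators of the $c_{P,\mathfrak N}$ may vanish at `l` although those of $\varphi_M$ do not.
  -- The identity is therefore taken at generic points of a line and passed to the limit by
  -- continuity.
  obtain ⟨d, hd⟩ := exists_direction hS hS0 l
  simp only [finsum_eq_sum_of_fintype]
  have hb0 : (b : ℝ)⁻¹ ≠ 0 := inv_ne_zero (by exact_mod_cast (by have := hN.one_le_b; omega))
  have hleft : Tendsto (fun t : ℝ => ∑ P, C P (l + (t : ℂ) • d)) (𝓝[≠] 0) (𝓝 (∑ P, C P l)) :=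
    tendsto_finsetSum _ fun P _ => tendsto_line (continuousAt_of_differentiableOn hU (hC P).1 hl) d
  have hright : Tendsto (fun t : ℝ => ∑ P : parabolicsOfLevi R M,
      varthetaHat R q P.1 Set.univ (l + (t : ℂ) • d) * φ P (l + (t : ℂ) • d)) (𝓝[≠] 0)
      (𝓝 (∑ P : parabolicsOfLevi R M, varthetaHat R q P.1 Set.univ l * φ P l)) :=
    tendsto_finsetSum _ fun P _ =>
      (tendsto_line (continuousAt_varthetaHat hq P.2.1 (hreg P.1 P.2)) d).mul
        (tendsto_line (continuousAt_of_differentiableOn hφ.isOpen (hφ.holomorphic P) (hUΩ hl)) d)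
  refine tendsto_nhds_unique_of_eventuallyEq hleft hright ?_
  filter_upwards [hd, eventually_line_mem hU hl d] with t ht htU
  set μ : aC R M := l + (t : ℂ) • d with hμ
  -- A nonzero real part forces $|q^{-\langle\lambda,v\rangle}|\ne1$. It is unchanged by the
  -- imaginary translates and only rescaled by $b^{-1}$, so one condition covers every denominator.
  have hre : ∀ n ∈ lat R q M, ∀ v ∈ S, (extend R (μ + n) v).re ≠ 0 := by
    intro n hn v hv
    rw [re_extend_add_lat hn, extend_of_mem R _ v.2]
    exact ht v hv
  have hreg₂ : ∀ n ∈ lat R q M, ∀ Q ∈ parabolicsContaining R M,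
      ∀ v ∈ simpleCoroots R Q Set.univ, qpow R q ((b : ℂ)⁻¹ • (μ + n)) v ≠ 1 := by
    intro n hn Q hQ v hv
    obtain ⟨v', hv', rfl⟩ := hS2 Q hQ v hv
    rw [qpow_inv_smul]
    refine qpow_ne_one_of_re_ne_zero hq ?_
    rw [map_smul, smul_re, smul_eq_mul]
    exact mul_ne_zero hb0 (hre n hn v' hv')
  have hC' : ∀ P : parabolicsOfLevi R M, C P μ = cTriplet R q N b ξ P.1 (φ P) μ := by
    intro P
    refine (hC P).2 N b b' hN μ htU fun n hn Q hQ => ⟨fun w hw => ?_, fun v hv => ?_⟩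
    · obtain ⟨w', hw', rfl⟩ := hS1 P.1 P.2 Q hQ w hw
      exact qpow_ne_one_of_re_ne_zero hq (hre n (hN.subset_lat hP₀ hn) w' hw')
    · exact hreg₂ n (hN.subset_lat hP₀ hn) Q
        ⟨hQ.1, (subset_of_mem_parabolicsOfLevi P.2).trans hQ.2⟩ v hv
  have h := sum_cTriplet hq hM hφ hN hGP (hΩ μ htU) hreg₂ (hinv μ htU)
  simp only [finsum_eq_sum_of_fintype] at h
  rw [← h]
  exact Finset.sum_congr rfl fun P _ => hC' P

end Formula

end Cofamily

end
-- The theorem.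
open Cofamily

theorem mainTheorem5 {ι X Y : Type*} [Finite ι] [AddCommGroup X] [Module ℝ X]
    [NormedAddCommGroup Y] [NormedSpace ℝ Y] [FiniteDimensional ℝ Y]
    (R : RootPairing ι ℝ X Y) [R.IsCrystallographic]
    (q : ℕ) (hq : 1 < q) (M : Set ι) (hM : Cofamily.IsLevi R M)
    (Ω : Set (Cofamily.aC R M))
    (φ : Cofamily.parabolicsOfLevi R M → Cofamily.aC R M → ℂ)
    (hφ : Cofamily.IsPeriodicCofamily R q Ω φ)
    (hprod : ∀ P, Cofamily.IsProductForm R q P.1 Ω (φ P)) :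
    (∃ (N : Finset (Cofamily.aC R M)) (b b' : ℕ), Cofamily.IsDualTriplet R q M N b b') ∧
    ∀ ξ : Y, Cofamily.GeneralPosition R q M ξ →
      ∃ U : Set (Cofamily.aC R M), IsOpen U ∧ Cofamily.imaginary R M ⊆ U ∧ U ⊆ Ω ∧
        ∃ (Φ : Cofamily.aC R M → ℂ)
          (C : Cofamily.parabolicsOfLevi R M → Cofamily.aC R M → ℂ),
          Cofamily.IsPhiM R q U φ Φ ∧
          (∀ P, Cofamily.IsCFunction R q U ξ P.1 (φ P) (C P)) ∧
          ∀ l ∈ U, Φ l = ∑ᶠ P, C P l := by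
  refine ⟨exists_isDualTriplet hM hq, fun ξ hξ => ?_⟩
  have := Fintype.ofFinite (parabolicsOfLevi R M)
  -- This triplet only shapes the domain `U`; the one supplied by general position enters through
  -- `sum_cFunction_eq`.
  obtain ⟨N, b, b', hN⟩ := exists_isDualTriplet hM hq
  obtain ⟨P₀, hP₀⟩ := id hM
  choose T C hT hTi hC hCeq hCinv using fun P : parabolicsOfLevi R M =>
    exists_cFunction hq P.2 (hprod P) ξ
  have hΩlat : ∀ n ∈ lat R q M, ∀ l ∈ Ω, l + n ∈ Ω := fun n hn =>
    hφ.invariant P₀ hP₀ n (by rwa [periodLattice_eq q hP₀])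
  set U : Set (aC R M) := (Ω ∩ ⋂ P, T P) ∩
    ⋂ Q ∈ parabolicsContaining R M, ⋂ n ∈ N, {l | projC R Q (l + n) ∈ Ω} with hU
  have hUΩ : U ⊆ Ω := fun l hl => hl.1.1
  have hUT : ∀ P, U ⊆ T P := fun P l hl => Set.mem_iInter.1 hl.1.2 P
  have hUopen : IsOpen U := by
    refine (hφ.isOpen.inter (isOpen_iInter_of_finite hT)).inter
      (Set.Finite.isOpen_biInter (Set.toFinite _) fun Q _ => isOpen_biInter_finset fun n _ => ?_)
    exact hφ.isOpen.preimage ((continuous_projC Q).comp (continuous_add_form n))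
  have hUim : imaginary R M ⊆ U := by
    refine fun l hl => ⟨⟨hφ.imaginary_subset hl, Set.mem_iInter.2 fun P => hTi P hl⟩, ?_⟩
    simp only [Set.mem_iInter]
    exact fun Q _ n hn => hφ.imaginary_subset
      (projC_mem_imaginary (add_mem_imaginary (hN.subset_lat hP₀ hn) hl) Q)
  have hproj : ∀ l ∈ U, ∀ n ∈ lat R q M, ∀ Q ∈ parabolicsContaining R M,
      projC R Q (l + n) ∈ Ω := by
    intro l hl n hn Q hQ
    obtain ⟨-, P, hP, hQP⟩ := exists_mem_parabolicsOfLevi hM hQ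
    refine hN.projC_add_mem hP hQP hΩlat (fun n₀ hn₀ => ?_) hn
    have h := hl.2
    simp only [Set.mem_iInter] at h
    exact h Q hQ n₀ hn₀
  have hcont : ∀ P : parabolicsOfLevi R M, ∀ Q ∈ parabolicsContaining R P.1,
      Q ∈ parabolicsContaining R M := fun P Q hQ =>
    ⟨hQ.1, (subset_of_mem_parabolicsOfLevi P.2).trans hQ.2⟩
  have hCf : ∀ P, IsCFunction R q U ξ P.1 (φ P) (C P) := fun P =>
    ⟨(hC P).mono (hUT P), fun N b b' hN l hl => hCeq P l (hUT P hl)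
      (fun n hn Q hQ => hproj l hl n hn Q (hcont P Q hQ)) N b b' hN⟩
  -- With the continuation of $\varphi_M$ taken to be the sum of the `C P`, the final identity is
  -- definitional. What remains is its holomorphy and its agreement with the defining sum off the
  -- denominators.
  refine ⟨U, hUopen, hUim, hUΩ, fun l => ∑ᶠ P, C P l, C, ⟨?_, fun l hl hreg => ?_⟩, hCf,
    fun _ _ => rfl⟩
  · simp only [finsum_eq_sum_of_fintype]
    exact differentiableOn_sum fun P => (hCf P).1
  · exact sum_cFunction_eq hq hM hφ hξ hUopen hUΩ hCf hproj (fun l hl P n hn =>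
      hCinv P l (hUT P hl) (hUΩ hl) n hn (hproj l hl n hn _
        ⟨isParabolic_univ R, Set.subset_univ _⟩)) hl hreg
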